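/- **Setting.** Fix constants $q>2$, $A>0$, $L_0,L>0$, $c_1\in(0,1)$, $c_2>0$, $a_1,a_2>0$ and an integer $\iota\ge 0$, none of which depends on the sample size $n$ or the dimension $p$. Along a sequence of pairs $(n,p)$ with $n\to\infty$ and $p\to\infty$, let $(\varepsilon_i)_{i\in\mathbb Z}$ be i.i.d. random vectors in $\mathbb R^p$ with an independent copy $(\varepsilon_i')_{i\in\mathbb Z}$, let $\mathcal F_i=(\dots,\varepsilon_{i-1},\varepsilon_i)$, let $\mathcal F_{i,\{m\}}$ be $\mathcal F_i$ with $\varepsilon_{i-m}$ replaced by $\varepsilon_{i-m}'$, let $H=(H_1,\dots,H_p)$ be jointly measurable, $X^\circ_{i}(t)=H(\mathcal F_i;t)$ for $t\in[0,1]$, and suppose that $X_i=X_i^\circ(i/n)$, $1\le i\le n$, is observed. (All these objects may change with $(n,p)$.) Put $\|Y\|_a=(\mathbb E|Y|^a)^{1/a}$, $$\theta_{m,a,j}=\sup_{0\le t\le1}\|H_j(\mathcal F_0;t)-H_j(\mathcal F_{0,\{m\}};t)\|_a,\qquad \|X_{\cdot,j}\|_{a,A}=\sup_{m\ge0}(m+1)^A\sum_{i\ge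 m}\theta_{i,a,j},$$ $\sigma_{jk}(t)=\mathbb E[H_j(\mathcal F_0;t)H_k(\mathcal F_0;t)]$, $\Sigma(t)=(\sigma_{jk}(t))_{j,k}$, and $|B|_\infty=\max_{j,k}|b_{jk}|$ for a matrix $B$. **Assumptions.** 1. (Dependence and moments.) $\nu_{2q}:=\sup_{n,p}\sup_{t\in[0,1]}\max_{j\le p}\mathbb E|X^\circ_{0j}(t)|^{2q}<\infty$, and $\max_{j\le p}\|X_{\cdot,j}\|_{2q,A}<\infty$ for each $(n,p)$. 2. (Piecewise smoothness.) $\mathbb E X_0^\circ(t)=0$ for all $t\in[0,1]$, and there are $0=t^{(0)}<t^{(1)}<\dots<t^{(\iota)}<t^{(\iota+1)}=1$ (which may depend on $(n,p)$) such that for all $l$ and all $s,t\in[t^{(l)},t^{(l+1)})$: $\max_j\|H_j(\mathcal F_0;t)-H_j(\mathcal F_0;s)\|_2\le L_0|t-s|$; every $\sigma_{jk}$ is $C^2$ on $[t^{(l)},t^{(l+1)})$; and $L$ is a Lipschitz constant of $\Sigma$ there, $|\Sigma(t)-\Sigma(s)|_\infty\le L|t-s|$. (If $\sup_{n,p,t,j}\|H_j(\mathcal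 F_0;t)\|_2\le C$, then $L=2CL_0$ has the last property.) 3. (Separated and sizeable jumps.) $\min_{0\le l\le\iota}(t^{(l+1)}-t^{(l)})\ge c_1$, and $|\Sigma(t^{(l)})-\Sigma(t^{(l)}-)|_\infty\ge c_2$ for $1\le l\le\iota$. **Quantities.** $M_{X,q}=\big(\sum_{j\le p}\|X_{\cdot,j}\|_{2q,A}^q\big)^{1/q}$, $N_X=\max_{j\le p}\|X_{\cdot,j}\|_{4,A}$; $\varpi_{q,A}(n)=n$, $n(\log n)^{1+2q}$, $n^{q/2-Aq}$ according to whether $A>\frac12-\frac1q$, $A=\frac12-\frac1q$, $A<\frac12-\frac1q$; $J_{q,A}(n,p)=M_{X,q}(p\,\varpi_{q,A}(n))^{1/q}$; and $$h_\diamond=a_1\big(n^{-1}J_{q,A}(n,p)\big)^{1/3}+a_2N_X^{1/3}n^{-1/6}(\log p)^{1/6}.$$ Assume $h_\diamond>0$ and $h_\diamond=o(1)$. **Detector.** Use the bandwidth $h=h_\diamond$ and the threshold $\nu=(1+L)h_\diamond^2$. Let $b=\lfloor nh\rfloor$ and, for $m\in\{b,\dots,n-b\}$, $$D(m/n)=n^{-1}\Big(\sum_{i=0}^{b-1}X_{m-i}X_{m-i}^\top-\sum_{i=1}^{b}X_{m+i}X_{m+i}^\top\Big).$$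 Let $\mathcal D(0)=\{m/n: b\le m\le n-b\}$. For $l=0,1,2,\dots$: stop with $\hat\iota=l$ if $|D(s)|_\infty<\nu$ for all $s\in\mathcal D(l)$ (in particular if $\mathcal D(l)=\emptyset$); otherwise let $\hat s_{l+1}$ be a maximizer of $|D(s)|_\infty$ over $\mathcal D(l)$ (ties are broken arbitrarily) and $\mathcal D(l+1)=\{s\in\mathcal D(l):|s-\hat s_{l+1}|>2b/n\}$. **Theorem (consistency of change point estimation).** There are constants $C_1,C_2,C_3>0$ independent of $n$ and $p$ such that $$\mathbb P(\hat\iota\ne\iota)\le C_1\Big(\frac{p\,\varpi_{q,A}(n)\,M_{X,q}^q\,\nu_{2q}^q}{n^q c_2^q}\Big)^{1/3}+C_2\,p^2\exp\Big\{-C_3\Big(\frac{n\log^2 p}{N_X^2}\Big)^{1/3}\Big\}.$$ Furthermore, on the event $\{\hat\iota=\iota\}$ the ordered estimates $\hat s_{(1)}<\dots<\hat s_{(\hat\iota)}$ satisfy $\max_{1\le j\le\iota}|\hat s_{(j)}-t^{(j)}|=O_{\mathbb P}(h_\diamond^2)$; that is, for every $\delta>0$ there is a $C>0$ with $\mathbb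 P\big(\hat\iota=\iota,\ \max_{1\le j\le\iota}|\hat s_{(j)}-t^{(j)}|>C h_\diamond^2\big)<\delta$ for all $(n,p)$ in the sequence. -/

import Mathlib

open MeasureTheory ProbabilityTheory Filter Topology

noncomputable section

namespace ChangePoint

/-- The causal time series `X°_i(t) = H(F_i; t)`, `F_i = (…, ε_{i-1}, ε_i)`, in dimension `p`:
i.i.d. innovations `ε_i` in `ℝ^p`, an independent copy `ε'_i` of them, and a jointly measurable
function `H` of the past (the past is listed backwards: entry `m` is the innovation of lag `m`)
and of the rescaled time `t`. -/
structure CausalModel (Ω : Type*) [MeasurableSpace Ω] (P : Measure Ω) (p : ℕ) where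
  ε : ℤ → Ω → Fin p → ℝ
  ε' : ℤ → Ω → Fin p → ℝ
  measurable_ε : ∀ i, Measurable (ε i)
  measurable_ε' : ∀ i, Measurable (ε' i)
  indep : iIndepFun (fun i : ℤ ⊕ ℤ => Sum.elim ε ε' i) P
  ident : ∀ i, IdentDistrib (ε i) (ε 0) P P
  ident' : ∀ i, IdentDistrib (ε' i) (ε 0) P P
  H : (ℕ → Fin p → ℝ) → ℝ → Fin p → ℝ
  measurable_H : Measurable (fun x : (ℕ → Fin p → ℝ) × ℝ => H x.1 x.2)

namespace CausalModel

variable {Ω : Type*} [MeasurableSpace Ω] {P : Measure Ω} {p : ℕ}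

/-- `F_i`. -/
def past (M : CausalModel Ω P p) (i : ℤ) (ω : Ω) : ℕ → Fin p → ℝ :=
  fun m => M.ε (i - m) ω

/-- `F_{i,{m}}`: in `F_i` the innovation `ε_{i-m}` is replaced by its copy `ε'_{i-m}`. -/
def pastCoupled (M : CausalModel Ω P p) (i : ℤ) (m : ℕ) (ω : Ω) : ℕ → Fin p → ℝ :=
  Function.update (M.past i ω) m (M.ε' (i - m) ω)

/-- `X°_i(t)`. -/
def X (M : CausalModel Ω P p) (i : ℤ) (t : ℝ) (ω : Ω) : Fin p → ℝ :=
  M.H (M.past i ω) t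

/-- `X°_{i,{m}}(t)`. -/
def XCoupled (M : CausalModel Ω P p) (i : ℤ) (m : ℕ) (t : ℝ) (ω : Ω) : Fin p → ℝ :=
  M.H (M.pastCoupled i m ω) t

/-- The observations `X_i = X°_i(i/n)` of a sample of size `n` (used for `1 ≤ i ≤ n`). -/
def obs (M : CausalModel Ω P p) (n : ℕ) (ω : Ω) (i : ℕ) : Fin p → ℝ :=
  M.X (i : ℤ) ((i : ℝ) / (n : ℝ)) ω

/-- The covariance function `σ_{jk}(t)`. -/
def cov (M : CausalModel Ω P p) (j k : Fin p) (t : ℝ) : ℝ :=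
  ∫ ω, M.X 0 t ω j * M.X 0 t ω k ∂P

/-- The uniform functional dependence measure `θ_{m,a,j}`. By stationarity in `i` it does not
matter which `i` is taken. -/
def depMeasure (M : CausalModel Ω P p) (a : ℝ) (j : Fin p) (m : ℕ) : ENNReal :=
  ⨆ t ∈ Set.Icc (0 : ℝ) 1,
    eLpNorm (fun ω => M.X 0 t ω j - M.XCoupled 0 m t ω j) (ENNReal.ofReal a) P

/-- The dependence adjusted norm
`‖X_{·,j}‖_{a,A} = sup_m (m+1)^A ∑_{i ≥ m} θ_{i,a,j}`, possibly infinite. -/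
def dan (M : CausalModel Ω P p) (a A : ℝ) (j : Fin p) : ENNReal :=
  ⨆ m : ℕ, ENNReal.ofReal (((m : ℝ) + 1) ^ A) * ∑' i : ℕ, M.depMeasure a j (m + i)

/-- `sup_{t ∈ [0,1]} max_j E |X°_j(t)|^{2q}`, possibly infinite. -/
def momentSup (M : CausalModel Ω P p) (q : ℝ) : ENNReal :=
  ⨆ t ∈ Set.Icc (0 : ℝ) 1, ⨆ j : Fin p, ∫⁻ ω, ENNReal.ofReal (|M.X 0 t ω j| ^ (2 * q)) ∂P

/-- `N_{X,a} = max_j ‖X_{·,j}‖_{a,A}`, possibly infinite. -/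
def maxDan (M : CausalModel Ω P p) (a A : ℝ) : ENNReal :=
  ⨆ j : Fin p, M.dan a A j

/-- `N_X = N_{X,4}`. -/
def NX (M : CausalModel Ω P p) (A : ℝ) : ℝ :=
  (M.maxDan 4 A).toReal

/-- `M_{X,q} = (∑_j ‖X_{·,j}‖_{2q,A}^q)^{1/q}`. -/
def MX (M : CausalModel Ω P p) (q A : ℝ) : ℝ :=
  (∑ j : Fin p, (M.dan (2 * q) A j).toReal ^ q) ^ (1 / q)

/-- `0 = t^{(0)} < t^{(1)} < ⋯ < t^{(ι)} < t^{(ι+1)} = 1`. -/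
structure IsPartition {ι : ℕ} (t : Fin (ι + 2) → ℝ) : Prop where
  strictMono : StrictMono t
  first : t 0 = 0
  last : t (Fin.last (ι + 1)) = 1

/-- The `l`-th piece `[t^{(l)}, t^{(l+1)})`, for `0 ≤ l ≤ ι`. -/
def piece {ι : ℕ} (t : Fin (ι + 2) → ℝ) (l : Fin (ι + 1)) : Set ℝ :=
  Set.Ico (t l.castSucc) (t l.succ)

/-- The process is mean zero, and all its coordinates are stochastically Lipschitz with
constant `L₀` (in the norm of `L²`) on each piece of the partition. -/
structure IsPLS (M : CausalModel Ω P p) {ι : ℕ} (t : Fin (ι + 2) → ℝ) (L₀ : ℝ) : Prop where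
  partition : IsPartition t
  mean_zero : ∀ s ∈ Set.Icc (0 : ℝ) 1, ∀ j : Fin p,
    Integrable (fun ω => M.X 0 s ω j) P ∧ ∫ ω, M.X 0 s ω j ∂P = 0
  lipschitz : ∀ l : Fin (ι + 1), ∀ s ∈ piece t l, ∀ s' ∈ piece t l, ∀ j : Fin p,
    eLpNorm (fun ω => M.X 0 s ω j - M.X 0 s' ω j) 2 P ≤ ENNReal.ofReal (L₀ * |s - s'|)

/-- All entries of the covariance function are `C²` on each piece. -/
def CovC2 (M : CausalModel Ω P p) {ι : ℕ} (t : Fin (ι + 2) → ℝ) : Prop :=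
  ∀ l : Fin (ι + 1), ∀ j k : Fin p, ContDiffOn ℝ 2 (M.cov j k) (piece t l)

/-- `L` is a Lipschitz constant of the covariance function on each piece, in the max norm. -/
def CovLipschitz (M : CausalModel Ω P p) {ι : ℕ} (t : Fin (ι + 2) → ℝ) (L : ℝ) : Prop :=
  ∀ l : Fin (ι + 1), ∀ s ∈ piece t l, ∀ s' ∈ piece t l, ∀ j k : Fin p,
    |M.cov j k s - M.cov j k s'| ≤ L * |s - s'|

end CausalModel

/-- `|B|_∞ = max_{j,k} |b_{jk}|`. -/
def maxNorm {p : ℕ} (B : Matrix (Fin p) (Fin p) ℝ) : ℝ :=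
  ⨆ x : Fin p × Fin p, |B x.1 x.2|

namespace CausalModel

variable {Ω : Type*} [MeasurableSpace Ω] {P : Measure Ω} {p : ℕ}

/-- The jump `Δ(s) = Σ(s) - Σ(s-)` of the covariance function. -/
def jump (M : CausalModel Ω P p) (s : ℝ) : Matrix (Fin p) (Fin p) ℝ :=
  Matrix.of fun j k => M.cov j k s - Function.leftLim (M.cov j k) s

/-- The change points are separated and their jumps are sizeable. -/
structure SeparatedSizeable (M : CausalModel Ω P p) {ι : ℕ} (t : Fin (ι + 2) → ℝ)
    (c₁ c₂ : ℝ) : Prop where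
  separated : ∀ l : Fin (ι + 1), c₁ ≤ t l.succ - t l.castSucc
  sizeable : ∀ l : Fin ι, c₂ ≤ maxNorm (M.jump (t l.succ.castSucc))

end CausalModel

/-- `ϖ_{q,A}(n)`. -/
def varpi (q A : ℝ) (n : ℕ) : ℝ :=
  if 1 / 2 - 1 / q < A then (n : ℝ)
  else if A = 1 / 2 - 1 / q then (n : ℝ) * Real.log n ^ (1 + 2 * q)
  else (n : ℝ) ^ (q / 2 - A * q)

namespace CausalModel

variable {Ω : Type*} [MeasurableSpace Ω] {P : Measure Ω} {p : ℕ}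

/-- `J_{q,A}(n,p) = M_{X,q} (p ϖ_{q,A}(n))^{1/q}`. -/
def J (M : CausalModel Ω P p) (q A : ℝ) (n : ℕ) : ℝ :=
  M.MX q A * ((p : ℝ) * varpi q A n) ^ (1 / q)

/-- `h_⋄ = a₁ (J_{q,A}(n,p) / n)^{1/3} + a₂ N_X^{1/3} n^{-1/6} (log p)^{1/6}`. -/
def bandwidth (M : CausalModel Ω P p) (q A a₁ a₂ : ℝ) (n : ℕ) : ℝ :=
  a₁ * ((n : ℝ)⁻¹ * M.J q A n) ^ (1 / 3 : ℝ)
    + a₂ * M.NX A ^ (1 / 3 : ℝ) * (n : ℝ) ^ (-(1 / 6) : ℝ) * Real.log p ^ (1 / 6 : ℝ)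

end CausalModel

/-- The local difference `D(m/n)` of the data `x_1, …, x_n`, with windows of `b` observations. -/
def localDiff {p : ℕ} (x : ℕ → Fin p → ℝ) (n b m : ℕ) : Matrix (Fin p) (Fin p) ℝ :=
  (n : ℝ)⁻¹ • (∑ i ∈ Finset.range b, Matrix.vecMulVec (x (m - i)) (x (m - i))
    - ∑ i ∈ Finset.Icc 1 b, Matrix.vecMulVec (x (m + i)) (x (m + i)))

/-- The search grids, a point `m/n` being represented by `m`: first `{b, b+1, …, n-b}`, and then
recursively the points at distance at most `2b` from the latest estimate are removed. Here `m̂ l`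
is the estimate number `l + 1`. -/
def searchGrid (n b : ℕ) (mhat : ℕ → ℕ) : ℕ → Finset ℕ
  | 0 => Finset.Icc b (n - b)
  | l + 1 => (searchGrid n b mhat l).filter fun m => 2 * (b : ℤ) < |(m : ℤ) - (mhat l : ℤ)|

/-- `mhat 0 / n, …, mhat (ihat - 1) / n` is an output of the recursive detector with bandwidth `h`
and threshold `thr` on the data `x_1, …, x_n`: every estimate is a maximizer (ties being broken in
any way) of `|D|_∞` on the current grid, and the search goes on exactly as long as this maximum is
at least `thr`. The window length is `h n` rounded down. -/
structure IsDetectorOutput {p : ℕ} (x : ℕ → Fin p → ℝ) (n : ℕ) (h thr : ℝ)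
    (ihat : ℕ) (mhat : ℕ → ℕ) : Prop where
  mem : ∀ l < ihat, mhat l ∈ searchGrid n ⌊h * n⌋₊ mhat l
  argmax : ∀ l < ihat, ∀ m ∈ searchGrid n ⌊h * n⌋₊ mhat l,
    maxNorm (localDiff x n ⌊h * n⌋₊ m) ≤ maxNorm (localDiff x n ⌊h * n⌋₊ (mhat l))
  continues : ∀ l < ihat, thr ≤ maxNorm (localDiff x n ⌊h * n⌋₊ (mhat l))
  stops : ∀ m ∈ searchGrid n ⌊h * n⌋₊ mhat ihat, maxNorm (localDiff x n ⌊h * n⌋₊ m) < thr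

/-- The first `ι` estimated locations `mhat 0 / n, …, mhat (ι - 1) / n` in increasing order. -/
def orderedEstimate (n ι : ℕ) (mhat : ℕ → ℕ) (j : Fin ι) : ℝ :=
  let s : Fin ι → ℝ := fun i => (mhat i : ℝ) / (n : ℝ)
  s (Tuple.sort s j)

/-- `max_{1 ≤ j ≤ ι} |ŝ_{(j)} - t^{(j)}|` (and `0` if `ι = 0`). -/
def locationError {ι : ℕ} (n : ℕ) (mhat : ℕ → ℕ) (t : Fin (ι + 2) → ℝ) : ℝ :=
  ⨆ j : Fin ι, |orderedEstimate n ι mhat j - t j.succ.castSucc|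

/-- The moment bound `ν_{2q}` of a family of models, i.e. the supremum over all sample sizes and
dimensions of `sup_{t ∈ [0,1]} max_j E |X°_j(t)|^{2q}`, possibly infinite. -/
def nu2q {Ω : ℕ → Type*} [∀ k, MeasurableSpace (Ω k)] {P : ∀ k, Measure (Ω k)} {p : ℕ → ℕ}
    (X : ∀ k, CausalModel (Ω k) (P k) (p k)) (q : ℝ) : ENNReal :=
  ⨆ k, (X k).momentSup q

/-- `Y_k = O_P(a_k)`. -/
def IsBigOP {Ω : ℕ → Type*} [∀ k, MeasurableSpace (Ω k)] (P : ∀ k, Measure (Ω k))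
    (Y : ∀ k, Ω k → ℝ) (a : ℕ → ℝ) : Prop :=
  ∀ δ : ℝ, 0 < δ → ∃ C : ℝ, 0 < C ∧
    ∀ k, P k {ω | C < |Y k ω| / a k} < ENNReal.ofReal δ

end ChangePoint

end

noncomputable section

namespace ChangePoint

set_option linter.unusedSectionVars false

/-! ### Fuk–Nagaev maximal inequality for independent summands -/

section FukNagaev

/-! The matrix `localDiff` is a deterministic part plus noise. The deterministic part is a window
difference of a piecewise Lipschitz covariance function. Away from the change points it is `O(h²)`.
Within one window of a change point it is, up to `O(h²)`, a tent of height about `h` times the jump.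
If all partial sums of the centred products are below `n h² / 8`, the noise is `O(h²)` as well, and
the threshold then separates the two regimes: whatever exceeds it lies within `b` of a change point,
and every change point exceeds it. Deleting `2b`-neighbourhoods makes the search visit each change
point exactly once (`exists_perm_of_search`). Comparing the maximum with the value at the change
point, through the slope of the tent, gives a location error of order `h²`
(`IsDetectorOutput.consistent`).

The probability enters through one maximal inequality for partial sums of products
(`exists_measure_products_le`) and a union bound over the `p²` pairs of coordinates. A functional of
the past minus its mean is written as `∑ j, D i j`, where `D i j` is the difference of its
conditional expectations given the latest `j + 1` and the latest `j` innovations. This difference is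
a conditional expectation of the coupling difference at lag `j` (`window_sub_ae_eq`), so the
dependence measure bounds its norm. Lags are grouped dyadically. For lags of size about `2^l`,
blocks of length `2^(l+1)` are independent when every second one is taken, and a Fuk–Nagaev
inequality applies, with block moments supplied by Burkholder's inequality. Lags beyond the sample
size need only Burkholder and a dyadic maximum. The decay `(u + 1)^(-A)` of the dependence tails
makes the polynomial terms add up to `varpi` and the Gaussian terms to a single one
(`exists_measure_partialSum_le`).

At the level `n h²`, the two summands of the bandwidth are exactly what turns the polynomial term
into a cube root and the exponential term into `exp(-C (n log² p / N_X²)^(1/3))`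
(`exists_calibration`, `exists_measure_noiseEvent_le`). The deterministic half holds once `h` is
small and `p` is large; the finitely many other indices are absorbed into the constants. -/

lemma exp_le_one_add_add_sq {u c : ℝ} (hc : 1 ≤ c) (hu : u ≤ c) :
    Real.exp u ≤ 1 + u + Real.exp c * u ^ 2 := by
  have hec : 1 ≤ Real.exp c := Real.one_le_exp (by linarith)
  rcases le_or_gt (-c) u with h | h
  · have h1 := Complex.norm_exp_sub_sum_le_norm_mul_exp (u : ℂ) 2
    have h2 : Complex.exp (u : ℂ) - ∑ m ∈ Finset.range 2, (u : ℂ) ^ m / (m.factorial : ℂ)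
        = ((Real.exp u - (1 + u) : ℝ) : ℂ) := by
      simp [Finset.sum_range_succ]
    rw [h2, Complex.norm_real, Complex.norm_real, Real.norm_eq_abs, Real.norm_eq_abs, sq_abs] at h1
    have h3 : |u| ≤ c := abs_le.2 ⟨h, hu⟩
    have h4 : u ^ 2 * Real.exp |u| ≤ Real.exp c * u ^ 2 := by
      rw [mul_comm]
      gcongr
    linarith [le_abs_self (Real.exp u - (1 + u))]
  -- Here `u < -c ≤ -1`, so `u + u ^ 2 ≥ 0`. No lower bound on `u` is needed, which suits variables
  -- truncated from above only.
  · have h1 : Real.exp u ≤ 1 := Real.exp_le_one_iff.2 (by linarith)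
    nlinarith [sq_nonneg u]

/-- As long as `t * min s y ≤ q` the quadratic bound applies. Beyond that, `η ↦ exp (t * η) / η ^ q`
is increasing, so its value at `min s y` is at most the one at `y`; this is the last term. -/
lemma exp_truncation_le {q : ℝ} (hq : 1 ≤ q) {t y s : ℝ} (ht : 0 ≤ t) (hy : 0 < y) :
    Real.exp (t * min s y) ≤ 1 + t * s + Real.exp q * t ^ 2 * s ^ 2
      + Real.exp (t * y) * (|s| ^ q / y ^ q) := by
  set η := min s y with hη
  have hηs : η ≤ s := min_le_left _ _
  have hηy : η ≤ y := min_le_right _ _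
  have hsq : η ^ 2 ≤ s ^ 2 := by
    rcases le_total s y with h | h
    · rw [hη, min_eq_left h]
    · rw [hη, min_eq_right h]; exact pow_le_pow_left₀ hy.le h 2
  have hlast : 0 ≤ Real.exp (t * y) * (|s| ^ q / y ^ q) := by positivity
  have hts : t * η ≤ t * s := by gcongr
  have hmid : Real.exp q * t ^ 2 * η ^ 2 ≤ Real.exp q * t ^ 2 * s ^ 2 := by gcongr
  rcases le_or_gt (t * η) q with h | h
  · have := exp_le_one_add_add_sq hq h
    nlinarith
  · have hu : 0 < t * η := by linarith
    have htp : 0 < t := by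
      rcases ht.eq_or_lt with h0 | h0
      · rw [← h0] at hu; simp at hu
      · exact h0
    have hηp : 0 < η := pos_of_mul_pos_right hu ht
    have h1 : (y / η) ^ q ≤ Real.exp (t * y - t * η) := by
      have hyη : 1 ≤ y / η := (one_le_div hηp).2 hηy
      rw [Real.rpow_def_of_pos (by positivity)]
      apply Real.exp_le_exp.2
      have hl := Real.log_le_sub_one_of_pos (show 0 < y / η by positivity)
      calc Real.log (y / η) * q ≤ (y / η - 1) * (t * η) := by
            apply mul_le_mul hl h.le (by linarith) (by linarith)
        _ = t * y - t * η := by field_simp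
    have h2 : Real.exp (t * η) ≤ Real.exp (t * y) * (|s| ^ q / y ^ q) := by
      have hy' : 0 < y ^ q := by positivity
      have hη' : 0 < η ^ q := by positivity
      rw [Real.div_rpow hy.le hηp.le, Real.exp_sub, div_le_div_iff₀ hη' (by positivity)] at h1
      have h3 : η ^ q ≤ |s| ^ q :=
        Real.rpow_le_rpow hηp.le (hηs.trans (le_abs_self s)) (by linarith)
      calc Real.exp (t * η) ≤ Real.exp (t * y) * (η ^ q / y ^ q) := by
            rw [mul_div_assoc', le_div_iff₀ hy']; linarith
        _ ≤ _ := by gcongr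
    nlinarith [sq_nonneg (t * s), Real.exp_pos q, mul_nonneg (mul_nonneg (Real.exp_pos q).le (sq_nonneg t)) (sq_nonneg s)]

variable {Ω : Type*} [mΩ : MeasurableSpace Ω] {P : Measure Ω} [IsProbabilityMeasure P]

/-- Doob's maximal inequality by hand: `W k` is `exp (t * S k)`, frozen at `exp (t * x)` as soon as
the level `x` has been reached. A step multiplies its mean by at most `exp v`, since `ξ k` is
independent of `𝓕 k`, and Markov's inequality at time `R` concludes. -/
lemma measure_exists_le_sum_le_exp {ξ : ℕ → Ω → ℝ} {𝓕 : ℕ → MeasurableSpace Ω}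
    (hmono : Monotone 𝓕) (hle : ∀ r, 𝓕 r ≤ mΩ) (hadp : ∀ r, Measurable[𝓕 (r + 1)] (ξ r))
    (hind : ∀ r, Indep (𝓕 r) (MeasurableSpace.comap (ξ r) inferInstance) P)
    {t v : ℝ} (ht : 0 ≤ t) (hv : 0 ≤ v) {R : ℕ}
    (hexp : ∀ r < R, ∫⁻ ω, ENNReal.ofReal (Real.exp (t * ξ r ω)) ∂P
      ≤ ENNReal.ofReal (Real.exp v)) (x : ℝ) :
    P {ω | ∃ k ≤ R, x ≤ ∑ r ∈ Finset.range k, ξ r ω}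
      ≤ ENNReal.ofReal (Real.exp (-(t * x) + R * v)) := by
  classical
  set S : ℕ → Ω → ℝ := fun k ω => ∑ r ∈ Finset.range k, ξ r ω with hS
  set hit : ℕ → Set Ω := fun k => {ω | ∃ j ≤ k, x ≤ S j ω} with hhit
  have hSm : ∀ k, Measurable[𝓕 k] (S k) := fun k =>
    @Finset.measurable_fun_sum _ _ _ _ _ _ (𝓕 k) _ _ fun r hr =>
      (hadp r).mono (hmono (Finset.mem_range.1 hr)) le_rfl
  have hhitm : ∀ k, MeasurableSet[𝓕 k] (hit k) := by
    intro k
    have : hit k = ⋃ j ∈ Finset.range (k + 1), {ω | x ≤ S j ω} := by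
      ext ω; simp [hhit]
    rw [this]
    refine @Finset.measurableSet_biUnion _ _ (𝓕 k) _ _ fun j hj => ?_
    exact ((hSm j).mono (hmono (by simpa using hj)) le_rfl) measurableSet_Ici
  set W : ℕ → Ω → ENNReal := fun k ω =>
    if ω ∈ hit k then ENNReal.ofReal (Real.exp (t * x)) else ENNReal.ofReal (Real.exp (t * S k ω))
  have hmain : ∀ k ≤ R, ∫⁻ ω, W k ω ∂P ≤ ENNReal.ofReal (Real.exp (k * v)) := by
    intro k
    induction k with
    | zero =>
      intro _
      calc ∫⁻ ω, W 0 ω ∂P ≤ ∫⁻ _, 1 ∂P := by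
            apply lintegral_mono
            intro ω
            simp only [W]
            split_ifs with h
            · have hx : x ≤ 0 := by
                obtain ⟨j, hj, hx⟩ := h
                simpa [hS, Nat.le_zero.1 hj] using hx
              simpa using mul_nonpos_of_nonneg_of_nonpos ht hx
            · simp [hS]
        _ ≤ _ := by simp
    | succ k ih =>
      intro hk
      set A : Ω → ENNReal := (hit k).indicator fun _ => ENNReal.ofReal (Real.exp (t * x))
      set B : Ω → ENNReal := (hit k)ᶜ.indicator fun ω => ENNReal.ofReal (Real.exp (t * S k ω))
      set G : Ω → ENNReal := fun ω => ENNReal.ofReal (Real.exp (t * ξ k ω))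
      have hBm : Measurable[𝓕 k] B := by
        refine Measurable.indicator (m := 𝓕 k) ?_ (hhitm k).compl
        exact ENNReal.measurable_ofReal.comp (Real.measurable_exp.comp ((hSm k).const_mul t))
      have hGm : Measurable[MeasurableSpace.comap (ξ k) inferInstance] G :=
        (ENNReal.measurable_ofReal.comp (Real.measurable_exp.comp
          (measurable_id.const_mul t))).comp (comap_measurable _)
      have hW : ∀ ω, W (k + 1) ω ≤ A ω + B ω * G ω := by
        intro ω
        by_cases h : ω ∈ hit k
        · have h' : ω ∈ hit (k + 1) := by
            obtain ⟨j, hj, hx⟩ := h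
            exact ⟨j, by omega, hx⟩
          simp [W, A, B, h, h']
        · have hs : S (k + 1) ω = S k ω + ξ k ω := Finset.sum_range_succ _ _
          have hBG : B ω * G ω = ENNReal.ofReal (Real.exp (t * S (k + 1) ω)) := by
            simp only [B, G, Set.indicator_of_mem (show ω ∈ (hit k)ᶜ from h)]
            rw [← ENNReal.ofReal_mul (Real.exp_pos _).le, ← Real.exp_add, hs, mul_add]
          simp only [A, Set.indicator_of_notMem h, zero_add, hBG, W]
          split_ifs with h'
          · obtain ⟨j, hj, hx⟩ := h'
            rcases Nat.lt_or_ge j (k + 1) with hj' | hj'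
            · exact absurd ⟨j, by omega, hx⟩ h
            · have : j = k + 1 := by omega
              subst this
              exact ENNReal.ofReal_le_ofReal (Real.exp_le_exp.2 (by gcongr))
          · exact le_rfl
      have hAB : ∀ ω, A ω + B ω = W k ω := by
        intro ω
        by_cases h : ω ∈ hit k <;> simp [A, B, W, h]
      have hAm : Measurable A := measurable_const.indicator (hle k _ (hhitm k))
      calc ∫⁻ ω, W (k + 1) ω ∂P ≤ ∫⁻ ω, A ω + B ω * G ω ∂P := lintegral_mono hW
        _ = ∫⁻ ω, A ω ∂P + (∫⁻ ω, B ω ∂P) * ∫⁻ ω, G ω ∂P := by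
            rw [lintegral_add_left hAm,
              lintegral_mul_eq_lintegral_mul_lintegral_of_independent_measurableSpace (hle k)
                ?_ (hind k) hBm hGm]
            exact ((hadp k).mono (hle _) le_rfl).comap_le
        _ ≤ (∫⁻ ω, A ω ∂P) * ENNReal.ofReal (Real.exp v)
            + (∫⁻ ω, B ω ∂P) * ENNReal.ofReal (Real.exp v) := by
            gcongr
            · refine le_mul_of_one_le_right' ?_
              rw [← ENNReal.ofReal_one]
              exact ENNReal.ofReal_le_ofReal (Real.one_le_exp hv)
            · exact hexp k (by omega)
        _ = (∫⁻ ω, W k ω ∂P) * ENNReal.ofReal (Real.exp v) := by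
            rw [← add_mul, ← lintegral_add_left hAm]
            simp_rw [hAB]
        _ ≤ ENNReal.ofReal (Real.exp (k * v)) * ENNReal.ofReal (Real.exp v) := by
            gcongr
            exact ih (by omega)
        _ = _ := by
            rw [← ENNReal.ofReal_mul (Real.exp_pos _).le, ← Real.exp_add]
            push_cast
            ring_nf
  have h1 : ENNReal.ofReal (Real.exp (t * x)) * P (hit R)
      ≤ ENNReal.ofReal (Real.exp (R * v)) := by
    refine le_trans ?_ (hmain R le_rfl)
    rw [← setLIntegral_const, ← lintegral_indicator (hle R _ (hhitm R))]
    apply lintegral_mono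
    intro ω
    by_cases h : ω ∈ hit R <;> simp [W, h]
  have h2 : ENNReal.ofReal (Real.exp (-(t * x) + R * v))
      = ENNReal.ofReal (Real.exp (-(t * x))) * ENNReal.ofReal (Real.exp (R * v)) := by
    rw [← ENNReal.ofReal_mul (Real.exp_pos _).le, ← Real.exp_add]
  rw [h2]
  calc P (hit R) = ENNReal.ofReal (Real.exp (-(t * x)))
        * (ENNReal.ofReal (Real.exp (t * x)) * P (hit R)) := by
        rw [← mul_assoc, ← ENNReal.ofReal_mul (Real.exp_pos _).le, ← Real.exp_add]
        simp
    _ ≤ _ := by gcongr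

/-- Integrating the pointwise bound kills the linear term, as `ξ` is centred; `1 + z ≤ exp z` moves
the rest into the exponent. -/
lemma lintegral_exp_truncation_le {q : ℝ} (hq : 2 < q) {ξ : Ω → ℝ}
    (hξ : MemLp ξ (ENNReal.ofReal q) P) (hmean : ∫ ω, ξ ω ∂P = 0) {a v : ℝ}
    (ha : ∫ ω, |ξ ω| ^ q ∂P ≤ a) (hv : ∫ ω, ξ ω ^ 2 ∂P ≤ v) {t y : ℝ} (ht : 0 ≤ t) (hy : 0 < y) :
    ∫⁻ ω, ENNReal.ofReal (Real.exp (t * min (ξ ω) y)) ∂P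
      ≤ ENNReal.ofReal (Real.exp (Real.exp q * t ^ 2 * v + Real.exp (t * y) * (a / y ^ q))) := by
  have hi1 : Integrable ξ P := hξ.integrable (by
    rw [← ENNReal.ofReal_one]; exact ENNReal.ofReal_le_ofReal (by linarith))
  have hi2 : Integrable (fun ω => ξ ω ^ 2) P := by
    refine MemLp.integrable_sq (hξ.mono_exponent ?_)
    rw [show (2 : ENNReal) = ENNReal.ofReal 2 by simp]
    exact ENNReal.ofReal_le_ofReal hq.le
  have hiq : Integrable (fun ω => |ξ ω| ^ q) P := by
    have := hξ.integrable_norm_rpow (by simp; linarith) (by simp)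
    rwa [ENNReal.toReal_ofReal (by linarith)] at this
  have hib : Integrable (fun ω => 1 + t * ξ ω + Real.exp q * t ^ 2 * ξ ω ^ 2
      + Real.exp (t * y) * (|ξ ω| ^ q / y ^ q)) P :=
    (((integrable_const _).add (hi1.const_mul _)).add (hi2.const_mul _)).add
      ((hiq.div_const _).const_mul _)
  have hpt : ∀ ω, Real.exp (t * min (ξ ω) y) ≤ 1 + t * ξ ω + Real.exp q * t ^ 2 * ξ ω ^ 2
      + Real.exp (t * y) * (|ξ ω| ^ q / y ^ q) := fun ω =>
    exp_truncation_le (by linarith) ht hy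
  calc ∫⁻ ω, ENNReal.ofReal (Real.exp (t * min (ξ ω) y)) ∂P
      ≤ ∫⁻ ω, ENNReal.ofReal (1 + t * ξ ω + Real.exp q * t ^ 2 * ξ ω ^ 2
      + Real.exp (t * y) * (|ξ ω| ^ q / y ^ q)) ∂P :=
        lintegral_mono fun ω => ENNReal.ofReal_le_ofReal (hpt ω)
    _ = ENNReal.ofReal (∫ ω, (1 + t * ξ ω + Real.exp q * t ^ 2 * ξ ω ^ 2
      + Real.exp (t * y) * (|ξ ω| ^ q / y ^ q)) ∂P) :=
        (ofReal_integral_eq_lintegral_ofReal hib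
          (ae_of_all _ fun ω => (Real.exp_pos _).le.trans (hpt ω))).symm
    _ ≤ _ := by
        apply ENNReal.ofReal_le_ofReal
        rw [integral_add (f := fun ω => 1 + t * ξ ω + Real.exp q * t ^ 2 * ξ ω ^ 2)
            (((integrable_const _).add (hi1.const_mul _)).add (hi2.const_mul _))
            ((hiq.div_const _).const_mul _),
          integral_add (f := fun ω => 1 + t * ξ ω)
            ((integrable_const _).add (hi1.const_mul _)) (hi2.const_mul _),
          integral_add (integrable_const _) (hi1.const_mul _), integral_const_mul,
          integral_const_mul, integral_const_mul, integral_div, hmean]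
        have h1 : Real.exp q * t ^ 2 * ∫ ω, ξ ω ^ 2 ∂P ≤ Real.exp q * t ^ 2 * v := by gcongr
        have h2 : Real.exp (t * y) * ((∫ ω, |ξ ω| ^ q ∂P) / y ^ q)
            ≤ Real.exp (t * y) * (a / y ^ q) := by gcongr
        simp only [integral_const, probReal_univ, smul_eq_mul, mul_one, mul_zero, add_zero]
        linarith [Real.add_one_le_exp (Real.exp q * t ^ 2 * v + Real.exp (t * y) * (a / y ^ q))]

/-- The choice of the Chernoff parameter. `t₁` is suited to the Gaussian part and is kept if the
large-jump term stays below `1`. Otherwise `t₂ ≤ t₁` makes that term equal to `1`; then `exp (-(t₂ *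
x)) = β ^ 2`, and the spare power of `β` pays for the Gaussian part. -/
lemma exists_exponent_le {C x V β : ℝ} (hC : 0 < C) (hx : 0 < x) (hV : 0 < V) (hβ : 0 ≤ β)
    (hβ1 : β < 1) :
    ∃ t : ℝ, 0 ≤ t ∧ Real.exp (-(t * x) + (C * t ^ 2 * V + Real.exp (t * (x / 2)) * β))
      ≤ Real.exp 1 * β + Real.exp 1 * Real.exp (-(x ^ 2 / (8 * C * V))) := by
  set t₁ := x / (4 * C * V) with ht₁
  have ht₁p : 0 < t₁ := by positivity
  have hkey : C * t₁ * V = x / 4 := by rw [ht₁]; field_simp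
  by_cases h : Real.exp (t₁ * (x / 2)) * β ≤ 1
  · refine ⟨t₁, ht₁p.le, ?_⟩
    have h1 : C * t₁ ^ 2 * V = t₁ * (x / 4) := by rw [← hkey]; ring
    have h2 : x ^ 2 / (8 * C * V) = t₁ * x / 2 := by rw [ht₁]; field_simp; norm_num
    have : Real.exp (-(t₁ * x) + (C * t₁ ^ 2 * V + Real.exp (t₁ * (x / 2)) * β))
        ≤ Real.exp 1 * Real.exp (-(x ^ 2 / (8 * C * V))) := by
      rw [← Real.exp_add, h1, h2]
      apply Real.exp_le_exp.2
      nlinarith [mul_pos ht₁p hx]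
    have h3 : 0 ≤ Real.exp 1 * β := by positivity
    linarith
  · push Not at h
    have hβp : 0 < β := by
      rcases hβ.eq_or_lt with h0 | h0
      · rw [← h0] at h; simp at h; linarith
      · exact h0
    set t₂ := -Real.log β / (x / 2) with ht₂
    have hlog : Real.log β < 0 := Real.log_neg hβp hβ1
    have ht₂p : 0 < t₂ := div_pos (by linarith) (by linarith)
    have ht₂x : t₂ * (x / 2) = -Real.log β := by rw [ht₂]; field_simp
    have hle : t₂ ≤ t₁ := by
      have : -Real.log β < t₁ * (x / 2) := by
        have := Real.log_lt_log one_pos h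
        rw [Real.log_mul (Real.exp_pos _).ne' hβp.ne', Real.log_exp, Real.log_one] at this
        linarith
      rw [← ht₂x] at this
      exact (lt_of_mul_lt_mul_right this (by linarith)).le
    refine ⟨t₂, ht₂p.le, ?_⟩
    have h1 : Real.exp (t₂ * (x / 2)) * β = 1 := by
      rw [ht₂x, Real.exp_neg, Real.exp_log hβp]; field_simp
    have h2 : C * t₂ ^ 2 * V ≤ t₂ * (x / 4) := by
      have : C * t₂ ^ 2 * V ≤ t₂ * (C * t₁ * V) := by
        have : C * t₂ ^ 2 * V = t₂ * (C * t₂ * V) := by ring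
        rw [this]; gcongr
      rwa [hkey] at this
    have h3 : Real.exp (-(t₂ * x) + (C * t₂ ^ 2 * V + Real.exp (t₂ * (x / 2)) * β))
        ≤ Real.exp 1 * β := by
      rw [h1]
      calc _ ≤ Real.exp (1 + Real.log β) := by
            apply Real.exp_le_exp.2
            nlinarith
        _ = _ := by rw [Real.exp_add, Real.exp_log hβp]
    have h4 : 0 ≤ Real.exp 1 * Real.exp (-(x ^ 2 / (8 * C * V))) := by positivity
    linarith

lemma measure_le_abs_le_of_integral_rpow_le {q : ℝ} (hq : 0 < q) {ξ : Ω → ℝ}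
    (hξ : MemLp ξ (ENNReal.ofReal q) P) {a : ℝ} (ha : ∫ ω, |ξ ω| ^ q ∂P ≤ a) {y : ℝ}
    (hy : 0 < y) : P.real {ω | y ≤ |ξ ω|} ≤ a / y ^ q := by
  have hiq : Integrable (fun ω => |ξ ω| ^ q) P := by
    have := hξ.integrable_norm_rpow (by simp; linarith) (by simp)
    rwa [ENNReal.toReal_ofReal (by linarith)] at this
  have h := mul_meas_ge_le_integral_of_nonneg (ae_of_all P fun ω => by positivity) hiq (y ^ q)
  have hset : {ω | y ^ q ≤ |ξ ω| ^ q} = {ω | y ≤ |ξ ω|} := by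
    ext ω
    exact Real.rpow_le_rpow_iff hy.le (abs_nonneg _) hq
  rw [hset] at h
  rw [le_div_iff₀ (by positivity), mul_comm]
  exact h.trans ha

/-- A maximal inequality of Fuk–Nagaev type, one-sided. -/
lemma measure_exists_le_sum_le {q : ℝ} (hq : 2 < q) {ξ : ℕ → Ω → ℝ} {𝓕 : ℕ → MeasurableSpace Ω}
    (hmono : Monotone 𝓕) (hle : ∀ r, 𝓕 r ≤ mΩ) (hadp : ∀ r, Measurable[𝓕 (r + 1)] (ξ r))
    (hind : ∀ r, Indep (𝓕 r) (MeasurableSpace.comap (ξ r) inferInstance) P)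
    (hLp : ∀ r, MemLp (ξ r) (ENNReal.ofReal q) P) (hmean : ∀ r, ∫ ω, ξ r ω ∂P = 0) {a v : ℝ}
    (ha : ∀ r, ∫ ω, |ξ r ω| ^ q ∂P ≤ a) (hv : ∀ r, ∫ ω, ξ r ω ^ 2 ∂P ≤ v) (R : ℕ) {x : ℝ}
    (hx : 0 < x) :
    P.real {ω | ∃ k ≤ R, x ≤ ∑ r ∈ Finset.range k, ξ r ω}
      ≤ 4 * (R * a / (x / 2) ^ q) + 3 * Real.exp (-(x ^ 2 / (8 * Real.exp q * (R * v)))) := by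
  have ha0 : 0 ≤ a := (integral_nonneg fun ω => by positivity).trans (ha 0)
  have hv0 : 0 ≤ v := (integral_nonneg fun ω => by positivity).trans (hv 0)
  have he : Real.exp 1 < 3 := Real.exp_one_lt_d9.trans (by norm_num)
  set y := x / 2 with hy
  have hyp : 0 < y := by positivity
  set β := R * a / y ^ q with hβdef
  have hβ : 0 ≤ β := by positivity
  have hexp0 : 0 ≤ Real.exp (-(x ^ 2 / (8 * Real.exp q * (R * v)))) := (Real.exp_pos _).le
  by_cases hβ1 : 1 ≤ β
  · have : P.real {ω | ∃ k ≤ R, x ≤ ∑ r ∈ Finset.range k, ξ r ω} ≤ 1 := measureReal_le_one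
    linarith
  push Not at hβ1
  -- If `R * v = 0`, division by zero makes the exponential equal to `1`, so the claimed bound
  -- exceeds `1`.
  by_cases hV : R * v = 0
  · have : P.real {ω | ∃ k ≤ R, x ≤ ∑ r ∈ Finset.range k, ξ r ω} ≤ 1 := measureReal_le_one
    rw [hV]
    simp only [mul_zero, div_zero, neg_zero, Real.exp_zero]
    linarith
  have hVp : 0 < R * v := lt_of_le_of_ne (by positivity) (Ne.symm hV)
  obtain ⟨t, ht, hexp⟩ := exists_exponent_le (Real.exp_pos q) hx hVp hβ hβ1
  set η : ℕ → Ω → ℝ := fun r ω => min (ξ r ω) y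
  set w := Real.exp q * t ^ 2 * v + Real.exp (t * y) * (a / y ^ q) with hw
  have htr := measure_exists_le_sum_le_exp (P := P) (ξ := η) hmono hle
    (fun r => (hadp r).min measurable_const)
    (fun r => indep_of_indep_of_le_right (hind r)
      ((comap_measurable (ξ r)).min measurable_const).comap_le) ht (v := w) (by positivity)
    (fun r (_ : r < R) => lintegral_exp_truncation_le hq (hLp r) (hmean r) (ha r) (hv r) ht hyp) x
  have htr' : P.real {ω | ∃ k ≤ R, x ≤ ∑ r ∈ Finset.range k, η r ω}
      ≤ Real.exp (-(t * x) + R * w) := by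
    rw [measureReal_def]
    exact ENNReal.toReal_le_of_le_ofReal (Real.exp_pos _).le htr
  have hRw : R * w = Real.exp q * t ^ 2 * (R * v) + Real.exp (t * (x / 2)) * β := by
    rw [hw, hβdef]; ring
  rw [hRw] at htr'
  -- Either some summand is at least `y` in absolute value, which a union bound controls by `β`, or
  -- truncation at `y` changes nothing.
  have hsub : {ω | ∃ k ≤ R, x ≤ ∑ r ∈ Finset.range k, ξ r ω}
      ⊆ {ω | ∃ k ≤ R, x ≤ ∑ r ∈ Finset.range k, η r ω}
        ∪ ⋃ r ∈ Finset.range R, {ω | y ≤ |ξ r ω|} := by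
    rintro ω ⟨k, hk, hxk⟩
    by_cases h : ∃ r < R, y ≤ |ξ r ω|
    · right
      simpa using h
    · left
      push Not at h
      refine ⟨k, hk, hxk.trans (le_of_eq (Finset.sum_congr rfl fun r hr => ?_))⟩
      have := h r ((Finset.mem_range.1 hr).trans_le hk)
      exact (min_eq_left ((le_abs_self _).trans this.le)).symm
  have hbig : P.real (⋃ r ∈ Finset.range R, {ω | y ≤ |ξ r ω|}) ≤ β := by
    refine (measureReal_biUnion_finset_le _ _).trans ?_
    calc _ ≤ ∑ r ∈ Finset.range R, a / y ^ q := Finset.sum_le_sum fun r _ =>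
          measure_le_abs_le_of_integral_rpow_le (by linarith) (hLp r) (ha r) hyp
      _ = β := by simp [hβdef, mul_div_assoc]
  have h1 := (measureReal_mono hsub).trans (measureReal_union_le (μ := P) _ _)
  nlinarith [Real.exp_pos 1]

/-- A maximal inequality of Fuk–Nagaev type. -/
lemma measure_exists_le_abs_sum_le {q : ℝ} (hq : 2 < q) {ξ : ℕ → Ω → ℝ}
    {𝓕 : ℕ → MeasurableSpace Ω}
    (hmono : Monotone 𝓕) (hle : ∀ r, 𝓕 r ≤ mΩ) (hadp : ∀ r, Measurable[𝓕 (r + 1)] (ξ r))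
    (hind : ∀ r, Indep (𝓕 r) (MeasurableSpace.comap (ξ r) inferInstance) P)
    (hLp : ∀ r, MemLp (ξ r) (ENNReal.ofReal q) P) (hmean : ∀ r, ∫ ω, ξ r ω ∂P = 0) {a v : ℝ}
    (ha : ∀ r, ∫ ω, |ξ r ω| ^ q ∂P ≤ a) (hv : ∀ r, ∫ ω, ξ r ω ^ 2 ∂P ≤ v) (R : ℕ) {x : ℝ}
    (hx : 0 < x) :
    P.real {ω | ∃ k ≤ R, x ≤ |∑ r ∈ Finset.range k, ξ r ω|}
      ≤ 8 * (R * a / (x / 2) ^ q) + 6 * Real.exp (-(x ^ 2 / (8 * Real.exp q * (R * v)))) := by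
  have h1 := measure_exists_le_sum_le hq hmono hle hadp hind hLp hmean ha hv R hx
  have h2 := measure_exists_le_sum_le (ξ := fun r ω => -ξ r ω) hq hmono hle
    (fun r => (hadp r).neg)
    (fun r => indep_of_indep_of_le_right (hind r) (comap_measurable (ξ r)).neg.comap_le)
    (fun r => (hLp r).neg) (fun r => by rw [integral_neg, hmean, neg_zero])
    (fun r => by simpa using ha r) (fun r => by simpa using hv r) R hx
  have hsub : {ω | ∃ k ≤ R, x ≤ |∑ r ∈ Finset.range k, ξ r ω|}
      ⊆ {ω | ∃ k ≤ R, x ≤ ∑ r ∈ Finset.range k, ξ r ω}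
        ∪ {ω | ∃ k ≤ R, x ≤ ∑ r ∈ Finset.range k, -ξ r ω} := by
    rintro ω ⟨k, hk, hxk⟩
    rcases le_abs.1 hxk with h | h
    · exact Or.inl ⟨k, hk, h⟩
    · exact Or.inr ⟨k, hk, by simpa using h⟩
  have h3 := (measureReal_mono hsub).trans (measureReal_union_le (μ := P) _ _)
  linarith

end FukNagaev

/-! ### Burkholder's inequality in `L^q` -/

section Burkholder

/-- A second-order expansion of `|·| ^ q`. If `|d|` is comparable to `|x|` or larger, every term is
dominated by `|d| ^ q`; otherwise `(1 + d / x) ^ q` is bounded through the exponential, with a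
quadratic error. -/
lemma exists_abs_add_rpow_le {q : ℝ} (hq : 2 ≤ q) : ∃ C : ℝ, 1 ≤ C ∧ ∀ x d : ℝ,
    |x + d| ^ q ≤ |x| ^ q + q * (x * |x| ^ (q - 2)) * d
      + C * (|x| ^ (q - 2) * d ^ 2 + |d| ^ q) := by
  have h3q : (1 : ℝ) ≤ 3 ^ q := Real.one_le_rpow (by norm_num) (by linarith)
  have hA : 0 ≤ q * (2 : ℝ) ^ q := by positivity
  have hB : 0 ≤ q ^ 2 * Real.exp q := by positivity
  refine ⟨3 ^ q + q * 2 ^ q + q ^ 2 * Real.exp q, by linarith, fun x d => ?_⟩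
  set C := 3 ^ q + q * (2 : ℝ) ^ q + q ^ 2 * Real.exp q with hC
  have hxq : |x| ^ (q - 2) * x ^ 2 = |x| ^ q ∨ x = 0 := by
    by_cases hx : x = 0
    · exact Or.inr hx
    · left
      rw [← sq_abs x, ← Real.rpow_two, ← Real.rpow_add (abs_pos.2 hx)]
      congr 1; ring
  rcases le_or_gt |x| (2 * |d|) with h | h
  · have h1 : |x + d| ^ q ≤ 3 ^ q * |d| ^ q := by
      rw [← Real.mul_rpow (by norm_num) (abs_nonneg _)]
      apply Real.rpow_le_rpow (abs_nonneg _) _ (by linarith)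
      linarith [abs_add_le x d]
    have h2 : |q * (x * |x| ^ (q - 2)) * d| ≤ q * 2 ^ q * |d| ^ q := by
      rcases hxq with hxq | hx
      · have hd : 0 ≤ |d| := abs_nonneg d
        have h4 : |q * (x * |x| ^ (q - 2)) * d| = q * (|x| * |x| ^ (q - 2)) * |d| := by
          rw [abs_mul, abs_mul, abs_mul, abs_of_nonneg (show 0 ≤ q by linarith),
            abs_of_nonneg (Real.rpow_nonneg (abs_nonneg x) _)]
        have h5 : |x| * |x| ^ (q - 2) ≤ (2 * |d|) * (2 * |d|) ^ (q - 2) := by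
          gcongr
        rcases hd.eq_or_lt with h0 | h0
        · rw [h4, ← h0]; simp; positivity
        have h6 : (2 * |d|) * (2 * |d|) ^ (q - 2) * (2 * |d|) = 2 ^ q * |d| ^ q := by
          rw [← Real.mul_rpow (by norm_num) hd]
          have : (2 * |d|) ^ q = (2 * |d|) ^ (q - 2) * (2 * |d|) ^ (2 : ℝ) := by
            rw [← Real.rpow_add (by linarith)]; congr 1; ring
          rw [this, Real.rpow_two]; ring
        rw [h4, mul_assoc q (2 ^ q), ← h6]
        have h7 : |x| * |x| ^ (q - 2) * |d| ≤ (2 * |d|) * (2 * |d|) ^ (q - 2) * (2 * |d|) := by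
          calc _ ≤ (2 * |d|) * (2 * |d|) ^ (q - 2) * |d| := by gcongr
            _ ≤ _ := by gcongr; linarith
        calc _ = q * (|x| * |x| ^ (q - 2) * |d|) := by ring
          _ ≤ _ := by gcongr
      · rw [hx]; simp; positivity
    have h3 : 0 ≤ |x| ^ q := by positivity
    have h4 : 0 ≤ |x| ^ (q - 2) * d ^ 2 := by positivity
    have h5 : 0 ≤ |d| ^ q := by positivity
    have h6 := neg_le_of_abs_le h2
    have h7 : 3 ^ q * |d| ^ q + q * 2 ^ q * |d| ^ q ≤ C * (|x| ^ (q - 2) * d ^ 2 + |d| ^ q) := by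
      have : 0 ≤ C := by linarith
      nlinarith [mul_nonneg this h4, mul_nonneg hB h5]
    linarith
  · have hxp : 0 < |x| := lt_of_le_of_lt (by positivity) h
    have hx0 : x ≠ 0 := abs_pos.1 hxp
    have hxq' : |x| ^ (q - 2) * x ^ 2 = |x| ^ q := hxq.resolve_right hx0
    set z := d / x with hz
    have hd : d = x * z := by rw [hz]; field_simp
    have hz2 : |z| < 1 / 2 := by
      rw [hz, abs_div, div_lt_iff₀ hxp]; linarith
    obtain ⟨hz3, hz4⟩ := abs_lt.1 hz2
    have h1 : |x + d| ^ q = |x| ^ q * (1 + z) ^ q := by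
      rw [hd, show x + x * z = x * (1 + z) by ring, abs_mul, abs_of_pos (show 0 < 1 + z by linarith),
        Real.mul_rpow (abs_nonneg _) (by linarith)]
    have h2 : (1 + z) ^ q ≤ 1 + q * z + Real.exp q * (q * z) ^ 2 := by
      refine le_trans ?_ (exp_le_one_add_add_sq (by linarith) (by nlinarith))
      rw [Real.rpow_def_of_pos (by linarith)]
      apply Real.exp_le_exp.2
      rw [mul_comm]
      have := Real.log_le_sub_one_of_pos (show 0 < 1 + z by linarith)
      gcongr
      linarith
    have h3 : q * (x * |x| ^ (q - 2)) * d = q * |x| ^ q * z := by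
      rw [← hxq', hd]; ring
    have h4 : |x| ^ (q - 2) * d ^ 2 = |x| ^ q * z ^ 2 := by
      rw [← hxq', hd]; ring
    have h5 : 0 ≤ |d| ^ q := by positivity
    have hxq0 : 0 ≤ |x| ^ q := by positivity
    rw [h1, h3, h4]
    have h6 : |x| ^ q * (1 + z) ^ q
        ≤ |x| ^ q * (1 + q * z + Real.exp q * (q * z) ^ 2) := by gcongr
    have h7 : q ^ 2 * Real.exp q * (|x| ^ q * z ^ 2) ≤ C * (|x| ^ q * z ^ 2) := by
      gcongr
      linarith
    have h8 : 0 ≤ C * |d| ^ q := by positivity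
    nlinarith

/-- Here `X` and `Y` stand for squared norms and `p` for half the moment exponent. The lemma folds
the expansion back into one power, so that squared norms add up from step to step. Each power is
split as `z ^ (p - 1) * z`, and all first factors are bounded by that of the total. -/
lemma rpow_add_mul_le {p C : ℝ} (hp : 1 ≤ p) (hC : 1 ≤ C) {X Y : ℝ} (hX : 0 ≤ X) (hY : 0 ≤ Y) :
    X ^ p + C * (X ^ (p - 1) * Y + Y ^ p) ≤ (X + 2 * C * Y) ^ p := by
  have hZ : 0 ≤ X + 2 * C * Y := by positivity
  have hsplit : ∀ {z : ℝ}, 0 ≤ z → z ^ p = z ^ (p - 1) * z := by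
    intro z hz
    rcases hz.eq_or_lt with h | h
    · rw [← h, Real.zero_rpow (by linarith), mul_zero]
    · nth_rewrite 3 [← Real.rpow_one z]
      rw [← Real.rpow_add h]; congr 1; ring
  have h1 : X ^ (p - 1) ≤ (X + 2 * C * Y) ^ (p - 1) := by
    apply Real.rpow_le_rpow hX _ (by linarith)
    have : 0 ≤ 2 * C * Y := by positivity
    linarith
  have h2 : Y ^ (p - 1) ≤ (X + 2 * C * Y) ^ (p - 1) := by
    apply Real.rpow_le_rpow hY _ (by linarith)
    nlinarith
  rw [hsplit hZ, hsplit hX, hsplit hY]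
  set a := X ^ (p - 1)
  set b := Y ^ (p - 1)
  set c := (X + 2 * C * Y) ^ (p - 1)
  have h3 : a * X ≤ c * X := by gcongr
  have h4 : C * Y * a ≤ C * Y * c := by gcongr
  have h5 : C * Y * b ≤ C * Y * c := by gcongr
  nlinarith

variable {Ω : Type*} [mΩ : MeasurableSpace Ω] {P : Measure Ω} [IsProbabilityMeasure P]

lemma integrable_abs_rpow {q : ℝ} (hq : 0 < q) {f : Ω → ℝ} (hf : MemLp f (ENNReal.ofReal q) P) :
    Integrable (fun ω => |f ω| ^ q) P := by
  have := hf.integrable_norm_rpow (by simp; linarith) (by simp)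
  rwa [ENNReal.toReal_ofReal (by linarith)] at this

lemma eLpNorm_le_ofReal_iff {q : ℝ} (hq : 0 < q) {f : Ω → ℝ} (hf : MemLp f (ENNReal.ofReal q) P)
    {c : ℝ} (hc : 0 ≤ c) :
    eLpNorm f (ENNReal.ofReal q) P ≤ ENNReal.ofReal c ↔ ∫ ω, |f ω| ^ q ∂P ≤ c ^ q := by
  have h0 : 0 ≤ ∫ ω, |f ω| ^ q ∂P := integral_nonneg fun ω => by positivity
  rw [hf.eLpNorm_eq_integral_rpow_norm (by simp; linarith) (by simp),
    ENNReal.toReal_ofReal hq.le, ENNReal.ofReal_le_ofReal_iff hc]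
  simp only [Real.norm_eq_abs]
  constructor
  · intro h
    have := Real.rpow_le_rpow (by positivity) h hq.le
    rwa [← Real.rpow_mul h0, inv_mul_cancel₀ hq.ne', Real.rpow_one] at this
  · intro h
    have := Real.rpow_le_rpow h0 h (inv_nonneg.2 hq.le)
    rwa [← Real.rpow_mul hc, mul_inv_cancel₀ hq.ne', Real.rpow_one] at this

/-- Hölder's inequality with exponents `q / (q - 2)` and `q / 2`; the first degenerates at `q = 2`,
which is treated apart. -/
lemma integral_abs_rpow_mul_sq_le {q : ℝ} (hq : 2 ≤ q) {x d : Ω → ℝ}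
    (hx : MemLp x (ENNReal.ofReal q) P) (hd : MemLp d (ENNReal.ofReal q) P) {X Y : ℝ}
    (hX : 0 ≤ X) (hY : 0 ≤ Y) (hxX : ∫ ω, |x ω| ^ q ∂P ≤ X ^ (q / 2))
    (hdY : ∫ ω, |d ω| ^ q ∂P ≤ Y ^ (q / 2)) :
    ∫ ω, |x ω| ^ (q - 2) * d ω ^ 2 ∂P ≤ X ^ (q / 2 - 1) * Y := by
  rcases hq.eq_or_lt with h | h
  · subst h
    simpa using hdY
  have hpq : (q / (q - 2)).HolderConjugate (q / 2) := by
    rw [Real.holderConjugate_iff]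
    constructor
    · rw [lt_div_iff₀ (by linarith)]; linarith
    · field_simp; ring
  have hxm : MemLp (fun ω => |x ω| ^ (q - 2)) (ENNReal.ofReal (q / (q - 2))) P := by
    have := hx.norm_rpow_div (ENNReal.ofReal (q - 2))
    rwa [ENNReal.toReal_ofReal (by linarith), ← ENNReal.ofReal_div_of_pos (by linarith)] at this
  have hdm : MemLp (fun ω => d ω ^ 2) (ENNReal.ofReal (q / 2)) P := by
    have := hd.norm_rpow_div (ENNReal.ofReal 2)
    rw [ENNReal.toReal_ofReal (by linarith), ← ENNReal.ofReal_div_of_pos (by linarith)] at this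
    simpa using this
  have hH := integral_mul_le_Lp_mul_Lq_of_nonneg hpq
    (ae_of_all P fun ω => by positivity) (ae_of_all P fun ω => sq_nonneg (d ω)) hxm hdm
  refine hH.trans ?_
  have e1 : ∀ ω, (|x ω| ^ (q - 2)) ^ (q / (q - 2)) = |x ω| ^ q := fun ω => by
    rw [← Real.rpow_mul (abs_nonneg _), mul_div_cancel₀ _ (by linarith)]
  have e2 : ∀ ω, (d ω ^ 2) ^ (q / 2) = |d ω| ^ q := fun ω => by
    rw [← sq_abs, ← Real.rpow_natCast, ← Real.rpow_mul (abs_nonneg _)]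
    congr 1; push_cast; field_simp
  simp_rw [e1, e2]
  have hx0 : 0 ≤ ∫ ω, |x ω| ^ q ∂P := integral_nonneg fun ω => by positivity
  have hd0 : 0 ≤ ∫ ω, |d ω| ^ q ∂P := integral_nonneg fun ω => by positivity
  have e3 : (∫ ω, |x ω| ^ q ∂P) ^ (1 / (q / (q - 2))) ≤ X ^ (q / 2 - 1) := by
    calc _ ≤ (X ^ (q / 2)) ^ (1 / (q / (q - 2))) := by
          apply Real.rpow_le_rpow hx0 hxX
          have : 0 < q - 2 := by linarith
          positivity
      _ = _ := by
          rw [← Real.rpow_mul hX]; congr 1; field_simp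
  have e4 : (∫ ω, |d ω| ^ q ∂P) ^ (1 / (q / 2)) ≤ Y := by
    calc _ ≤ (Y ^ (q / 2)) ^ (1 / (q / 2)) := by
          apply Real.rpow_le_rpow hd0 hdY (by positivity)
      _ = _ := by
          rw [← Real.rpow_mul hY, mul_one_div_cancel (by positivity), Real.rpow_one]
  exact mul_le_mul e3 e4 (by positivity) (by positivity)

lemma integral_mul_eq_zero_of_condExp {m : MeasurableSpace Ω} (hm : m ≤ mΩ) {g d : Ω → ℝ}
    (hg : StronglyMeasurable[m] g) (hgd : Integrable (g * d) P) (hd : Integrable d P)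
    (hcond : P[d|m] =ᵐ[P] 0) : ∫ ω, g ω * d ω ∂P = 0 := by
  have h1 := condExp_mul_of_stronglyMeasurable_left hg hgd hd
  have h2 : P[g * d|m] =ᵐ[P] 0 := by
    filter_upwards [h1, hcond] with ω h1 h2
    rw [h1, Pi.mul_apply, h2]; simp
  have h3 := integral_condExp hm (μ := P) (f := g * d)
  rw [integral_congr_ae h2] at h3
  simpa using h3.symm

lemma stronglyMeasurable_const_mul_mul_abs_rpow {Ω : Type*} {m : MeasurableSpace Ω} {x : Ω → ℝ}
    (hx : StronglyMeasurable x) (c s : ℝ) :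
    StronglyMeasurable fun ω => c * (x ω * |x ω| ^ s) := by
  have h1 : Measurable x := hx.measurable
  have h2 : Measurable fun ω => |x ω| := h1.norm
  exact (Measurable.const_mul (h1.mul (h2.pow_const _)) c).stronglyMeasurable

/-- One step of Burkholder's inequality. -/
lemma exists_integral_abs_add_rpow_le {q : ℝ} (hq : 2 ≤ q) : ∃ K : ℝ, 1 ≤ K ∧
    ∀ {Ω : Type*} {m : MeasurableSpace Ω} [mΩ : MeasurableSpace Ω] (P : Measure Ω)
      [IsProbabilityMeasure P] (_ : m ≤ mΩ) {x d : Ω → ℝ}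
      (_ : MemLp x (ENNReal.ofReal q) P) (_ : MemLp d (ENNReal.ofReal q) P)
      (_ : StronglyMeasurable[m] x) (_ : P[d|m] =ᵐ[P] 0) {X Y : ℝ} (_ : 0 ≤ X) (_ : 0 ≤ Y)
      (_ : ∫ ω, |x ω| ^ q ∂P ≤ X ^ (q / 2)) (_ : ∫ ω, |d ω| ^ q ∂P ≤ Y ^ (q / 2)),
      ∫ ω, |x ω + d ω| ^ q ∂P ≤ (X + K * Y) ^ (q / 2) := by
  obtain ⟨C, hC, hpt⟩ := exists_abs_add_rpow_le hq
  refine ⟨2 * C, by linarith, ?_⟩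
  intro Ω m mΩ P _ hm x d hx hd hxm hcond X Y hX hY hxX hdY
  have hq0 : 0 < q := by linarith
  have hix := integrable_abs_rpow hq0 hx
  have hid := integrable_abs_rpow hq0 hd
  have hd1 : Integrable d P := hd.integrable (by
    rw [← ENNReal.ofReal_one]; exact ENNReal.ofReal_le_ofReal (by linarith))
  have hms : ∀ {f : Ω → ℝ}, AEStronglyMeasurable f P → ∀ s : ℝ,
      AEStronglyMeasurable (fun ω => |f ω| ^ s) P := fun {f} hf s =>
    (((continuous_abs.comp_aestronglyMeasurable hf).aemeasurable).pow_const s).aestronglyMeasurable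
  have hpow : ∀ {a b s r : ℝ}, 0 ≤ a → 0 ≤ b → 0 ≤ s → 0 ≤ r → s + r = q →
      a ^ s * b ^ r ≤ a ^ q + b ^ q := by
    intro a b s r ha hb hs hr hsr
    set c := max a b with hc
    have hc0 : 0 ≤ c := ha.trans (le_max_left _ _)
    have h1 : a ^ s * b ^ r ≤ c ^ s * c ^ r := by
      gcongr
      · exact le_max_left _ _
      · exact le_max_right _ _
    rw [← Real.rpow_add_of_nonneg hc0 hs hr, hsr] at h1
    refine h1.trans ?_
    have := Real.rpow_nonneg ha q
    have := Real.rpow_nonneg hb q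
    rcases max_choice a b with h | h
    · rw [hc, h]; linarith
    · rw [hc, h]; linarith
  have hi2 : Integrable (fun ω => |x ω| ^ (q - 2) * d ω ^ 2) P := by
    refine (hix.add hid).mono ((hms hx.1 _).mul (hd.1.pow 2)) (ae_of_all _ fun ω => ?_)
    have h0 : 0 ≤ |x ω| ^ (q - 2) * d ω ^ 2 := by positivity
    have h1 : 0 ≤ |x ω| ^ q + |d ω| ^ q := by positivity
    rw [Real.norm_eq_abs, Real.norm_eq_abs, abs_of_nonneg h0]
    refine le_trans ?_ (le_abs_self _)
    rw [← sq_abs, ← Real.rpow_two]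
    exact hpow (abs_nonneg _) (abs_nonneg _) (by linarith) (by norm_num) (by ring)
  set g : Ω → ℝ := fun ω => q * (x ω * |x ω| ^ (q - 2)) with hg
  have hgm : StronglyMeasurable[m] g := stronglyMeasurable_const_mul_mul_abs_rpow hxm q _
  have hi1 : Integrable (g * d) P := by
    have hb : Integrable (fun ω => q * (|x ω| ^ q + |d ω| ^ q)) P := (hix.add hid).const_mul q
    refine hb.mono ((hgm.mono hm).aestronglyMeasurable.mul hd.1) (ae_of_all _ fun ω => ?_)
    have h1 : 0 ≤ |x ω| ^ q + |d ω| ^ q := by positivity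
    rw [Real.norm_eq_abs, Real.norm_eq_abs, abs_of_nonneg (mul_nonneg hq0.le h1), Pi.mul_apply,
      abs_mul, hg, abs_mul, abs_mul, abs_of_pos hq0, abs_of_nonneg (Real.rpow_nonneg (abs_nonneg _) _),
      mul_assoc]
    gcongr
    have e : |x ω| * |x ω| ^ (q - 2) = |x ω| ^ (q - 1) := by
      rcases (abs_nonneg (x ω)).eq_or_lt with h | h
      · rw [← h, zero_mul, Real.zero_rpow (by linarith)]
      · nth_rewrite 1 [← Real.rpow_one |x ω|]
        rw [← Real.rpow_add h]; congr 1; ring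
    rw [e]
    have := hpow (abs_nonneg (x ω)) (abs_nonneg (d ω)) (s := q - 1) (r := 1) (by linarith)
      (by norm_num) (by ring)
    rwa [Real.rpow_one] at this
  have hz := integral_mul_eq_zero_of_condExp hm hgm hi1 hd1 hcond
  have hi1' : Integrable (fun ω => g ω * d ω) P := hi1
  calc ∫ ω, |x ω + d ω| ^ q ∂P
      ≤ ∫ ω, (|x ω| ^ q + g ω * d ω + C * (|x ω| ^ (q - 2) * d ω ^ 2 + |d ω| ^ q)) ∂P := by
        apply integral_mono_of_nonneg (ae_of_all _ fun ω => by positivity)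
          ((hix.add hi1').add ((hi2.add hid).const_mul C)) (ae_of_all _ fun ω => hpt _ _)
    _ = ∫ ω, |x ω| ^ q ∂P + C * (∫ ω, |x ω| ^ (q - 2) * d ω ^ 2 ∂P + ∫ ω, |d ω| ^ q ∂P) := by
        rw [integral_add (f := fun ω => |x ω| ^ q + g ω * d ω) (hix.add hi1')
          (g := fun ω => C * (|x ω| ^ (q - 2) * d ω ^ 2 + |d ω| ^ q))
          ((hi2.add hid).const_mul C), integral_add hix hi1', hz, integral_const_mul,
          integral_add hi2 hid, add_zero]
    _ ≤ X ^ (q / 2) + C * (X ^ (q / 2 - 1) * Y + Y ^ (q / 2)) := by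
        have := integral_abs_rpow_mul_sq_le hq hx hd hX hY hxX hdY
        gcongr
    _ ≤ _ := rpow_add_mul_le (by linarith) hC hX hY

/-- Burkholder's inequality for reversed martingale differences. -/
lemma exists_eLpNorm_sum_Ico_le {q : ℝ} (hq : 2 ≤ q) : ∃ K : ℝ, 1 ≤ K ∧
    ∀ {Ω : Type*} [mΩ : MeasurableSpace Ω] (P : Measure Ω) [IsProbabilityMeasure P]
      (𝓗 : ℕ → MeasurableSpace Ω) (_ : ∀ i, 𝓗 i ≤ mΩ) (d : ℕ → Ω → ℝ)
      (_ : ∀ i, MemLp (d i) (ENNReal.ofReal q) P)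
      (_ : ∀ i i', i < i' → StronglyMeasurable[𝓗 i] (d i'))
      (_ : ∀ i, P[d i|𝓗 i] =ᵐ[P] 0) (c : ℝ) (_ : 0 ≤ c)
      (_ : ∀ i, eLpNorm (d i) (ENNReal.ofReal q) P ≤ ENNReal.ofReal c) (u k : ℕ),
      eLpNorm (fun ω => ∑ i ∈ Finset.Ico u (u + k), d i ω) (ENNReal.ofReal q) P
        ≤ ENNReal.ofReal (K * c * √k) := by
  obtain ⟨K, hK, hstep⟩ := exists_integral_abs_add_rpow_le hq
  have hq0 : 0 < q := by linarith
  refine ⟨√K, by rw [Real.one_le_sqrt]; exact hK, ?_⟩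
  intro Ω mΩ P _ 𝓗 hle d hd hm hcond c hc hdc u k
  have hLp : ∀ u k : ℕ, MemLp (fun ω => ∑ i ∈ Finset.Ico u (u + k), d i ω) (ENNReal.ofReal q) P :=
    fun u k => memLp_finsetSum _ fun i _ => hd i
  have hmain : ∀ k u : ℕ, ∫ ω, |∑ i ∈ Finset.Ico u (u + k), d i ω| ^ q ∂P
      ≤ (K * c ^ 2 * k) ^ (q / 2) := by
    intro k
    induction k with
    | zero => intro u; simp [Real.zero_rpow hq0.ne', Real.zero_rpow (show q / 2 ≠ 0 by linarith)]
    | succ k ih =>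
      intro u
      -- The sum grows at its lower end: the later terms are `𝓗 u`-measurable, and `d u` is centred
      -- given `𝓗 u`.
      have e : ∀ ω, ∑ i ∈ Finset.Ico u (u + (k + 1)), d i ω
          = ∑ i ∈ Finset.Ico (u + 1) (u + 1 + k), d i ω + d u ω := by
        intro ω
        rw [Finset.sum_eq_sum_Ico_succ_bot (by omega), add_comm]
        congr 2
        congr 1
        omega
      simp_rw [e]
      have := hstep P (hle u) (hLp (u + 1) k) (hd u)
        (Finset.stronglyMeasurable_fun_sum _ fun i hi => hm u i (by simp at hi; omega)) (hcond u)
        (X := K * c ^ 2 * k) (Y := c ^ 2) (by positivity) (by positivity) (ih (u + 1))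
        (by
          have h := (eLpNorm_le_ofReal_iff hq0 (hd u) hc).1 (hdc u)
          rwa [← Real.rpow_natCast, ← Real.rpow_mul hc, Nat.cast_ofNat, mul_div_cancel₀ _ (by norm_num)])
      refine this.trans (le_of_eq ?_)
      push_cast
      ring_nf
  rw [eLpNorm_le_ofReal_iff hq0 (hLp u k) (by positivity)]
  refine (hmain k u).trans (le_of_eq ?_)
  have : K * c ^ 2 * k = (√K * c * √k) ^ 2 := by
    rw [mul_pow, mul_pow, Real.sq_sqrt (by linarith), Real.sq_sqrt (by positivity)]
  rw [this, ← Real.rpow_natCast, ← Real.rpow_mul (by positivity)]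
  congr 1; push_cast; field_simp

end Burkholder

/-! ### Maxima of partial sums by dyadic splitting -/

section Dyadic

/-- A bound of the absolute partial sums of `Z` over subintervals of `[u, u + 2 ^ r)` that start
at `u`. -/
def dyadicMax {Ω : Type*} (Z : ℕ → Ω → ℝ) : ℕ → ℕ → Ω → ℝ
  | 0, u => fun ω => |Z u ω|
  | r + 1, u => fun ω => |∑ i ∈ Finset.Ico u (u + 2 ^ r), Z i ω|
      + max (dyadicMax Z r u ω) (dyadicMax Z r (u + 2 ^ r) ω)

variable {Ω : Type*} [mΩ : MeasurableSpace Ω] {P : Measure Ω} [IsProbabilityMeasure P]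

lemma dyadicMax_nonneg (Z : ℕ → Ω → ℝ) (r u : ℕ) (ω : Ω) : 0 ≤ dyadicMax Z r u ω := by
  induction r generalizing u with
  | zero => exact abs_nonneg _
  | succ r ih => exact add_nonneg (abs_nonneg _) ((ih u).trans (le_max_left _ _))

lemma abs_sum_le_dyadicMax (Z : ℕ → Ω → ℝ) (r u k : ℕ) (hk : k ≤ 2 ^ r) (ω : Ω) :
    |∑ i ∈ Finset.Ico u (u + k), Z i ω| ≤ dyadicMax Z r u ω := by
  induction r generalizing u k with
  | zero =>
    have : k = 0 ∨ k = 1 := by simp at hk; omega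
    rcases this with rfl | rfl
    · simpa using dyadicMax_nonneg Z 0 u ω
    · simp [dyadicMax]
  | succ r ih =>
    simp only [dyadicMax]
    rcases le_or_gt k (2 ^ r) with h | h
    · have := ih u k h
      have := le_max_left (dyadicMax Z r u ω) (dyadicMax Z r (u + 2 ^ r) ω)
      have := abs_nonneg (∑ i ∈ Finset.Ico u (u + 2 ^ r), Z i ω)
      linarith
    · rw [← Finset.sum_Ico_consecutive _ (show u ≤ u + 2 ^ r by omega)
        (show u + 2 ^ r ≤ u + k by omega)]
      refine (abs_add_le _ _).trans ?_
      have h1 := ih (u + 2 ^ r) (k - 2 ^ r) (by rw [pow_succ] at hk; omega)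
      rw [show u + 2 ^ r + (k - 2 ^ r) = u + k by omega] at h1
      have := le_max_right (dyadicMax Z r u ω) (dyadicMax Z r (u + 2 ^ r) ω)
      linarith

lemma memLp_dyadicMax {q : ENNReal} {Z : ℕ → Ω → ℝ} (hZ : ∀ i, MemLp (Z i) q P)
    (r u : ℕ) : MemLp (dyadicMax Z r u) q P := by
  induction r generalizing u with
  | zero => exact (hZ u).abs
  | succ r ih =>
    exact (memLp_finsetSum _ fun i _ => hZ i).abs.add ((ih u).sup (ih _))

/-- A maximum of two costs a factor `2 ^ (1 / q)` in `L^q`, whereas the target grows by `√2` per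
doubling. Since `q > 2`, the recursion closes without a logarithm. -/
lemma exists_integral_dyadicMax_le {q : ℝ} (hq : 2 < q) : ∃ K : ℝ, 1 ≤ K ∧
    ∀ {Ω : Type*} [MeasurableSpace Ω] (P : Measure Ω) [IsProbabilityMeasure P]
      (Z : ℕ → Ω → ℝ) (_ : ∀ i, MemLp (Z i) (ENNReal.ofReal q) P) (c : ℝ) (_ : 0 ≤ c)
      (_ : ∀ u k : ℕ, eLpNorm (fun ω => ∑ i ∈ Finset.Ico u (u + k), Z i ω) (ENNReal.ofReal q) P
        ≤ ENNReal.ofReal (c * √k)) (r u : ℕ),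
      ∫ ω, |dyadicMax Z r u ω| ^ q ∂P ≤ (K * c * √(2 ^ r)) ^ q := by
  have hq0 : 0 < q := by linarith
  have hgap : 0 < √2 - 2 ^ (1 / q) := by
    rw [sub_pos, Real.sqrt_eq_rpow]
    apply Real.rpow_lt_rpow_of_exponent_lt (by norm_num)
    exact one_div_lt_one_div_of_lt (by norm_num) hq
  -- `K` solves `1 + 2 ^ (1 / q) * K ≤ √2 * K`, which is the induction step.
  set K := max 1 (1 / (√2 - 2 ^ (1 / q))) with hKdef
  have hK1 : 1 ≤ K := le_max_left _ _
  have hK2 : 1 + 2 ^ (1 / q) * K ≤ √2 * K := by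
    have : 1 / (√2 - 2 ^ (1 / q)) ≤ K := le_max_right _ _
    rw [div_le_iff₀ hgap] at this
    linarith
  refine ⟨K, hK1, ?_⟩
  intro Ω mΩ P _ Z hZ c hc hb r
  have hLp := memLp_dyadicMax hZ
  induction r with
  | zero =>
    intro u
    have h := (eLpNorm_le_ofReal_iff hq0 (hZ u) hc).1 (by simpa using hb u 1)
    simp only [dyadicMax, abs_abs, pow_zero, Real.sqrt_one, mul_one]
    refine h.trans ?_
    apply Real.rpow_le_rpow hc _ hq0.le
    nlinarith
  | succ r ih =>
    intro u
    set w := √(2 ^ r : ℝ) with hw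
    have hmax : MemLp (fun ω => max (dyadicMax Z r u ω) (dyadicMax Z r (u + 2 ^ r) ω))
        (ENNReal.ofReal q) P := (hLp r u).sup (hLp r _)
    have h1 : ∫ ω, |max (dyadicMax Z r u ω) (dyadicMax Z r (u + 2 ^ r) ω)| ^ q ∂P
        ≤ (2 ^ (1 / q) * (K * c * w)) ^ q := by
      have i1 := integrable_abs_rpow hq0 (hLp r u)
      have i2 := integrable_abs_rpow hq0 (hLp r (u + 2 ^ r))
      calc _ ≤ ∫ ω, (|dyadicMax Z r u ω| ^ q + |dyadicMax Z r (u + 2 ^ r) ω| ^ q) ∂P := by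
            refine integral_mono_of_nonneg (ae_of_all _ fun ω => by positivity) (i1.add i2)
              (ae_of_all _ fun ω => ?_)
            have e1 : 0 ≤ |dyadicMax Z r u ω| ^ q := by positivity
            have e2 : 0 ≤ |dyadicMax Z r (u + 2 ^ r) ω| ^ q := by positivity
            simp only
            rcases max_choice (dyadicMax Z r u ω) (dyadicMax Z r (u + 2 ^ r) ω) with h | h <;>
              rw [h] <;> linarith
        _ ≤ (K * c * w) ^ q + (K * c * w) ^ q := by
            rw [integral_add i1 i2]
            exact add_le_add (ih u) (ih _)
        _ = _ := by
            rw [Real.mul_rpow (x := 2 ^ (1 / q)) (by positivity) (by positivity),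
              ← Real.rpow_mul (by norm_num), one_div_mul_cancel hq0.ne', Real.rpow_one]
            ring
    have hsum : MemLp (fun ω => |∑ i ∈ Finset.Ico u (u + 2 ^ r), Z i ω|) (ENNReal.ofReal q) P :=
      (memLp_finsetSum _ fun i _ => hZ i).abs
    have h2 := (eLpNorm_le_ofReal_iff hq0 hmax (by positivity)).2 h1
    have h3 : eLpNorm (fun ω => |∑ i ∈ Finset.Ico u (u + 2 ^ r), Z i ω|) (ENNReal.ofReal q) P
        ≤ ENNReal.ofReal (c * w) := by
      have := hb u (2 ^ r)
      push_cast at this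
      rwa [← eLpNorm_norm] at this
    have h4 : eLpNorm (dyadicMax Z (r + 1) u) (ENNReal.ofReal q) P
        ≤ ENNReal.ofReal (c * w + 2 ^ (1 / q) * (K * c * w)) := by
      rw [ENNReal.ofReal_add (by positivity) (by positivity)]
      refine (eLpNorm_add_le hsum.1 hmax.1 ?_).trans (add_le_add h3 h2)
      rw [← ENNReal.ofReal_one]
      exact ENNReal.ofReal_le_ofReal (by linarith)
    refine ((eLpNorm_le_ofReal_iff hq0 (hLp _ u) (by positivity)).1 h4).trans ?_
    apply Real.rpow_le_rpow (by positivity) _ hq0.le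
    rw [pow_succ, Real.sqrt_mul (by positivity)]
    calc c * w + 2 ^ (1 / q) * (K * c * w) = (1 + 2 ^ (1 / q) * K) * (c * w) := by ring
      _ ≤ √2 * K * (c * w) := by gcongr
      _ = _ := by rw [hw]; ring

end Dyadic

/-! ### Arrays of martingale projections, one dyadic level of lags at a time -/

section ProjectionArray

/-- The join of the `σ`-algebras `m k`, `k ∈ S`. -/
@[reducible] def sigmaOn {Ω : Type*} (m : ℤ → MeasurableSpace Ω) (S : Set ℤ) : MeasurableSpace Ω :=
  ⨆ k ∈ S, m k

lemma sigmaOn_mono {Ω : Type*} (m : ℤ → MeasurableSpace Ω) {S T : Set ℤ} (h : S ⊆ T) :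
    sigmaOn m S ≤ sigmaOn m T :=
  biSup_mono h

lemma sigmaOn_le {Ω : Type*} {mΩ : MeasurableSpace Ω} {m : ℤ → MeasurableSpace Ω}
    (h : ∀ k, m k ≤ mΩ) (S : Set ℤ) : sigmaOn m S ≤ mΩ :=
  iSup₂_le fun k _ => h k

/-- An array of random variables `D i j` such that `D i j` depends only on the innovations
`i - j, …, i` and is centred given the innovations after `i - j`. -/
structure IsProjectionArray {Ω : Type*} [mΩ : MeasurableSpace Ω] (P : Measure Ω)
    (m : ℤ → MeasurableSpace Ω) (q : ℝ) (D : ℕ → ℕ → Ω → ℝ) (α β : ℕ → ℝ) : Prop where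
  le : ∀ k, m k ≤ mΩ
  indep : iIndep m P
  memLp : ∀ i j, MemLp (D i j) (ENNReal.ofReal q) P
  meas : ∀ i j : ℕ, StronglyMeasurable[sigmaOn m (Set.Icc ((i : ℤ) - j) i)] (D i j)
  condExp_eq : ∀ i j : ℕ, P[D i j|sigmaOn m (Set.Ioi ((i : ℤ) - j))] =ᵐ[P] 0
  norm_le : ∀ i j, eLpNorm (D i j) (ENNReal.ofReal q) P ≤ ENNReal.ofReal (α j)
  norm_two_le : ∀ i j, eLpNorm (D i j) (ENNReal.ofReal 2) P ≤ ENNReal.ofReal (β j)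
  nonneg : ∀ j, 0 ≤ α j
  nonneg' : ∀ j, 0 ≤ β j

/-- For a fixed lag `j` the variables `D i j` are reversed martingale differences in `i`: if `i' >
i`, then `D i' j` uses only innovations after `i - j`, given which `D i j` is centred. The lags are
then added by Minkowski's inequality. -/
lemma exists_eLpNorm_projection_sum_le {q : ℝ} (hq : 2 ≤ q) : ∃ K : ℝ, 1 ≤ K ∧
    ∀ {Ω : Type*} [MeasurableSpace Ω] (P : Measure Ω) [IsProbabilityMeasure P]
      (m : ℤ → MeasurableSpace Ω) (D : ℕ → ℕ → Ω → ℝ) (α β : ℕ → ℝ)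
      (_ : IsProjectionArray P m q D α β) (J : Finset ℕ) (u k : ℕ),
      eLpNorm (fun ω => ∑ i ∈ Finset.Ico u (u + k), ∑ j ∈ J, D i j ω) (ENNReal.ofReal q) P
        ≤ ENNReal.ofReal (K * (∑ j ∈ J, α j) * √k) := by
  obtain ⟨K, hK, hB⟩ := exists_eLpNorm_sum_Ico_le hq
  refine ⟨K, hK, ?_⟩
  intro Ω _ P _ m D α β hD J u k
  have hcomm : (fun ω => ∑ i ∈ Finset.Ico u (u + k), ∑ j ∈ J, D i j ω)
      = ∑ j ∈ J, fun ω => ∑ i ∈ Finset.Ico u (u + k), D i j ω := by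
    ext ω
    rw [Finset.sum_comm, Finset.sum_apply]
  have h1 : (1 : ENNReal) ≤ ENNReal.ofReal q := by
    rw [← ENNReal.ofReal_one]; exact ENNReal.ofReal_le_ofReal (by linarith)
  rw [hcomm]
  refine (eLpNorm_sum_le (fun j _ => (memLp_finsetSum _ fun i _ => hD.memLp i j).1) h1).trans ?_
  rw [Finset.mul_sum, Finset.sum_mul, ENNReal.ofReal_sum_of_nonneg
    (fun j _ => mul_nonneg (mul_nonneg (by linarith) (hD.nonneg j)) (Real.sqrt_nonneg _))]
  refine Finset.sum_le_sum fun j _ => ?_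
  refine hB P (fun i => sigmaOn m (Set.Ioi ((i : ℤ) - j))) (fun i => sigmaOn_le hD.le _)
    (fun i => D i j) (fun i => hD.memLp i j) (fun i i' hii => ?_) (fun i => hD.condExp_eq i j)
    (α j) (hD.nonneg j) (fun i => hD.norm_le i j) u k
  refine (hD.meas i' j).mono (sigmaOn_mono m fun z hz => ?_)
  simp only [Set.mem_Icc, Set.mem_Ioi] at hz ⊢
  omega

/-- Makes the moment bound available at exponent `2`, where it controls the variance of a block. -/
lemma IsProjectionArray.two {Ω : Type*} [mΩ : MeasurableSpace Ω] {P : Measure Ω}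
    [IsProbabilityMeasure P]
    {m : ℤ → MeasurableSpace Ω} {q : ℝ} (hq : 2 ≤ q) {D : ℕ → ℕ → Ω → ℝ} {α β : ℕ → ℝ}
    (h : IsProjectionArray P m q D α β) : IsProjectionArray P m 2 D β β where
  le := h.le
  indep := h.indep
  memLp i j := (h.memLp i j).mono_exponent (ENNReal.ofReal_le_ofReal hq)
  meas := h.meas
  condExp_eq := h.condExp_eq
  norm_le := h.norm_two_le
  norm_two_le := h.norm_two_le
  nonneg := h.nonneg'
  nonneg' := h.nonneg'

lemma sum_range_even_odd {M : Type*} [AddCommMonoid M] (f : ℕ → M) (s : ℕ) :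
    ∑ t ∈ Finset.range s, f t = ∑ r ∈ Finset.range ((s + 1) / 2), f (2 * r)
      + ∑ r ∈ Finset.range (s / 2), f (2 * r + 1) := by
  induction s with
  | zero => simp
  | succ s ih =>
    rw [Finset.sum_range_succ, ih]
    rcases Nat.even_or_odd' s with ⟨c, rfl | rfl⟩
    · rw [show (2 * c + 1 + 1) / 2 = c + 1 by omega, show (2 * c + 1) / 2 = c by omega,
        show 2 * c / 2 = c by omega, Finset.sum_range_succ]
      abel
    · rw [show (2 * c + 1 + 1 + 1) / 2 = c + 1 by omega, show (2 * c + 1 + 1) / 2 = c + 1 by omega,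
        show (2 * c + 1) / 2 = c by omega, Finset.sum_range_succ (fun r => f (2 * r + 1))]
      abel

lemma sum_range_eq_sum_blocks {M : Type*} [AddCommMonoid M] (f : ℕ → M) (B k : ℕ) :
    ∑ i ∈ Finset.range k, f i = ∑ t ∈ Finset.range (k / B), ∑ i ∈ Finset.Ico (t * B) (t * B + B), f i
      + ∑ i ∈ Finset.Ico (k / B * B) (k / B * B + k % B), f i := by
  have h1 : ∀ s, ∑ t ∈ Finset.range s, ∑ i ∈ Finset.Ico (t * B) (t * B + B), f i
      = ∑ i ∈ Finset.range (s * B), f i := by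
    intro s
    induction s with
    | zero => simp
    | succ s ih =>
      rw [Finset.sum_range_succ, ih, Finset.range_eq_Ico, Finset.range_eq_Ico,
        Finset.sum_Ico_consecutive _ (by omega) (by omega), add_mul, one_mul]
  rw [h1, Nat.div_add_mod', Finset.range_eq_Ico, Finset.range_eq_Ico,
    Finset.sum_Ico_consecutive _ (by omega) (Nat.div_mul_le_self k B)]

variable {Ω : Type*} [mΩ : MeasurableSpace Ω] {P : Measure Ω} [IsProbabilityMeasure P]
  {m : ℤ → MeasurableSpace Ω} {q : ℝ} {D : ℕ → ℕ → Ω → ℝ} {α β : ℕ → ℝ}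

lemma IsProjectionArray.integral_eq_zero (hD : IsProjectionArray P m q D α β) (i j : ℕ) :
    ∫ ω, D i j ω ∂P = 0 := by
  have h := integral_condExp (μ := P) (f := D i j)
    (sigmaOn_le hD.le (Set.Ioi ((i : ℤ) - j)))
  rw [integral_congr_ae (hD.condExp_eq i j)] at h
  simpa using h.symm

/-- The tail bound for the sum of every second block. -/
lemma exists_measure_alternate_blocks_le (hq : 2 < q) : ∃ C : ℝ, 1 ≤ C ∧
    ∀ {Ω : Type*} [MeasurableSpace Ω] (P : Measure Ω) [IsProbabilityMeasure P]
      (m : ℤ → MeasurableSpace Ω) (D : ℕ → ℕ → Ω → ℝ) (α β : ℕ → ℝ)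
      (_ : IsProjectionArray P m q D α β) (J : Finset ℕ) (B : ℕ) (_ : ∀ j ∈ J, j < B)
      {b : ℝ} (_ : ∑ j ∈ J, β j ≤ b) (c R : ℕ) {x : ℝ} (_ : 0 < x),
      P.real {ω | ∃ k ≤ R, x ≤ |∑ r ∈ Finset.range k,
          ∑ i ∈ Finset.Ico ((2 * r + c) * B) ((2 * r + c) * B + B), ∑ j ∈ J, D i j ω|}
        ≤ C * (R * (√B * (∑ j ∈ J, α j)) ^ q / x ^ q
          + Real.exp (-(x ^ 2 / (C * (R * B * b ^ 2))))) := by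
  obtain ⟨K, hK, hB⟩ := exists_eLpNorm_projection_sum_le hq.le
  obtain ⟨K₂, hK₂, hB₂⟩ := exists_eLpNorm_projection_sum_le (le_refl (2 : ℝ))
  have hq0 : 0 < q := by linarith
  set C₁ := 8 * (2 * K) ^ q with hC₁
  set C₂ := 8 * Real.exp q * K₂ ^ 2 with hC₂
  have hC₂0 : 0 < C₂ := by positivity
  have hC₁0 : 0 < C₁ := by positivity
  refine ⟨C₁ + C₂ + 6, by linarith, ?_⟩
  intro Ω mΩ P _ m D α β hD J B hJ b hJb c R x hx
  have hα0 : 0 ≤ ∑ j ∈ J, α j := Finset.sum_nonneg fun j _ => hD.nonneg j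
  have hβ0 : 0 ≤ ∑ j ∈ J, β j := Finset.sum_nonneg fun j _ => hD.nonneg' j
  have hb0 : 0 ≤ b := hβ0.trans hJb
  set ξ : ℕ → Ω → ℝ := fun r ω =>
    ∑ i ∈ Finset.Ico ((2 * r + c) * B) ((2 * r + c) * B + B), ∑ j ∈ J, D i j ω with hξ
  -- Block `2 * r + c` with lags below `B` uses only innovations from `(2 * r + c - 1) * B` on, and
  -- before `(2 * r + c + 1) * B`. Cutting `𝓕 r` at the lower index therefore gives both
  -- independence and adaptedness.
  set 𝓕 : ℕ → MeasurableSpace Ω := fun r => sigmaOn m (Set.Iio ((2 * (r : ℤ) + c - 1) * B)) with h𝓕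
  have hLp : ∀ r, MemLp (ξ r) (ENNReal.ofReal q) P := fun r =>
    memLp_finsetSum _ fun i _ => memLp_finsetSum _ fun j _ => hD.memLp i j
  have hLp1 : ∀ i j, Integrable (D i j) P := fun i j => (hD.memLp i j).integrable (by
    rw [← ENNReal.ofReal_one]; exact ENNReal.ofReal_le_ofReal (by linarith))
  have hmeas : ∀ r : ℕ, Measurable[sigmaOn m (Set.Ico ((2 * (r : ℤ) + c - 1) * B)
      ((2 * (r : ℤ) + c - 1) * B + 2 * B))] (ξ r) := by
    intro r
    refine (Finset.stronglyMeasurable_fun_sum _ fun i hi =>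
      Finset.stronglyMeasurable_fun_sum _ fun j hj => ?_).measurable
    refine (hD.meas i j).mono (sigmaOn_mono m fun z hz => ?_)
    have hjB := hJ j hj
    rw [Finset.mem_Ico] at hi
    simp only [Set.mem_Icc, Set.mem_Ico] at hz ⊢
    zify at hi hjB
    constructor <;> nlinarith
  have hmono : Monotone 𝓕 := by
    intro r s hrs
    refine sigmaOn_mono m (Set.Iio_subset_Iio ?_)
    gcongr
  have hadp : ∀ r, Measurable[𝓕 (r + 1)] (ξ r) := by
    intro r
    refine (hmeas r).mono (sigmaOn_mono m fun z hz => ?_) le_rfl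
    simp only [Set.mem_Ico, Set.mem_Iio] at hz ⊢
    push_cast
    nlinarith
  have hind : ∀ r, Indep (𝓕 r) (MeasurableSpace.comap (ξ r) inferInstance) P := by
    intro r
    refine indep_of_indep_of_le_right ?_ (hmeas r).comap_le
    refine indep_iSup_of_disjoint hD.le hD.indep ?_
    rw [Set.disjoint_left]
    intro z hz hz'
    simp only [Set.mem_Ico, Set.mem_Iio] at hz hz'
    omega
  have hmean : ∀ r, ∫ ω, ξ r ω ∂P = 0 := by
    intro r
    rw [hξ, integral_finsetSum _ fun i _ => integrable_finsetSum _ fun j _ => hLp1 i j]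
    refine Finset.sum_eq_zero fun i _ => ?_
    rw [integral_finsetSum _ fun j _ => hLp1 i j]
    exact Finset.sum_eq_zero fun j _ => hD.integral_eq_zero i j
  have ha : ∀ r, ∫ ω, |ξ r ω| ^ q ∂P ≤ (K * (∑ j ∈ J, α j) * √B) ^ q := fun r =>
    (eLpNorm_le_ofReal_iff hq0 (hLp r) (by positivity)).1 (hB P m D α β hD J _ B)
  have hv : ∀ r, ∫ ω, ξ r ω ^ 2 ∂P ≤ (K₂ * b * √B) ^ 2 := fun r => by
    have := (eLpNorm_le_ofReal_iff (by norm_num) ((hLp r).mono_exponent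
      (ENNReal.ofReal_le_ofReal hq.le)) (by positivity)).1
      (hB₂ P m D β β (hD.two hq.le) J ((2 * r + c) * B) B)
    refine (by simpa using this : _ ≤ (K₂ * (∑ j ∈ J, β j) * √B) ^ 2).trans ?_
    gcongr
  have hFN := measure_exists_le_abs_sum_le hq hmono (fun r => sigmaOn_le hD.le _) hadp hind hLp
    hmean ha hv R hx
  refine hFN.trans ?_
  have e1 : 8 * (R * (K * (∑ j ∈ J, α j) * √B) ^ q / (x / 2) ^ q)
      = C₁ * (R * (√B * (∑ j ∈ J, α j)) ^ q / x ^ q) := by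
    rw [hC₁, show K * (∑ j ∈ J, α j) * √B = K * (√B * (∑ j ∈ J, α j)) by ring,
      Real.mul_rpow (by linarith) (by positivity), Real.div_rpow hx.le (by norm_num),
      Real.mul_rpow (x := 2) (y := K) (by norm_num) (by linarith)]
    field_simp
  have e2 : 8 * Real.exp q * (R * (K₂ * b * √B) ^ 2)
      = C₂ * (R * B * b ^ 2) := by
    rw [hC₂, mul_pow, mul_pow, Real.sq_sqrt (by positivity)]; ring
  rw [e1, e2]
  have h1 : 0 ≤ R * (√B * (∑ j ∈ J, α j)) ^ q / x ^ q := by positivity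
  have h2 : Real.exp (-(x ^ 2 / (C₂ * (R * B * b ^ 2))))
      ≤ Real.exp (-(x ^ 2 / ((C₁ + C₂ + 6) * (R * B * b ^ 2)))) := by
    apply Real.exp_le_exp.2
    apply neg_le_neg
    rcases (show 0 ≤ (R * B * b ^ 2 : ℝ) by positivity).eq_or_lt with h | h
    · rw [← h]; simp
    · gcongr
      linarith
  have h3 : 0 ≤ Real.exp (-(x ^ 2 / ((C₁ + C₂ + 6) * (R * B * b ^ 2)))) :=
    (Real.exp_pos _).le
  nlinarith [mul_nonneg hC₁0.le h3, mul_nonneg hC₂0.le h3, mul_nonneg hC₂0.le h1]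

/-- Only Burkholder and the dyadic maximum, hence no restriction on the lags in `J`. It serves for
incomplete blocks and for the lags beyond the sample size. -/
lemma exists_measure_interval_le (hq : 2 < q) : ∃ K : ℝ, 1 ≤ K ∧
    ∀ {Ω : Type*} [MeasurableSpace Ω] (P : Measure Ω) [IsProbabilityMeasure P]
      (m : ℤ → MeasurableSpace Ω) (D : ℕ → ℕ → Ω → ℝ) (α β : ℕ → ℝ)
      (_ : IsProjectionArray P m q D α β) (J : Finset ℕ) (r u : ℕ) {x : ℝ} (_ : 0 < x),
      P.real {ω | ∃ k ≤ 2 ^ r, x ≤ |∑ i ∈ Finset.Ico u (u + k), ∑ j ∈ J, D i j ω|}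
        ≤ K * ((√(2 ^ r) * (∑ j ∈ J, α j)) ^ q / x ^ q) := by
  obtain ⟨K, hK, hB⟩ := exists_eLpNorm_projection_sum_le hq.le
  obtain ⟨K', hK', hB'⟩ := exists_integral_dyadicMax_le hq
  have hq0 : 0 < q := by linarith
  refine ⟨(K' * K) ^ q, Real.one_le_rpow (by nlinarith) hq0.le, ?_⟩
  intro Ω mΩ P _ m D α β hD J r u x hx
  have hα0 : 0 ≤ ∑ j ∈ J, α j := Finset.sum_nonneg fun j _ => hD.nonneg j
  set Z : ℕ → Ω → ℝ := fun i ω => ∑ j ∈ J, D i j ω with hZ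
  have hLp : ∀ i, MemLp (Z i) (ENNReal.ofReal q) P := fun i =>
    memLp_finsetSum _ fun j _ => hD.memLp i j
  have h1 := hB' P Z hLp (K * ∑ j ∈ J, α j) (by positivity) (fun u k => hB P m D α β hD J u k) r u
  have h2 := measure_le_abs_le_of_integral_rpow_le hq0 (memLp_dyadicMax hLp r u) h1 hx
  refine (measureReal_mono ?_).trans (h2.trans (le_of_eq ?_))
  · rintro ω ⟨k, hk, hxk⟩
    exact hxk.trans ((abs_sum_le_dyadicMax Z r u k hk ω).trans (le_abs_self _))
  · rw [mul_div_assoc', ← Real.mul_rpow (by positivity) (by positivity)]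
    congr 2
    ring

/-- A partial sum consists of its even blocks, its odd blocks and an incomplete last block; each
receives `x / 3`. Around `n / 2 ^ r` blocks, each of `q`-th moment of order `(2 ^ r) ^ (q / 2)`,
produce the factor `n * (2 ^ r) ^ (q / 2 - 1)`. -/
lemma exists_measure_level_le (hq : 2 < q) : ∃ C : ℝ, 1 ≤ C ∧
    ∀ {Ω : Type*} [MeasurableSpace Ω] (P : Measure Ω) [IsProbabilityMeasure P]
      (m : ℤ → MeasurableSpace Ω) (D : ℕ → ℕ → Ω → ℝ) (α β : ℕ → ℝ)
      (_ : IsProjectionArray P m q D α β) (J : Finset ℕ) (r : ℕ) (_ : ∀ j ∈ J, j < 2 ^ r)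
      {b : ℝ} (_ : ∑ j ∈ J, β j ≤ b) (n : ℕ) (_ : 2 ^ r ≤ 2 * n) {x : ℝ} (_ : 0 < x),
      P.real {ω | ∃ k ≤ n, x ≤ |∑ i ∈ Finset.range k, ∑ j ∈ J, D i j ω|}
        ≤ C * (n * (2 ^ r : ℝ) ^ (q / 2 - 1) * (∑ j ∈ J, α j) ^ q / x ^ q
          + Real.exp (-(x ^ 2 / (C * (n * b ^ 2))))) := by
  obtain ⟨C₁, hC₁, hA⟩ := exists_measure_alternate_blocks_le hq
  obtain ⟨K, hK, hI⟩ := exists_measure_interval_le hq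
  have hq0 : 0 < q := by linarith
  have h3q : (1 : ℝ) ≤ 3 ^ q := Real.one_le_rpow (by norm_num) hq0.le
  refine ⟨3 * 3 ^ q * (2 * C₁ + K) + 27 * C₁, by nlinarith, ?_⟩
  set C := 3 * 3 ^ q * (2 * C₁ + K) + 27 * C₁ with hC
  intro Ω mΩ P _ m D α β hD J r hJ b hJb n hrn x hx
  set a := ∑ j ∈ J, α j with ha
  have ha0 : 0 ≤ a := Finset.sum_nonneg fun j _ => hD.nonneg j
  have hb0 : 0 ≤ b := (Finset.sum_nonneg fun j _ => hD.nonneg' j).trans hJb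
  set B := 2 ^ r with hB
  have hBp : 0 < B := by positivity
  set R := n / B + 1 with hR
  -- `R * B ≤ n + B`, and `B ≤ 2 * n` by assumption.
  have hRB : (R : ℝ) * B ≤ 3 * n := by
    have h1 : R * B ≤ 3 * n := by
      have := Nat.div_mul_le_self n B
      rw [hR, add_mul, one_mul]
      omega
    exact_mod_cast h1
  have hBr : (0 : ℝ) < B := by exact_mod_cast hBp
  have hBcast : (B : ℝ) = 2 ^ r := by rw [hB]; push_cast; rfl
  have hx3 : 0 < x / 3 := by positivity
  have he := hA P m D α β hD J B hJ hJb 0 R hx3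
  have ho := hA P m D α β hD J B hJ hJb 1 R hx3
  have hi := fun t => hI P m D α β hD J r t hx3
  set E : ℕ → Set Ω := fun c => {ω | ∃ k ≤ R, x / 3 ≤ |∑ r ∈ Finset.range k,
          ∑ i ∈ Finset.Ico ((2 * r + c) * B) ((2 * r + c) * B + B), ∑ j ∈ J, D i j ω|} with hE
  set F : ℕ → Set Ω := fun u => {ω | ∃ k ≤ 2 ^ r, x / 3 ≤ |∑ i ∈ Finset.Ico u (u + k),
    ∑ j ∈ J, D i j ω|} with hF
  have hsub : {ω | ∃ k ≤ n, x ≤ |∑ i ∈ Finset.range k, ∑ j ∈ J, D i j ω|}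
      ⊆ (E 0 ∪ E 1) ∪ ⋃ t ∈ Finset.range R, F (t * B) := by
    rintro ω ⟨k, hk, hxk⟩
    by_contra hcon
    simp only [Set.mem_union, not_or, Set.mem_iUnion, Finset.mem_range, not_exists] at hcon
    obtain ⟨⟨h0, h1⟩, h2⟩ := hcon
    have hkB : k / B < R := by
      have := Nat.div_le_div_right (c := B) hk
      omega
    have g0 : |∑ r ∈ Finset.range ((k / B + 1) / 2),
        ∑ i ∈ Finset.Ico ((2 * r) * B) ((2 * r) * B + B), ∑ j ∈ J, D i j ω| < x / 3 := by
      by_contra hg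
      exact h0 ⟨(k / B + 1) / 2, (Nat.div_le_self _ 2).trans hkB, by simpa using hg⟩
    have g1 : |∑ r ∈ Finset.range ((k / B) / 2),
        ∑ i ∈ Finset.Ico ((2 * r + 1) * B) ((2 * r + 1) * B + B), ∑ j ∈ J, D i j ω| < x / 3 := by
      by_contra hg
      exact h1 ⟨(k / B) / 2, (Nat.div_le_self _ 2).trans hkB.le, by simpa using hg⟩
    have g2 : |∑ i ∈ Finset.Ico (k / B * B) (k / B * B + k % B), ∑ j ∈ J, D i j ω| < x / 3 := by
      by_contra hg
      exact h2 (k / B) hkB ⟨k % B, (Nat.mod_lt k hBp).le, by simpa using hg⟩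
    rw [sum_range_eq_sum_blocks _ B, sum_range_even_odd] at hxk
    have := (abs_add_le _ _).trans (add_le_add_left (abs_add_le _ _) _) |>.trans' hxk
    linarith
  have h1 := (measureReal_mono hsub).trans ((measureReal_union_le (μ := P) _ _).trans
    (add_le_add (measureReal_union_le _ _) (measureReal_biUnion_finset_le _ _)))
  set p₀ := n * (2 ^ r : ℝ) ^ (q / 2 - 1) * a ^ q / x ^ q with hp₀
  have hp₀0 : 0 ≤ p₀ := by positivity
  have hpoly : R * ((√B * a) ^ q / (x / 3) ^ q) ≤ 3 * 3 ^ q * p₀ := by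
    have e1 : (√B * a) ^ q = (B : ℝ) ^ (q / 2 - 1) * B * a ^ q := by
      rw [Real.mul_rpow (by positivity) ha0, Real.sqrt_eq_rpow, ← Real.rpow_mul hBr.le]
      congr 1
      nth_rewrite 3 [← Real.rpow_one (B : ℝ)]
      rw [← Real.rpow_add hBr]; congr 1; ring
    rw [e1, Real.div_rpow hx.le (by norm_num)]
    calc _ = (R * B) * ((B : ℝ) ^ (q / 2 - 1) * a ^ q / x ^ q * 3 ^ q) := by field_simp
      _ ≤ (3 * n) * ((B : ℝ) ^ (q / 2 - 1) * a ^ q / x ^ q * 3 ^ q) := by gcongr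
      _ = _ := by rw [hp₀, hBcast]; ring
  have hpoly2 : R * (√B * a) ^ q / (x / 3) ^ q ≤ 3 * 3 ^ q * p₀ := by rwa [mul_div_assoc]
  set ex := Real.exp (-(x ^ 2 / (C * (n * b ^ 2)))) with hex
  have hexp : Real.exp (-((x / 3) ^ 2 / (C₁ * (R * B * b ^ 2)))) ≤ ex := by
    apply Real.exp_le_exp.2
    apply neg_le_neg
    rcases hb0.eq_or_lt with h | h
    · rw [← h]; simp
    rcases (Nat.cast_nonneg (α := ℝ) n).eq_or_lt with h' | h'
    · rw [← h']; simp; positivity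
    have hRp : (0 : ℝ) < R := by rw [hR]; positivity
    have : 27 * C₁ ≤ C := by
      have : 0 ≤ 3 * 3 ^ q * (2 * C₁ + K) := by positivity
      linarith
    calc x ^ 2 / (C * (n * b ^ 2)) ≤ x ^ 2 / (27 * C₁ * (n * b ^ 2)) := by gcongr
      _ = (x / 3) ^ 2 / (C₁ * (3 * n * b ^ 2)) := by field_simp; norm_num
      _ ≤ _ := by gcongr
  have hint : ∑ t ∈ Finset.range R, P.real (F (t * B)) ≤ K * (3 * 3 ^ q * p₀) := by
    calc _ ≤ ∑ t ∈ Finset.range R, K * ((√B * a) ^ q / (x / 3) ^ q) := by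
          refine Finset.sum_le_sum fun t _ => ?_
          have := hi (t * B)
          rwa [← hBcast] at this
      _ = K * (R * ((√B * a) ^ q / (x / 3) ^ q)) := by
          rw [Finset.sum_const, Finset.card_range, nsmul_eq_mul]; ring
      _ ≤ _ := by gcongr
  have h2 : P.real (E 0) ≤ C₁ * (3 * 3 ^ q * p₀ + ex) := he.trans (by gcongr)
  have h3 : P.real (E 1) ≤ C₁ * (3 * 3 ^ q * p₀ + ex) := ho.trans (by gcongr)
  have hex0 : 0 < ex := Real.exp_pos _
  have h4 : 0 ≤ 3 * 3 ^ q * (2 * C₁ + K) * ex := by positivity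
  have h5 : 0 ≤ C₁ * p₀ := by positivity
  have h6 : 0 ≤ C₁ * ex := by positivity
  nlinarith

end ProjectionArray

/-! ### Weights that distribute the deviation over the levels -/

section LevelWeights

/-- The weight of level `l < L`; the weights are summable from both ends, with sum at most `1`. -/
def levelWeight (L l : ℕ) : ℝ :=
  1 / 4 * (1 / ((l : ℝ) + 1) ^ 2 + 1 / ((L - 1 - l : ℕ) + 1 : ℝ) ^ 2)

lemma sum_range_inv_succ_sq_le (L : ℕ) : ∑ l ∈ Finset.range L, 1 / ((l : ℝ) + 1) ^ 2 ≤ 2 := by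
  have h : ∀ L : ℕ, ∑ l ∈ Finset.range (L + 1), 1 / ((l : ℝ) + 1) ^ 2 ≤ 2 - 1 / ((L : ℝ) + 1) := by
    intro L
    induction L with
    | zero => norm_num
    | succ L ih =>
      rw [Finset.sum_range_succ]
      have : 1 / (((L + 1 : ℕ) : ℝ) + 1) ^ 2 ≤ 1 / ((L : ℝ) + 1) - 1 / (((L + 1 : ℕ) : ℝ) + 1) := by
        push_cast
        rw [div_sub_div _ _ (by positivity) (by positivity), div_le_div_iff₀ (by positivity) (by positivity)]
        ring_nf
        nlinarith [(Nat.cast_nonneg L : (0 : ℝ) ≤ L)]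
      linarith
  rcases L with _ | L
  · simp
  · refine (h L).trans ?_
    have : 0 ≤ 1 / ((L : ℝ) + 1) := by positivity
    linarith

lemma sum_levelWeight_le (L : ℕ) : ∑ l ∈ Finset.range L, levelWeight L l ≤ 1 := by
  have h1 := sum_range_inv_succ_sq_le L
  have h2 : ∑ l ∈ Finset.range L, 1 / ((L - 1 - l : ℕ) + 1 : ℝ) ^ 2
      = ∑ l ∈ Finset.range L, 1 / ((l : ℝ) + 1) ^ 2 :=
    Finset.sum_range_reflect (fun l : ℕ => 1 / ((l : ℝ) + 1) ^ 2) L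
  unfold levelWeight
  rw [← Finset.mul_sum, Finset.sum_add_distrib, h2]
  linarith

lemma levelWeight_pos (L l : ℕ) : 0 < levelWeight L l := by
  unfold levelWeight; positivity

/-- Either summand alone bounds the weight from below, so the loss can be counted from the lowest
level or from the highest one, whichever dominates the sum over the levels. -/
lemma inv_levelWeight_rpow_le {q : ℝ} (hq : 0 ≤ q) (L l : ℕ) :
    (levelWeight L l ^ q)⁻¹ ≤ 4 ^ q * ((l : ℝ) + 1) ^ (2 * q) ∧
    (levelWeight L l ^ q)⁻¹ ≤ 4 ^ q * ((L - 1 - l : ℕ) + 1 : ℝ) ^ (2 * q) := by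
  have key : ∀ y : ℝ, 0 < y → 1 / 4 * (1 / y ^ 2) ≤ levelWeight L l →
      (levelWeight L l ^ q)⁻¹ ≤ 4 ^ q * y ^ (2 * q) := by
    intro y hy h
    have e : 4 ^ q * y ^ (2 * q) = ((1 / 4 * (1 / y ^ 2)) ^ q)⁻¹ := by
      rw [← Real.inv_rpow (by positivity), Real.rpow_mul hy.le,
        ← Real.mul_rpow (by norm_num) (by positivity)]
      congr 1
      rw [Real.rpow_two]
      field_simp
    rw [e]
    gcongr
  constructor
  · refine key _ (by positivity) ?_
    unfold levelWeight
    gcongr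
    have : 0 ≤ 1 / ((L - 1 - l : ℕ) + 1 : ℝ) ^ 2 := by positivity
    linarith
  · refine key _ (by positivity) ?_
    unfold levelWeight
    gcongr
    have : 0 ≤ 1 / ((l : ℝ) + 1) ^ 2 := by positivity
    linarith

lemma exists_succ_pow_le_mul_pow {r : ℝ} (hr : 1 < r) (k : ℕ) :
    ∃ C : ℝ, 0 < C ∧ ∀ l : ℕ, ((l : ℝ) + 1) ^ k ≤ C * r ^ l := by
  have h := tendsto_pow_const_div_const_pow_of_one_lt k hr
  obtain ⟨C, hC⟩ := h.bddAbove_range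
  refine ⟨max C 1 * r, by positivity, fun l => ?_⟩
  have h1 := hC ⟨l + 1, rfl⟩
  simp only at h1
  rw [div_le_iff₀ (by positivity)] at h1
  push_cast at h1
  calc ((l : ℝ) + 1) ^ k ≤ C * r ^ (l + 1) := h1
    _ ≤ max C 1 * r ^ (l + 1) := by gcongr; exact le_max_left _ _
    _ = _ := by ring

lemma exists_sum_pow_mul_rpow_le {r q : ℝ} (hr : 0 < r) (hr1 : r < 1) :
    ∃ C : ℝ, 0 < C ∧ ∀ L : ℕ, ∑ l ∈ Finset.range L, r ^ l * ((l : ℝ) + 1) ^ (2 * q) ≤ C := by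
  set k := ⌈2 * q⌉₊ with hk
  obtain ⟨C, hC, hb⟩ := exists_succ_pow_le_mul_pow
    (show 1 < (√r)⁻¹ from (one_lt_inv₀ (Real.sqrt_pos.2 hr)).2 (by
      rw [Real.sqrt_lt' one_pos]; simpa using hr1)) k
  have hs0 : 0 < √r := Real.sqrt_pos.2 hr
  have hs1 : √r < 1 := by rw [Real.sqrt_lt' one_pos]; simpa using hr1
  refine ⟨C * (1 - √r)⁻¹, mul_pos hC (inv_pos.2 (by linarith)), fun L => ?_⟩
  calc ∑ l ∈ Finset.range L, r ^ l * ((l : ℝ) + 1) ^ (2 * q)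
      ≤ ∑ l ∈ Finset.range L, C * √r ^ l := by
        refine Finset.sum_le_sum fun l _ => ?_
        have h1 : ((l : ℝ) + 1) ^ (2 * q) ≤ ((l : ℝ) + 1) ^ k := by
          rw [← Real.rpow_natCast]
          exact Real.rpow_le_rpow_of_exponent_le (by linarith [(Nat.cast_nonneg l : (0 : ℝ) ≤ l)])
            (Nat.le_ceil _)
        have h2 : r ^ l = √r ^ l * √r ^ l := by rw [← mul_pow, Real.mul_self_sqrt hr.le]
        calc _ ≤ r ^ l * (C * (√r)⁻¹ ^ l) := by gcongr; exact h1.trans (hb l)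
          _ = C * √r ^ l := by rw [h2, inv_pow]; field_simp
    _ = C * ∑ l ∈ Finset.range L, √r ^ l := by rw [Finset.mul_sum]
    _ ≤ _ := by
        gcongr
        rw [← tsum_geometric_of_lt_one hs0.le hs1]
        exact (summable_geometric_of_lt_one hs0.le hs1).sum_le_tsum _ fun i _ => by positivity

/-- The sum over the levels of the polynomial terms. -/
lemma exists_sum_levels_le_varpi {q A : ℝ} (hq : 2 < q) : ∃ C : ℝ, 1 ≤ C ∧
    ∀ n L : ℕ, 3 ≤ n → 2 ^ (L - 1) < n → 1 ≤ L →
      n * ∑ l ∈ Finset.range L, ((2 : ℝ) ^ l) ^ (q / 2 - 1 - A * q) * (levelWeight L l ^ q)⁻¹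
        ≤ C * varpi q A n := by
  have hq0 : 0 < q := by linarith
  set s := q / 2 - 1 - A * q with hs
  have hpow : ∀ l : ℕ, ((2 : ℝ) ^ l) ^ s = (2 ^ s) ^ l := fun l => by
    rw [← Real.rpow_natCast, ← Real.rpow_natCast, ← Real.rpow_mul (by norm_num),
      ← Real.rpow_mul (by norm_num), mul_comm]
  have hsA : 1 / 2 - 1 / q - A = s / q := by rw [hs]; field_simp
  have h4 : (0 : ℝ) < 4 ^ q := by positivity
  -- The sign of `s` separates the three cases of `varpi`. For `s < 0` the low levels dominate, for
  -- `s > 0` the high ones. For `s = 0` each of the `L` levels, of which there are `O(log n)`, loses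
  -- at most `L ^ (2 * q)` up to a constant, whence `(log n) ^ (1 + 2 * q)`.
  rcases lt_trichotomy s 0 with hneg | hzero | hposi
  · obtain ⟨C, hC, hb⟩ := exists_sum_pow_mul_rpow_le (q := q) (r := 2 ^ s) (by positivity)
      (Real.rpow_lt_one_of_one_lt_of_neg (by norm_num) hneg)
    refine ⟨max 1 (4 ^ q * C), le_max_left _ _, fun n L hn hL hL1 => ?_⟩
    have hv : varpi q A n = n := by
      rw [varpi, if_pos]
      have := div_neg_of_neg_of_pos hneg hq0
      linarith
    rw [hv, mul_comm]
    gcongr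
    refine le_trans ?_ (le_max_right _ _)
    calc _ ≤ ∑ l ∈ Finset.range L, 4 ^ q * ((2 ^ s) ^ l * ((l : ℝ) + 1) ^ (2 * q)) := by
          refine Finset.sum_le_sum fun l _ => ?_
          rw [hpow]
          calc _ ≤ (2 ^ s) ^ l * (4 ^ q * ((l : ℝ) + 1) ^ (2 * q)) := by
                gcongr
                exact (inv_levelWeight_rpow_le hq0.le L l).1
            _ = _ := by ring
      _ ≤ _ := by rw [← Finset.mul_sum]; gcongr; exact hb L
  · set c := 1 + 1 / Real.log 2 with hc
    have hl2 : 0 < Real.log 2 := Real.log_pos (by norm_num)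
    have hc0 : 0 < c := by positivity
    refine ⟨max 1 (4 ^ q * c ^ (1 + 2 * q)), le_max_left _ _, fun n L hn hL hL1 => ?_⟩
    have hn0 : (0 : ℝ) < n := by positivity
    have hv : varpi q A n = n * Real.log n ^ (1 + 2 * q) := by
      rw [hzero] at hsA
      rw [varpi, if_neg, if_pos]
      · simp at hsA; simp; linarith
      · simp at hsA; simp; linarith
    have hlog1 : 1 ≤ Real.log n := by
      rw [Real.le_log_iff_exp_le hn0]
      have : (3 : ℝ) ≤ n := by exact_mod_cast hn
      linarith [Real.exp_one_lt_d9]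
    have hLlog : (L : ℝ) ≤ c * Real.log n := by
      have h1 : ((L - 1 : ℕ) : ℝ) * Real.log 2 ≤ Real.log n := by
        rw [← Real.log_pow]
        exact Real.log_le_log (by positivity) (by exact_mod_cast hL.le)
      rw [Nat.cast_sub hL1, Nat.cast_one, ← le_div_iff₀ hl2] at h1
      rw [hc, add_mul, one_mul, div_mul_eq_mul_div, one_mul]
      linarith
    have hsum : ∑ l ∈ Finset.range L, ((2 : ℝ) ^ l) ^ s * (levelWeight L l ^ q)⁻¹
        ≤ 4 ^ q * (L : ℝ) ^ (1 + 2 * q) := by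
      calc _ ≤ ∑ l ∈ Finset.range L, 4 ^ q * (L : ℝ) ^ (2 * q) := by
            refine Finset.sum_le_sum fun l hl => ?_
            rw [hzero, Real.rpow_zero, one_mul]
            refine (inv_levelWeight_rpow_le hq0.le L l).1.trans ?_
            gcongr
            exact_mod_cast Finset.mem_range.1 hl
        _ = _ := by
            rw [Finset.sum_const, Finset.card_range, nsmul_eq_mul,
              Real.rpow_add (by exact_mod_cast hL1), Real.rpow_one]
            ring
    rw [hv]
    calc _ ≤ n * (4 ^ q * (c * Real.log n) ^ (1 + 2 * q)) := by
          refine mul_le_mul_of_nonneg_left (hsum.trans ?_) hn0.le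
          gcongr
      _ = 4 ^ q * c ^ (1 + 2 * q) * (n * Real.log n ^ (1 + 2 * q)) := by
          rw [Real.mul_rpow hc0.le (by linarith)]; ring
      _ ≤ _ := by
          gcongr
          exact le_max_right _ _
  · obtain ⟨C, hC, hb⟩ := exists_sum_pow_mul_rpow_le (q := q) (r := 2 ^ (-s)) (by positivity)
      (Real.rpow_lt_one_of_one_lt_of_neg (by norm_num) (by linarith))
    refine ⟨max 1 (4 ^ q * C), le_max_left _ _, fun n L hn hL hL1 => ?_⟩
    have hn0 : (0 : ℝ) < n := by positivity
    have hv : varpi q A n = n * (n : ℝ) ^ s := by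
      have h0 : 0 < s / q := by positivity
      rw [varpi, if_neg (by linarith), if_neg (by linarith)]
      nth_rewrite 2 [← Real.rpow_one (n : ℝ)]
      rw [← Real.rpow_add hn0]
      congr 1
      rw [hs]; ring
    rw [hv]
    have hsum : ∑ l ∈ Finset.range L, ((2 : ℝ) ^ l) ^ s * (levelWeight L l ^ q)⁻¹
        ≤ (n : ℝ) ^ s * (4 ^ q * C) := by
      calc _ ≤ ∑ l ∈ Finset.range L, (n : ℝ) ^ s * (4 ^ q *
            ((2 ^ (-s)) ^ (L - 1 - l) * ((L - 1 - l : ℕ) + 1 : ℝ) ^ (2 * q))) := by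
            refine Finset.sum_le_sum fun l hl => ?_
            have hl' := Finset.mem_range.1 hl
            have e : ((2 : ℝ) ^ l) ^ s ≤ (n : ℝ) ^ s * (2 ^ (-s)) ^ (L - 1 - l) := by
              have h1 : ((2 : ℝ) ^ (L - 1)) ^ s ≤ (n : ℝ) ^ s := by
                apply Real.rpow_le_rpow (by positivity) _ hposi.le
                exact_mod_cast hL.le
              have h2 : ((2 : ℝ) ^ l) ^ s = ((2 : ℝ) ^ (L - 1)) ^ s * (2 ^ (-s)) ^ (L - 1 - l) := by
                rw [hpow, hpow, Real.rpow_neg (by norm_num), inv_pow]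
                obtain ⟨e, he⟩ := Nat.exists_eq_add_of_le (show l ≤ L - 1 by omega)
                rw [he, Nat.add_sub_cancel_left, pow_add]
                field_simp
              rw [h2]
              gcongr
            calc _ ≤ ((n : ℝ) ^ s * (2 ^ (-s)) ^ (L - 1 - l))
                  * (4 ^ q * ((L - 1 - l : ℕ) + 1 : ℝ) ^ (2 * q)) := by
                  gcongr
                  · exact inv_nonneg.2 (Real.rpow_nonneg (levelWeight_pos L l).le _)
                  · exact (inv_levelWeight_rpow_le hq0.le L l).2
              _ = _ := by ring
        _ = (n : ℝ) ^ s * (4 ^ q * ∑ l ∈ Finset.range L,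
            ((2 ^ (-s)) ^ l * ((l : ℝ) + 1) ^ (2 * q))) := by
            rw [← Finset.mul_sum, ← Finset.mul_sum]
            congr 2
            exact Finset.sum_range_reflect
              (fun l : ℕ => ((2 : ℝ) ^ (-s)) ^ l * ((l : ℝ) + 1) ^ (2 * q)) L
        _ ≤ _ := by gcongr; exact hb L
    calc _ ≤ n * ((n : ℝ) ^ s * (4 ^ q * C)) := by gcongr
      _ = 4 ^ q * C * (n * (n : ℝ) ^ s) := by ring
      _ ≤ _ := by gcongr; exact le_max_right _ _

/-- In the Gaussian term the standard deviation decays like `2 ^ (-A * l)`, which outweighs the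
polynomial loss of the weights. The surviving factor `l + 1` makes the exponentials summable over
the levels; the power `5` in the proof is `4` for the squared weight plus this one. -/
lemma exists_mul_succ_le_levelWeight_sq {A : ℝ} (hA : 0 < A) : ∃ c : ℝ, 0 < c ∧
    ∀ L l : ℕ, c * ((l : ℝ) + 1) ≤ levelWeight L l ^ 2 * ((2 : ℝ) ^ l) ^ (2 * A) := by
  obtain ⟨C, hC, hb⟩ := exists_succ_pow_le_mul_pow
    (show (1 : ℝ) < 2 ^ (2 * A) from Real.one_lt_rpow (by norm_num) (by positivity)) 5
  refine ⟨1 / (16 * C), by positivity, fun L l => ?_⟩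
  have h1 : 1 / 4 * (1 / ((l : ℝ) + 1) ^ 2) ≤ levelWeight L l := by
    unfold levelWeight
    gcongr
    have : 0 ≤ 1 / ((L - 1 - l : ℕ) + 1 : ℝ) ^ 2 := by positivity
    linarith
  have h2 : ((2 : ℝ) ^ l) ^ (2 * A) = ((2 : ℝ) ^ (2 * A)) ^ l := by
    rw [← Real.rpow_natCast, ← Real.rpow_natCast, ← Real.rpow_mul (by norm_num),
      ← Real.rpow_mul (by norm_num), mul_comm]
  have h3 := hb l
  rw [h2]
  calc 1 / (16 * C) * ((l : ℝ) + 1)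
      = (1 / 4 * (1 / ((l : ℝ) + 1) ^ 2)) ^ 2 * (((l : ℝ) + 1) ^ 5 / C) := by
        field_simp; norm_num
    _ ≤ _ := by
        gcongr
        rw [div_le_iff₀ hC]; linarith

lemma sum_exp_neg_mul_succ_le {y : ℝ} (hy : 1 ≤ y) (L : ℕ) :
    ∑ l ∈ Finset.range L, Real.exp (-(y * ((l : ℝ) + 1))) ≤ 2 * Real.exp (-y) := by
  set r := Real.exp (-y) with hr
  have hr0 : 0 < r := Real.exp_pos _
  have hr2 : r ≤ 1 / 2 := by
    rw [hr, Real.exp_neg, inv_le_comm₀ (Real.exp_pos _) (by norm_num)]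
    have := Real.add_one_le_exp y
    norm_num
    linarith
  calc _ = r * ∑ l ∈ Finset.range L, r ^ l := by
        rw [Finset.mul_sum]
        refine Finset.sum_congr rfl fun l _ => ?_
        rw [hr, ← Real.exp_nat_mul, ← Real.exp_add]; ring_nf
    _ ≤ r * (1 - r)⁻¹ := by
        gcongr
        rw [← tsum_geometric_of_lt_one hr0.le (by linarith)]
        exact (summable_geometric_of_lt_one hr0.le (by linarith)).sum_le_tsum _
          fun i _ => by positivity
    _ ≤ r * 2 := by
        gcongr
        rw [inv_le_comm₀ (by linarith) (by norm_num)]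
        norm_num
        linarith
    _ = _ := by ring

/-- The left side is what the lags beyond the sample size contribute. -/
lemma rpow_le_varpi {q A : ℝ} (hq : 2 < q) {n : ℕ} (hn : 3 ≤ n) :
    (n : ℝ) ^ (q / 2 - A * q) ≤ varpi q A n := by
  have hq0 : 0 < q := by linarith
  have hn1 : (1 : ℝ) ≤ n := by exact_mod_cast (by omega : 1 ≤ n)
  have hsA : 1 / 2 - 1 / q - A = (q / 2 - 1 - A * q) / q := by field_simp
  unfold varpi
  split_ifs with h1 h2
  · have : (q / 2 - 1 - A * q) / q < 0 := by linarith
    rw [div_neg_iff] at this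
    have h : q / 2 - A * q ≤ 1 := by rcases this with h | h <;> linarith
    calc _ ≤ (n : ℝ) ^ (1 : ℝ) := Real.rpow_le_rpow_of_exponent_le hn1 h
      _ = n := Real.rpow_one _
  · have h : q / 2 - A * q = 1 := by rw [h2]; field_simp; ring
    rw [h, Real.rpow_one]
    have hlog1 : 1 ≤ Real.log n := by
      rw [Real.le_log_iff_exp_le (by linarith)]
      have : (3 : ℝ) ≤ n := by exact_mod_cast hn
      linarith [Real.exp_one_lt_d9]
    exact le_mul_of_one_le_right (by linarith) (Real.one_le_rpow hlog1 (by linarith))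
  · exact le_rfl

end LevelWeights

/-! ### Nagaev inequality for projection arrays -/

section Concentration

/-- A maximal inequality of Nagaev type for the partial sums of a projection array. -/
theorem exists_measure_partialSum_le {q A : ℝ} (hq : 2 < q) (hA : 0 < A) : ∃ C : ℝ, 1 ≤ C ∧
    ∀ {Ω : Type*} [MeasurableSpace Ω] (P : Measure Ω) [IsProbabilityMeasure P]
      (m : ℤ → MeasurableSpace Ω) (D : ℕ → ℕ → Ω → ℝ) (α β : ℕ → ℝ)
      (_ : IsProjectionArray P m q D α β) (a b : ℝ) (_ : 0 ≤ a) (_ : 0 ≤ b) (M : ℕ)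
      (_ : ∀ u, ∑ j ∈ Finset.Ico u M, α j ≤ a * ((u : ℝ) + 1) ^ (-A))
      (_ : ∀ u, ∑ j ∈ Finset.Ico u M, β j ≤ b * ((u : ℝ) + 1) ^ (-A))
      (n : ℕ) (_ : 3 ≤ n) (x : ℝ) (_ : 0 < x),
      P.real {ω | ∃ k ≤ n, x ≤ |∑ i ∈ Finset.range k, ∑ j ∈ Finset.range M, D i j ω|}
        ≤ C * (varpi q A n * a ^ q / x ^ q + Real.exp (-(x ^ 2 / (C * (n * b ^ 2))))) := by
  obtain ⟨C₁, hC₁, hlev⟩ := exists_measure_level_le hq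
  obtain ⟨K, hK, htop⟩ := exists_measure_interval_le hq
  obtain ⟨C₂, hC₂, hvarpi⟩ := exists_sum_levels_le_varpi (A := A) hq
  obtain ⟨c, hc, hw⟩ := exists_mul_succ_le_levelWeight_sq hA
  have hq0 : 0 < q := by linarith
  set T := 2 ^ (q / 2 - 1) * (2 : ℝ) ^ q with hT
  set Q := (2 : ℝ) ^ q * 2 ^ (q / 2) with hQ
  have hT0 : 0 < T := by positivity
  have hQ0 : 0 < Q := by positivity
  refine ⟨C₁ * C₂ * T + K * Q + 4 * C₁ / c + 2 * C₁ + 3, ?_, ?_⟩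
  · have : 0 ≤ C₁ * C₂ * T := by positivity
    have : 0 ≤ K * Q := by positivity
    have : 0 ≤ 4 * C₁ / c := by positivity
    linarith
  set C := C₁ * C₂ * T + K * Q + 4 * C₁ / c + 2 * C₁ + 3 with hC
  intro Ω mΩ P _ m D α β hD a b ha hb M hα hβ n hn x hx
  set L := Nat.clog 2 n with hL
  have hn1 : 1 < n := by omega
  have hL1 : 1 ≤ L := Nat.clog_pos (by norm_num) hn1
  have hLn : 2 ^ (L - 1) < n := Nat.pow_pred_clog_lt_self (by norm_num) hn1
  have hnL : n ≤ 2 ^ L := Nat.le_pow_clog (by norm_num) n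
  have hn0 : (0 : ℝ) < n := by positivity
  -- For `l < L` these are the lags with `2 ^ l ≤ j + 1 < 2 ^ (l + 1)`. Level `L` collects all lags
  -- with `j + 1 ≥ 2 ^ L`, hence `j + 1 ≥ n`, which are too long for blocks.
  set J : ℕ → Finset ℕ := fun l => (Finset.range M).filter fun j => min (Nat.log 2 (j + 1)) L = l
  have hJlow : ∀ l, ∀ j ∈ J l, 2 ^ l - 1 ≤ j := by
    intro l j hj
    simp only [J, Finset.mem_filter] at hj
    have h1 : l ≤ Nat.log 2 (j + 1) := by omega
    have h2 := (Nat.le_log_iff_pow_le (by norm_num) (by omega)).1 h1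
    omega
  have hJup : ∀ l < L, ∀ j ∈ J l, j < 2 ^ (l + 1) := by
    intro l hl j hj
    simp only [J, Finset.mem_filter] at hj
    have h1 : Nat.log 2 (j + 1) < l + 1 := by omega
    have := (Nat.log_lt_iff_lt_pow (by norm_num) (by omega)).1 h1
    omega
  have hJsum : ∀ f : ℕ → ℝ, ∑ j ∈ Finset.range M, f j
      = ∑ l ∈ Finset.range (L + 1), ∑ j ∈ J l, f j := fun f =>
    (Finset.sum_fiberwise_of_maps_to (fun j _ => Finset.mem_range.2 (by omega)) f).symm
  have htail : ∀ (γ : ℕ → ℝ) (e : ℝ), (∀ j, 0 ≤ γ j) →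
      (∀ u, ∑ j ∈ Finset.Ico u M, γ j ≤ e * ((u : ℝ) + 1) ^ (-A)) → ∀ l,
      ∑ j ∈ J l, γ j ≤ e * ((2 : ℝ) ^ l) ^ (-A) := by
    intro γ e hγ he l
    have h1 := he (2 ^ l - 1)
    rw [Nat.cast_sub Nat.one_le_two_pow] at h1
    push_cast at h1
    rw [sub_add_cancel] at h1
    refine le_trans (Finset.sum_le_sum_of_subset_of_nonneg ?_ fun j _ _ => hγ j) h1
    intro j hj
    rw [Finset.mem_Ico]
    refine ⟨hJlow l j hj, ?_⟩
    simp only [J, Finset.mem_filter, Finset.mem_range] at hj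
    exact hj.1
  have hαJ := htail α a hD.nonneg hα
  have hβJ := htail β b hD.nonneg' hβ
  have hαJ0 : ∀ l, 0 ≤ ∑ j ∈ J l, α j := fun l => Finset.sum_nonneg fun j _ => hD.nonneg j
  have hβJ0 : ∀ l, 0 ≤ ∑ j ∈ J l, β j := fun l => Finset.sum_nonneg fun j _ => hD.nonneg' j
  set G : ℕ → ℝ → Set Ω := fun l y =>
    {ω | ∃ k ≤ n, y ≤ |∑ i ∈ Finset.range k, ∑ j ∈ J l, D i j ω|} with hG
  -- Half of `x` is reserved for the top level, the other half is shared among the lower levels by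
  -- weights of total at most `1`.
  have hsub : {ω | ∃ k ≤ n, x ≤ |∑ i ∈ Finset.range k, ∑ j ∈ Finset.range M, D i j ω|}
      ⊆ (⋃ l ∈ Finset.range L, G l (levelWeight L l * (x / 2))) ∪ G L (x / 2) := by
    rintro ω ⟨k, hk, hxk⟩
    by_contra hcon
    simp only [Set.mem_union, not_or, Set.mem_iUnion, Finset.mem_range, not_exists, hG,
      Set.mem_ofPred_eq, not_and, not_le] at hcon
    obtain ⟨h0, h1⟩ := hcon
    have e : ∑ i ∈ Finset.range k, ∑ j ∈ Finset.range M, D i j ω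
        = ∑ l ∈ Finset.range L, ∑ i ∈ Finset.range k, ∑ j ∈ J l, D i j ω
          + ∑ i ∈ Finset.range k, ∑ j ∈ J L, D i j ω := by
      rw [← Finset.sum_range_succ (fun l => ∑ i ∈ Finset.range k, ∑ j ∈ J l, D i j ω),
        Finset.sum_comm (s := Finset.range (L + 1))]
      exact Finset.sum_congr rfl fun i _ => hJsum _
    rw [e] at hxk
    have h2 : |∑ l ∈ Finset.range L, ∑ i ∈ Finset.range k, ∑ j ∈ J l, D i j ω| ≤ x / 2 := by
      refine (Finset.abs_sum_le_sum_abs _ _).trans ?_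
      calc _ ≤ ∑ l ∈ Finset.range L, levelWeight L l * (x / 2) :=
            Finset.sum_le_sum fun l hl => (h0 l (Finset.mem_range.1 hl) k hk).le
        _ ≤ 1 * (x / 2) := by
            rw [← Finset.sum_mul]
            gcongr
            exact sum_levelWeight_le L
        _ = _ := one_mul _
    have := hxk.trans (abs_add_le _ _)
    linarith [h1 k hk]
  have hμ := (measureReal_mono hsub).trans ((measureReal_union_le (μ := P) _ _).trans
    (add_le_add_left (measureReal_biUnion_finset_le _ _) _))
  set p₀ := varpi q A n * a ^ q / x ^ q with hp₀
  set s := q / 2 - 1 - A * q with hs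
  have haq : 0 ≤ a ^ q := by positivity
  have hvp : 0 ≤ varpi q A n := (Real.rpow_nonneg hn0.le _).trans (rpow_le_varpi hq hn)
  have hp₀0 : 0 ≤ p₀ := by positivity
  have hrp : ∀ l : ℕ, (((2 : ℝ) ^ l) ^ (-A)) ^ q = ((2 : ℝ) ^ l) ^ (-(A * q)) := fun l => by
    rw [← Real.rpow_mul (by positivity)]; ring_nf
  have htopb : P.real (G L (x / 2)) ≤ K * Q * p₀ := by
    have h1 := htop P m D α β hD (J L) L 0 (show 0 < x / 2 by positivity)
    refine (measureReal_mono ?_).trans (h1.trans ?_)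
    · rintro ω ⟨k, hk, hxk⟩
      refine ⟨k, hk.trans hnL, ?_⟩
      rwa [zero_add, ← Finset.range_eq_Ico]
    · have h2L : (2 : ℝ) ^ L ≤ 2 * n := by
        have : 2 ^ L ≤ 2 * n := by
          calc 2 ^ L = 2 * 2 ^ (L - 1) := by
                rw [← pow_succ']; congr 1; omega
            _ ≤ 2 * n := by omega
        exact_mod_cast this
      have hnL' : (n : ℝ) ≤ 2 ^ L := by exact_mod_cast hnL
      have h3 : (√(2 ^ L) * ∑ j ∈ J L, α j) ^ q ≤ (2 : ℝ) ^ (q / 2) * (varpi q A n * a ^ q) := by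
        calc (√(2 ^ L) * ∑ j ∈ J L, α j) ^ q ≤ (√(2 * n) * (a * (n : ℝ) ^ (-A))) ^ q := by
              gcongr
              · exact mul_nonneg (Real.sqrt_nonneg _) (hαJ0 L)
              · exact hαJ0 L
              · refine (hαJ L).trans ?_
                gcongr 1
                exact Real.rpow_le_rpow_of_nonpos hn0 hnL' (by linarith)
          _ = (2 : ℝ) ^ (q / 2) * ((n : ℝ) ^ (q / 2 - A * q) * a ^ q) := by
              rw [Real.mul_rpow (by positivity) (by positivity), Real.mul_rpow ha (by positivity),
                Real.sqrt_eq_rpow, ← Real.rpow_mul (by positivity), ← Real.rpow_mul hn0.le,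
                Real.mul_rpow (by norm_num) hn0.le,
                show q / 2 - A * q = 1 / 2 * q + -A * q by ring, Real.rpow_add hn0,
                show 1 / 2 * q = q / 2 by ring]
              ring
          _ ≤ _ := by
              gcongr
              exact rpow_le_varpi hq hn
      calc K * ((√(2 ^ L) * ∑ j ∈ J L, α j) ^ q / (x / 2) ^ q)
          ≤ K * ((2 : ℝ) ^ (q / 2) * (varpi q A n * a ^ q) / (x / 2) ^ q) := by gcongr
        _ = K * Q * p₀ := by
            rw [Real.div_rpow hx.le (by norm_num), hQ, hp₀]
            field_simp
  have hlevb : ∀ l ∈ Finset.range L, P.real (G l (levelWeight L l * (x / 2)))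
      ≤ C₁ * (T * (a ^ q / x ^ q) * (n * (((2 : ℝ) ^ l) ^ s * (levelWeight L l ^ q)⁻¹))
        + Real.exp (-(x ^ 2 / (4 * C₁ / c * (n * b ^ 2)) * ((l : ℝ) + 1)))) := by
    intro l hl
    have hlL := Finset.mem_range.1 hl
    have hwp := levelWeight_pos L l
    have hrn : 2 ^ (l + 1) ≤ 2 * n := by
      calc 2 ^ (l + 1) ≤ 2 ^ L := Nat.pow_le_pow_right (by norm_num) hlL
        _ = 2 * 2 ^ (L - 1) := by rw [← pow_succ']; congr 1; omega
        _ ≤ 2 * n := by omega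
    have h1 := hlev P m D α β hD (J l) (l + 1) (hJup l hlL) (hβJ l) n hrn
      (show 0 < levelWeight L l * (x / 2) by positivity)
    refine h1.trans (mul_le_mul_of_nonneg_left (add_le_add ?_ ?_) (by linarith))
    · calc _ ≤ n * (2 ^ (l + 1) : ℝ) ^ (q / 2 - 1) * (a * ((2 : ℝ) ^ l) ^ (-A)) ^ q
            / (levelWeight L l * (x / 2)) ^ q := by
            gcongr
            · exact hαJ0 l
            · exact hαJ l
        _ = _ := by
            have h2 : (0 : ℝ) < 2 ^ l := by positivity
            rw [Real.mul_rpow ha (by positivity), hrp, Real.mul_rpow hwp.le (by positivity),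
              Real.div_rpow hx.le (by norm_num), pow_succ, Real.mul_rpow h2.le (by norm_num),
              hs, show q / 2 - 1 - A * q = (q / 2 - 1) + -(A * q) by ring, Real.rpow_add h2, hT]
            field_simp
    · apply Real.exp_le_exp.2
      apply neg_le_neg
      rcases hb.eq_or_lt with hb0 | hb0
      · rw [← hb0]
        simp
      calc x ^ 2 / (4 * C₁ / c * (n * b ^ 2)) * ((l : ℝ) + 1)
          = (c * ((l : ℝ) + 1)) * (x ^ 2 / (4 * C₁ * (n * b ^ 2))) := by
            field_simp
        _ ≤ (levelWeight L l ^ 2 * ((2 : ℝ) ^ l) ^ (2 * A)) * (x ^ 2 / (4 * C₁ * (n * b ^ 2))) :=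
            mul_le_mul_of_nonneg_right (hw L l) (by positivity)
        _ = (levelWeight L l * (x / 2)) ^ 2 / (C₁ * (n * (b * ((2 : ℝ) ^ l) ^ (-A)) ^ 2)) := by
            have h2 : (0 : ℝ) < 2 ^ l := by positivity
            rw [Real.rpow_neg h2.le, mul_comm 2 A, Real.rpow_mul h2.le, Real.rpow_two]
            field_simp
            norm_num
  have hC0 : 0 < C := by rw [hC]; positivity
  have h4c : 4 * C₁ / c ≤ C := by
    have : 0 ≤ C₁ * C₂ * T := by positivity
    have : 0 ≤ K * Q := by positivity
    linarith
  set y := x ^ 2 / (4 * C₁ / c * (n * b ^ 2)) with hy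
  set ex := Real.exp (-(x ^ 2 / (C * (n * b ^ 2)))) with hex
  have hex0 : 0 < ex := Real.exp_pos _
  have hyex : Real.exp (-y) ≤ ex := by
    apply Real.exp_le_exp.2
    apply neg_le_neg
    rcases hb.eq_or_lt with hb0 | hb0
    · rw [hy, ← hb0]; simp
    · rw [hy]; gcongr
  -- The sum of exponentials over the levels is geometric only for `y ≥ 1`. For `y < 1` the claim is
  -- trivial, because `3 * exp (-1) ≥ 1`.
  rcases lt_or_ge y 1 with hy1 | hy1
  · have h1 : (1 : ℝ) ≤ 3 * ex := by
      have h2 : Real.exp (-1) ≤ ex := (Real.exp_le_exp.2 (by linarith)).trans hyex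
      rw [Real.exp_neg] at h2
      have h3 : (3 : ℝ)⁻¹ ≤ (Real.exp 1)⁻¹ := by
        gcongr
        linarith [Real.exp_one_lt_d9]
      linarith
    have h3 : 3 * ex ≤ C * ex := by
      gcongr
      rw [hC]
      have : 0 ≤ C₁ * C₂ * T := by positivity
      have : 0 ≤ K * Q := by positivity
      have : 0 ≤ 4 * C₁ / c := by positivity
      linarith
    have h4 : P.real {ω | ∃ k ≤ n, x ≤ |∑ i ∈ Finset.range k, ∑ j ∈ Finset.range M, D i j ω|} ≤ 1 :=
      measureReal_le_one
    have h5 : 0 ≤ C * p₀ := by positivity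
    linarith
  · have h1 : ∑ l ∈ Finset.range L, P.real (G l (levelWeight L l * (x / 2)))
        ≤ C₁ * (T * (a ^ q / x ^ q) * (C₂ * varpi q A n) + 2 * ex) := by
      refine (Finset.sum_le_sum hlevb).trans ?_
      rw [← Finset.mul_sum, Finset.sum_add_distrib, ← Finset.mul_sum, ← Finset.mul_sum]
      refine mul_le_mul_of_nonneg_left (add_le_add ?_ ?_) (by linarith)
      · exact mul_le_mul_of_nonneg_left (hvarpi n L hn hLn hL1) (by positivity)
      · exact (sum_exp_neg_mul_succ_le hy1 L).trans (by gcongr)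
    have h2 : T * (a ^ q / x ^ q) * (C₂ * varpi q A n) = C₂ * T * p₀ := by rw [hp₀]; ring
    rw [h2] at h1
    have h3 : 0 ≤ 4 * C₁ / c := by positivity
    have h4 : 0 ≤ C₁ * C₂ * T := by positivity
    have h5 : 0 ≤ K * Q := by positivity
    have h6 : (C₁ * C₂ * T + K * Q) * p₀ ≤ C * p₀ := by
      gcongr
      linarith
    have h7 : 2 * C₁ * ex ≤ C * ex := by
      gcongr
      linarith
    linarith

end Concentration

/-! ### Conditional expectation and independent information -/

section CondExp

variable {Ω : Type*} {m₁ m₂ m' : MeasurableSpace Ω} [mΩ : MeasurableSpace Ω] {P : Measure Ω}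
  [IsProbabilityMeasure P]

lemma generateFrom_inter_eq_sup (m₁ m₂ : MeasurableSpace Ω) :
    m₁ ⊔ m₂ = MeasurableSpace.generateFrom
      {s | ∃ s₁ s₂, MeasurableSet[m₁] s₁ ∧ MeasurableSet[m₂] s₂ ∧ s = s₁ ∩ s₂} := by
  apply le_antisymm
  · refine sup_le (fun s hs => ?_) (fun s hs => ?_)
    · exact MeasurableSpace.measurableSet_generateFrom
        ⟨s, Set.univ, hs, MeasurableSet.univ, (Set.inter_univ s).symm⟩
    · exact MeasurableSpace.measurableSet_generateFrom
        ⟨Set.univ, s, MeasurableSet.univ, hs, (Set.univ_inter s).symm⟩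
  · refine MeasurableSpace.generateFrom_le ?_
    rintro s ⟨s₁, s₂, h₁, h₂, rfl⟩
    exact MeasurableSet.inter ((le_sup_left : m₁ ≤ m₁ ⊔ m₂) _ h₁)
      ((le_sup_right : m₂ ≤ m₁ ⊔ m₂) _ h₂)

lemma setIntegral_inter_of_indep (hm' : m' ≤ mΩ) (hm₂ : m₂ ≤ mΩ) (hind : Indep m' m₂ P)
    {g : Ω → ℝ} (hg : StronglyMeasurable[m'] g) {s₁ s₂ : Set Ω}
    (h₁ : MeasurableSet[m'] s₁) (h₂ : MeasurableSet[m₂] s₂) :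
    ∫ ω in s₁ ∩ s₂, g ω ∂P = (∫ ω in s₁, g ω ∂P) * P.real s₂ := by
  have hf1 : Measurable[m'] (s₁.indicator g) := hg.measurable.indicator h₁
  have hf2 : Measurable[m₂] (s₂.indicator fun _ => (1 : ℝ)) := measurable_const.indicator h₂
  have hi : IndepFun (s₁.indicator g) (s₂.indicator fun _ => (1 : ℝ)) P :=
    (IndepFun_iff_Indep _ _ _).2 (indep_of_indep_of_le_left
      (indep_of_indep_of_le_right hind hf2.comap_le) hf1.comap_le)
  have := hi.integral_mul_eq_mul_integral (hf1.mono hm' le_rfl).aestronglyMeasurable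
    (hf2.mono hm₂ le_rfl).aestronglyMeasurable
  rw [integral_indicator (hm' _ h₁), integral_indicator (hm₂ _ h₂)] at this
  simp only [integral_const, measureReal_restrict_apply_univ, smul_eq_mul, mul_one] at this
  rw [← this, ← integral_indicator ((hm' _ h₁).inter (hm₂ _ h₂))]
  congr 1
  ext ω
  by_cases ha : ω ∈ s₁ <;> by_cases hb : ω ∈ s₂ <;> simp [ha, hb]

/-- Independent information does not change a conditional expectation. -/
lemma condExp_sup_of_indep (h₁ : m₁ ≤ m') (hm' : m' ≤ mΩ) (hm₂ : m₂ ≤ mΩ) (hind : Indep m' m₂ P)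
    {f : Ω → ℝ} (hf : StronglyMeasurable[m'] f) (hfi : Integrable f P) :
    P[f|m₁ ⊔ m₂] =ᵐ[P] P[f|m₁] := by
  have hm₁ : m₁ ≤ mΩ := h₁.trans hm'
  have hsup : m₁ ⊔ m₂ ≤ mΩ := sup_le hm₁ hm₂
  have hg : StronglyMeasurable[m₁ ⊔ m₂] (P[f|m₁]) :=
    stronglyMeasurable_condExp.mono (le_sup_left : m₁ ≤ m₁ ⊔ m₂)
  symm
  refine ae_eq_condExp_of_forall_setIntegral_eq hsup hfi
    (fun s _ _ => integrable_condExp.integrableOn) ?_ hg.aestronglyMeasurable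
  intro s hs _
  have hbase : ∫ ω, (P[f|m₁]) ω ∂P = ∫ ω, f ω ∂P := integral_condExp hm₁
  -- The intersections `s₁ ∩ s₂` form a π-system generating the join, and on them both integrals
  -- factor by independence.
  refine MeasurableSpace.induction_on_inter
    (C := fun s _ => ∫ ω in s, (P[f|m₁]) ω ∂P = ∫ ω in s, f ω ∂P)
    (generateFrom_inter_eq_sup m₁ m₂) ?_ (by simp) ?_ ?_ ?_ s hs
  · rintro _ ⟨s₁, s₂, h1, h2, rfl⟩ _ ⟨t₁, t₂, k1, k2, rfl⟩ _
    exact ⟨s₁ ∩ t₁, s₂ ∩ t₂, h1.inter k1, h2.inter k2, Set.inter_inter_inter_comm _ _ _ _⟩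
  · rintro _ ⟨s₁, s₂, h1, h2, rfl⟩
    rw [setIntegral_inter_of_indep hm' hm₂ hind (stronglyMeasurable_condExp.mono h₁) (h₁ _ h1) h2,
      setIntegral_inter_of_indep hm' hm₂ hind hf (h₁ _ h1) h2, setIntegral_condExp hm₁ hfi h1]
  · intro t ht hC
    have e1 := integral_add_compl (hsup _ ht) (integrable_condExp (μ := P) (f := f) (m := m₁))
    have e2 := integral_add_compl (hsup _ ht) hfi
    linarith
  · intro t hd ht hC
    rw [integral_iUnion (fun i => hsup _ (ht i)) hd integrable_condExp.integrableOn,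
      integral_iUnion (fun i => hsup _ (ht i)) hd hfi.integrableOn]
    exact tsum_congr hC

lemma measurable_pi_of_measurable {Ω K E : Type*} {m : MeasurableSpace Ω} [MeasurableSpace E]
    {f : Ω → K → E} (h : ∀ k, Measurable fun ω => f ω k) : Measurable f :=
  measurable_pi_lambda _ h

lemma sigmaOn_union {Ω : Type*} (m : ℤ → MeasurableSpace Ω) (S T : Set ℤ) :
    sigmaOn m (S ∪ T) = sigmaOn m S ⊔ sigmaOn m T :=
  iSup_union

end CondExp

/-! ### Projections of functionals of the past and their coupling bound -/

namespace CausalModel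

variable {Ω : Type*} [mΩ : MeasurableSpace Ω] {P : Measure Ω} [IsProbabilityMeasure P] {p : ℕ}
  (M : CausalModel Ω P p)

/-- The innovations and their copies as one family. -/
def allInnovations (x : ℤ ⊕ ℤ) : Ω → Fin p → ℝ := Sum.elim M.ε M.ε' x

lemma measurable_allInnovations (x : ℤ ⊕ ℤ) : Measurable (M.allInnovations x) := by
  rcases x with i | i
  · exact M.measurable_ε i
  · exact M.measurable_ε' i

lemma identDistrib_allInnovations {K : Type*} [Countable K] {e e' : K → ℤ ⊕ ℤ}
    (he : Function.Injective e) (he' : Function.Injective e') :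
    IdentDistrib (fun ω k => M.allInnovations (e k) ω) (fun ω k => M.allInnovations (e' k) ω) P P := by
  have h0 : ∀ x, IdentDistrib (M.allInnovations x) (M.ε 0) P P := by
    intro x
    rcases x with i | i
    · exact M.ident i
    · exact M.ident' i
  exact IdentDistrib.pi (fun k => (h0 _).trans (h0 _).symm) (M.indep.precomp he)
    (M.indep.precomp he')

/-- The `σ`-algebra of the innovation with index `k + 1`. -/
@[reducible] def innovationSigma (k : ℤ) : MeasurableSpace Ω :=
  MeasurableSpace.comap (M.ε (k + 1)) inferInstance

lemma innovationSigma_le (k : ℤ) : M.innovationSigma k ≤ mΩ :=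
  (M.measurable_ε (k + 1)).comap_le

lemma iIndep_allInnovations :
    iIndep (fun x => MeasurableSpace.comap (M.allInnovations x) inferInstance) P :=
  (iIndepFun_iff_iIndep _ _ _).1 M.indep

lemma iIndep_innovationSigma : iIndep M.innovationSigma P := by
  have h : iIndepFun (fun k : ℤ => M.ε (k + 1)) P :=
    iIndepFun.precomp (g := fun k : ℤ => (Sum.inl (k + 1) : ℤ ⊕ ℤ))
      (fun a b h => by simpa using h) M.indep
  exact (iIndepFun_iff_iIndep _ _ _).1 h

lemma measurable_past (i : ℤ) : Measurable (M.past i) :=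
  measurable_pi_lambda _ fun _ => M.measurable_ε _

/-- Because of the shift by one in `innovationSigma`, row `i` of an array belongs to observation `i
+ 1`, so rows start at `0` while observations start at `1`. -/
lemma measurable_past_sigmaOn (i : ℤ) :
    Measurable[sigmaOn M.innovationSigma (Set.Iic i)] (M.past (i + 1)) := by
  refine measurable_pi_of_measurable fun k => ?_
  have h : M.innovationSigma (i - k) ≤ sigmaOn M.innovationSigma (Set.Iic i) :=
    le_iSup₂_of_le (i - k) (by simp) le_rfl
  refine Measurable.mono ?_ h le_rfl
  have : (fun ω => M.past (i + 1) ω k) = M.ε (i - k + 1) := by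
    ext ω
    simp only [past]
    congr 2
    ring
  rw [this]
  exact comap_measurable _

/-- The innovations with the one of index `i - j` replaced by its copy. -/
def replacedIndex (i : ℤ) (j : ℕ) (k : ℤ) : ℤ ⊕ ℤ := if k = i - j then Sum.inr k else Sum.inl k

lemma replacedIndex_injective (i : ℤ) (j : ℕ) : Function.Injective (replacedIndex i j) := by
  intro a b h
  unfold replacedIndex at h
  split_ifs at h with h1 h2 h2
  · simpa using h
  · simpa using h

lemma pastCoupled_eq (i : ℤ) (j : ℕ) (ω : Ω) (k : ℕ) :
    M.pastCoupled i j ω k = M.allInnovations (replacedIndex i j (i - k)) ω := by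
  unfold pastCoupled replacedIndex
  by_cases h : k = j
  · subst h
    simp [allInnovations]
  · rw [Function.update_of_ne h, if_neg (by simpa using h)]
    rfl

lemma measurable_pastCoupled (i : ℤ) (j : ℕ) : Measurable (M.pastCoupled i j) := by
  refine measurable_pi_lambda _ fun k => ?_
  simp_rw [pastCoupled_eq]
  exact M.measurable_allInnovations _

lemma identDistrib_past (i i' : ℤ) : IdentDistrib (M.past i) (M.past i') P P :=
  M.identDistrib_allInnovations (K := ℕ) (e := fun k => Sum.inl (i - k))
    (e' := fun k => Sum.inl (i' - k)) (fun a b h => by simpa using h)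
    (fun a b h => by simpa using h)

/-- The past together with the single copy is one family of independent identically distributed
vectors, the copy sitting at `none`; the coupled past is a measurable function of it. -/
lemma identDistrib_past_pastCoupled (i i' : ℤ) (j : ℕ) :
    IdentDistrib (fun ω => (M.past i ω, M.pastCoupled i j ω))
      (fun ω => (M.past i' ω, M.pastCoupled i' j ω)) P P := by
  have h := M.identDistrib_allInnovations (K := Option ℕ)
    (e := fun o => o.elim (Sum.inr (i - j)) fun k => Sum.inl (i - k))
    (e' := fun o => o.elim (Sum.inr (i' - j)) fun k => Sum.inl (i' - k))
    (fun a b h => by cases a <;> cases b <;> simp at h ⊢; exact h)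
    (fun a b h => by cases a <;> cases b <;> simp at h ⊢; exact h)
  have hu : Measurable fun v : Option ℕ → Fin p → ℝ =>
      ((fun k : ℕ => v (some k)), Function.update (fun k : ℕ => v (some k)) j (v none)) := by
    refine Measurable.prodMk (by fun_prop) ?_
    refine measurable_pi_lambda _ fun k => ?_
    by_cases hk : k = j
    · subst hk; simp; fun_prop
    · simp [Function.update_of_ne hk]; fun_prop
  exact h.comp hu

lemma identDistrib_past_pastCoupled_same (i : ℤ) (j : ℕ) :
    IdentDistrib (M.pastCoupled i j) (M.past i) P P := by
  have h := M.identDistrib_allInnovations (K := ℕ) (e := fun k => replacedIndex i j (i - k))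
    (e' := fun k => Sum.inl (i - k))
    (fun a b h => by simpa using replacedIndex_injective i j h)
    (fun a b h => by simpa using h)
  refine (IdentDistrib.of_ae_eq (M.measurable_pastCoupled i j).aemeasurable ?_).trans h
  exact ae_of_all _ fun ω => funext fun k => M.pastCoupled_eq i j ω k

section Projection

variable {F : (ℕ → Fin p → ℝ) → ℝ} (hF : Measurable F)

include hF in
-- Swapping one innovation for its copy preserves the joint law of the whole sequence. The event `s`
-- does not involve the swapped innovation, so it is the same event for both sequences.
lemma setIntegral_pastCoupled (i : ℤ) (j : ℕ)
    {S : Set ℤ} (hS : i - j ∉ S) {s : Set Ω} (hs : MeasurableSet[sigmaOn M.innovationSigma S] s) :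
    ∫ ω in s, F (M.pastCoupled (i + 1) j ω) ∂P = ∫ ω in s, F (M.past (i + 1) ω) ∂P := by
  set V : Ω → ℤ → Fin p → ℝ := fun ω k => M.allInnovations (Sum.inl k) ω
  set V' : Ω → ℤ → Fin p → ℝ := fun ω k => M.allInnovations (replacedIndex (i + 1) j k) ω
  have hV : IdentDistrib V' V P P := M.identDistrib_allInnovations
    (replacedIndex_injective (i + 1) j) Sum.inl_injective
  set W : Ω → S → Fin p → ℝ := fun ω k => M.ε (k + 1) ω
  have hW : sigmaOn M.innovationSigma S ≤ MeasurableSpace.comap W inferInstance := by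
    refine iSup₂_le fun k hk => ?_
    have : M.ε (k + 1) = (fun v : S → Fin p → ℝ => v ⟨k, hk⟩) ∘ W := rfl
    simp only [innovationSigma]
    rw [this, ← MeasurableSpace.comap_comp]
    exact MeasurableSpace.comap_mono (measurable_pi_apply _).comap_le
  obtain ⟨T₀, hT₀, rfl⟩ := hW s hs
  set r : (ℤ → Fin p → ℝ) → S → Fin p → ℝ := fun v k => v (k + 1)
  have hr : Measurable r := by fun_prop
  set T := r ⁻¹' T₀
  have hT : MeasurableSet T := hr hT₀
  have e1 : W ⁻¹' T₀ = V ⁻¹' T := rfl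
  have e2 : W ⁻¹' T₀ = V' ⁻¹' T := by
    have : W = r ∘ V' := by
      ext ω k l
      have hk : (k : ℤ) + 1 ≠ i + 1 - j := by
        intro h
        apply hS
        have : i - j = k := by omega
        rw [this]; exact k.2
      simp [W, r, V', replacedIndex, hk, allInnovations]
    rw [this]; rfl
  have hWm : MeasurableSet (W ⁻¹' T₀) :=
    (measurable_pi_lambda W fun k => M.measurable_ε _) hT₀
  set Φ : (ℤ → Fin p → ℝ) → ℝ := fun v => F fun k => v (i + 1 - k)
  have hΦ : Measurable Φ := hF.comp (by fun_prop)
  have h := ((hV.comp (hΦ.indicator hT)).integral_eq)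
  have f1 : (T.indicator Φ) ∘ V' = (W ⁻¹' T₀).indicator fun ω => F (M.pastCoupled (i + 1) j ω) := by
    ext ω
    have : Φ (V' ω) = F (M.pastCoupled (i + 1) j ω) := by
      simp only [Φ, V']
      congr 1
      ext k l
      rw [pastCoupled_eq]
    rw [e2]
    by_cases hω : V' ω ∈ T <;> simp [Set.indicator, hω, this]
  have f2 : (T.indicator Φ) ∘ V = (W ⁻¹' T₀).indicator fun ω => F (M.past (i + 1) ω) := by
    ext ω
    rw [e1]
    by_cases hω : V ω ∈ T
    · simp [Set.indicator, hω]; rfl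
    · simp [Set.indicator, hω]
  rw [f1, f2, integral_indicator hWm, integral_indicator hWm] at h
  exact h

/-- The conditional expectation of `F (F_{i+1})` given the latest `j` innovations. -/
def window (F : (ℕ → Fin p → ℝ) → ℝ) (i : ℤ) (j : ℕ) : Ω → ℝ :=
  P[fun ω => F (M.past (i + 1) ω)|sigmaOn M.innovationSigma (Set.Ioc (i - j) i)]

lemma window_zero (i : ℤ) : M.window F i 0 = fun _ => ∫ ω, F (M.past (i + 1) ω) ∂P := by
  have : sigmaOn M.innovationSigma (Set.Ioc (i - (0 : ℕ)) i) = ⊥ := by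
    simp [sigmaOn]
  rw [window, this, condExp_bot]

lemma Ioc_succ_eq (i : ℤ) (j : ℕ) : Set.Ioc (i - (j + 1 : ℕ)) i = Set.Icc (i - j) i := by
  ext z
  simp only [Set.mem_Ioc, Set.mem_Icc]
  push_cast
  omega

include hF

lemma condExp_union_Ioi {i : ℤ} (hFi : Integrable (fun ω => F (M.past (i + 1) ω)) P) {S : Set ℤ}
    (hS : S ⊆ Set.Iic i) :
    P[fun ω => F (M.past (i + 1) ω)|sigmaOn M.innovationSigma (S ∪ Set.Ioi i)]
      =ᵐ[P] P[fun ω => F (M.past (i + 1) ω)|sigmaOn M.innovationSigma S] := by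
  rw [sigmaOn_union]
  refine condExp_sup_of_indep (sigmaOn_mono _ hS) (sigmaOn_le M.innovationSigma_le _)
    (sigmaOn_le M.innovationSigma_le _) ?_
    (hF.comp (M.measurable_past_sigmaOn i)).stronglyMeasurable hFi
  refine indep_iSup_of_disjoint M.innovationSigma_le M.iIndep_innovationSigma ?_
  rw [Set.disjoint_left]
  intro z hz hz'
  simp at hz hz'
  omega

/-- Innovations after `i` are irrelevant, so the two windows are conditional expectations given all
innovations from `i - j` on, respectively after `i - j`. By the tower property both project to the
latter. -/
lemma condExp_window_sub {i : ℤ} (hFi : Integrable (fun ω => F (M.past (i + 1) ω)) P) (j : ℕ) :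
    P[M.window F i (j + 1) - M.window F i j|sigmaOn M.innovationSigma (Set.Ioi (i - j))]
      =ᵐ[P] 0 := by
  have hle := fun S => sigmaOn_le M.innovationSigma_le S
  set Y : Ω → ℝ := fun ω => F (M.past (i + 1) ω) with hY
  have u1 : Set.Icc (i - j) i ∪ Set.Ioi i = Set.Ici (i - j) := by
    ext z; simp
  have u2 : Set.Ioc (i - j) i ∪ Set.Ioi i = Set.Ioi (i - j) := by
    ext z; simp
  have h1 : M.window F i (j + 1) =ᵐ[P] P[Y|sigmaOn M.innovationSigma (Set.Ici (i - j))] := by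
    rw [window, Ioc_succ_eq, ← u1]
    exact (M.condExp_union_Ioi hF hFi fun z hz => hz.2).symm
  have h2 : M.window F i j =ᵐ[P] P[Y|sigmaOn M.innovationSigma (Set.Ioi (i - j))] := by
    rw [window, ← u2]
    exact (M.condExp_union_Ioi hF hFi fun z hz => hz.2).symm
  have h3 : P[M.window F i (j + 1)|sigmaOn M.innovationSigma (Set.Ioi (i - j))]
      =ᵐ[P] P[Y|sigmaOn M.innovationSigma (Set.Ioi (i - j))] :=
    (condExp_congr_ae h1).trans
      (condExp_condExp_of_le (sigmaOn_mono _ Set.Ioi_subset_Ici_self) (hle _))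
  have h4 : P[M.window F i j|sigmaOn M.innovationSigma (Set.Ioi (i - j))]
      =ᵐ[P] P[Y|sigmaOn M.innovationSigma (Set.Ioi (i - j))] :=
    (condExp_congr_ae h2).trans (condExp_condExp_of_le le_rfl (hle _))
  have h5 : P[M.window F i (j + 1) - M.window F i j|sigmaOn M.innovationSigma (Set.Ioi (i - j))]
      =ᵐ[P] P[M.window F i (j + 1)|sigmaOn M.innovationSigma (Set.Ioi (i - j))]
        - P[M.window F i j|sigmaOn M.innovationSigma (Set.Ioi (i - j))] :=
    condExp_sub integrable_condExp integrable_condExp _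
  filter_upwards [h5, h3, h4] with ω e1 e2 e3
  rw [e1, Pi.sub_apply, e2, e3]
  simp

/-- The coupled functional does not see the innovation `i - j`, so adding that innovation to the
conditioning has no effect on it. What remains is the shorter window, by `setIntegral_pastCoupled`.
Thus the martingale difference is a conditional expectation of the coupling difference. -/
lemma window_sub_ae_eq {i : ℤ} (hFi : Integrable (fun ω => F (M.past (i + 1) ω)) P) (j : ℕ) :
    M.window F i (j + 1) - M.window F i j =ᵐ[P]
      P[fun ω => F (M.past (i + 1) ω) - F (M.pastCoupled (i + 1) j ω)|
        sigmaOn M.innovationSigma (Set.Icc (i - j) i)] := by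
  have hle := fun S => sigmaOn_le M.innovationSigma_le S
  set Y' : Ω → ℝ := fun ω => F (M.pastCoupled (i + 1) j ω) with hY'
  have hYi' : Integrable Y' P :=
    ((M.identDistrib_past_pastCoupled_same (i + 1) j).comp hF).integrable_iff.2 hFi
  set mm : ℤ ⊕ ℤ → MeasurableSpace Ω := fun x =>
    MeasurableSpace.comap (M.allInnovations x) inferInstance
  have hmm : ∀ x, mm x ≤ mΩ := fun x => (M.measurable_allInnovations x).comap_le
  set x₀ : ℤ ⊕ ℤ := Sum.inl (i - j + 1)
  have h1 : P[Y'|sigmaOn M.innovationSigma (Set.Ioc (i - j) i) ⊔ ⨆ x ∈ ({x₀} : Set (ℤ ⊕ ℤ)), mm x]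
      =ᵐ[P] P[Y'|sigmaOn M.innovationSigma (Set.Ioc (i - j) i)] := by
    refine condExp_sup_of_indep (m' := ⨆ x ∈ ({x₀}ᶜ : Set (ℤ ⊕ ℤ)), mm x) ?_
      (iSup₂_le fun x _ => hmm x) (iSup₂_le fun x _ => hmm x)
      (indep_iSup_of_disjoint hmm M.iIndep_allInnovations disjoint_compl_left) ?_ hYi'
    · refine iSup₂_le fun k hk => ?_
      refine le_iSup₂_of_le (Sum.inl (k + 1)) ?_ le_rfl
      simp only [Set.mem_compl_iff, Set.mem_singleton_iff, x₀, Sum.inl.injEq]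
      have := hk.1
      omega
    · refine (hF.comp (measurable_pi_of_measurable fun k => ?_)).stronglyMeasurable
      simp_rw [pastCoupled_eq]
      have hx : replacedIndex (i + 1) j (i + 1 - k) ∈ ({x₀}ᶜ : Set (ℤ ⊕ ℤ)) := by
        unfold replacedIndex
        split_ifs with h
        · simp [x₀]
        · simp only [Set.mem_compl_iff, Set.mem_singleton_iff, x₀, Sum.inl.injEq]
          omega
      exact (comap_measurable _).mono (le_iSup₂_of_le (f := fun x _ => mm x) _ hx le_rfl) le_rfl
  have e1 : sigmaOn M.innovationSigma (Set.Ioc (i - j) i) ⊔ ⨆ x ∈ ({x₀} : Set (ℤ ⊕ ℤ)), mm x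
      = sigmaOn M.innovationSigma (Set.Icc (i - j) i) := by
    have u : Set.Icc (i - j) i = Set.Ioc (i - j) i ∪ {i - (j : ℤ)} := by
      ext z; simp
    rw [u, sigmaOn_union]
    simp [sigmaOn, mm, x₀, innovationSigma, allInnovations]
  rw [e1] at h1
  have h2 : P[Y'|sigmaOn M.innovationSigma (Set.Ioc (i - j) i)] =ᵐ[P] M.window F i j := by
    refine ae_eq_condExp_of_forall_setIntegral_eq (hle _) hFi
      (fun s _ _ => integrable_condExp.integrableOn) (fun s hs _ => ?_)
      stronglyMeasurable_condExp.aestronglyMeasurable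
    rw [setIntegral_condExp (hle _) hYi' hs]
    exact M.setIntegral_pastCoupled hF i j (by simp) hs
  have h3 : M.window F i (j + 1)
      = P[fun ω => F (M.past (i + 1) ω)|sigmaOn M.innovationSigma (Set.Icc (i - j) i)] := by
    rw [window, Ioc_succ_eq]
  have h4 := condExp_sub hFi hYi' (sigmaOn M.innovationSigma (Set.Icc (i - j) i))
  filter_upwards [h1, h2, h4] with ω k1 k2 k4
  rw [Pi.sub_apply, h3, ← k2, ← k1, ← Pi.sub_apply, ← k4]
  rfl

/-- Conditional expectation contracts `L^r`, and stationarity moves the coupling difference to time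
`0`. -/
lemma eLpNorm_window_sub_le {i : ℤ} (hFi : Integrable (fun ω => F (M.past (i + 1) ω)) P) (j : ℕ)
    {r : ENNReal} (hr : 1 ≤ r) :
    eLpNorm (M.window F i (j + 1) - M.window F i j) r P
      ≤ eLpNorm (fun ω => F (M.past 0 ω) - F (M.pastCoupled 0 j ω)) r P := by
  rw [eLpNorm_congr_ae (M.window_sub_ae_eq hF hFi j)]
  refine (eLpNorm_condExp_le_eLpNorm _ hr).trans (le_of_eq ?_)
  have := (M.identDistrib_past_pastCoupled (i + 1) 0 j).comp
    (u := fun v : (ℕ → Fin p → ℝ) × (ℕ → Fin p → ℝ) => F v.1 - F v.2) (by fun_prop)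
  exact this.eLpNorm_eq r

/-- The filtration of the windows of growing length. -/
def windowFiltration (i : ℤ) : Filtration ℕ mΩ where
  seq j := sigmaOn M.innovationSigma (Set.Ioc (i - j) i)
  mono' a b hab := sigmaOn_mono _ (Set.Ioc_subset_Ioc_left (by gcongr))
  le' _ := sigmaOn_le M.innovationSigma_le _

lemma stronglyMeasurable_iSup_windowFiltration (i : ℤ) :
    StronglyMeasurable[⨆ j, M.windowFiltration i j] fun ω => F (M.past (i + 1) ω) := by
  refine (hF.comp ((M.measurable_past_sigmaOn i).mono ?_ le_rfl)).stronglyMeasurable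
  refine iSup₂_le fun k hk => ?_
  refine le_iSup_of_le (i - k + 1).toNat (le_iSup₂_of_le k ?_ le_rfl)
  have : k ≤ i := hk
  simp only [Set.mem_Ioc]
  omega

lemma tendsto_ae_window {i : ℤ} (hFi : Integrable (fun ω => F (M.past (i + 1) ω)) P) :
    ∀ᵐ ω ∂P, Tendsto (fun j => M.window F i j ω) atTop (𝓝 (F (M.past (i + 1) ω))) :=
  hFi.tendsto_ae_condExp (ℱ := M.windowFiltration i) (M.stronglyMeasurable_iSup_windowFiltration hF i)

lemma tendsto_eLpNorm_window {i : ℤ} (hFi : Integrable (fun ω => F (M.past (i + 1) ω)) P) :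
    Tendsto (fun j => eLpNorm (M.window F i j - fun ω => F (M.past (i + 1) ω)) 1 P) atTop (𝓝 0) :=
  hFi.tendsto_eLpNorm_condExp (ℱ := M.windowFiltration i)
    (M.stronglyMeasurable_iSup_windowFiltration hF i)

/-- The differences of successive windows telescope from the mean, which is the empty window, to the
functional; Fatou's lemma passes to the limit. -/
lemma eLpNorm_sub_integral_le {i : ℤ} (hFi : Integrable (fun ω => F (M.past (i + 1) ω)) P)
    {r : ENNReal} (hr : 1 ≤ r) :
    eLpNorm (fun ω => F (M.past (i + 1) ω) - ∫ ω', F (M.past (i + 1) ω') ∂P) r P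
      ≤ ∑' j, eLpNorm (fun ω => F (M.past 0 ω) - F (M.pastCoupled 0 j ω)) r P := by
  set c := ∫ ω', F (M.past (i + 1) ω') ∂P with hc
  have hm : ∀ j, AEStronglyMeasurable (M.window F i j) P := fun j =>
    integrable_condExp.aestronglyMeasurable
  have h1 := Lp.eLpNorm_lim_le_liminf_eLpNorm (μ := P) (p := r)
    (f := fun j ω => M.window F i j ω - c) (fun j => (hm j).sub aestronglyMeasurable_const)
    (fun ω => F (M.past (i + 1) ω) - c) (by
      filter_upwards [M.tendsto_ae_window hF hFi] with ω hω
      exact hω.sub_const c)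
  refine h1.trans ?_
  refine liminf_le_of_le (by isBoundedDefault) ?_
  intro b hb
  obtain ⟨N, hN⟩ := hb.exists
  refine hN.trans ?_
  have e : (fun ω => M.window F i N ω - c)
      = ∑ j ∈ Finset.range N, (M.window F i (j + 1) - M.window F i j) := by
    rw [Finset.sum_range_sub, window_zero]
    rfl
  rw [e]
  refine (eLpNorm_sum_le (fun j _ => (hm _).sub (hm _)) hr).trans ?_
  refine (Finset.sum_le_sum fun j _ => M.eLpNorm_window_sub_le hF hFi j hr).trans ?_
  exact ENNReal.sum_le_tsum _

end Projection

end CausalModel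

/-- The product rule and Hölder's inequality. It explains why products in `L^r` need moments and
dependence measures of order `2 * r`. -/
lemma eLpNorm_mul_sub_mul_le {Ω : Type*} [MeasurableSpace Ω] {P : Measure Ω} {r : ℝ} (hr : 1 ≤ r)
    {f g f' g' : Ω → ℝ} (hf : AEStronglyMeasurable f P) (hg : AEStronglyMeasurable g P)
    (hf' : AEStronglyMeasurable f' P) (hg' : AEStronglyMeasurable g' P) :
    eLpNorm (fun ω => f ω * g ω - f' ω * g' ω) (ENNReal.ofReal r) P
      ≤ eLpNorm f (ENNReal.ofReal (2 * r)) P * eLpNorm (fun ω => g ω - g' ω) (ENNReal.ofReal (2 * r)) P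
        + eLpNorm (fun ω => f ω - f' ω) (ENNReal.ofReal (2 * r)) P
          * eLpNorm g' (ENNReal.ofReal (2 * r)) P := by
  have hT : ENNReal.HolderTriple (ENNReal.ofReal (2 * r)) (ENNReal.ofReal (2 * r))
      (ENNReal.ofReal r) := by
    constructor
    rw [← ENNReal.ofReal_inv_of_pos (by linarith), ← ENNReal.ofReal_inv_of_pos (by linarith),
      ← ENNReal.ofReal_add (by positivity) (by positivity)]
    congr 1
    field_simp
    norm_num
  have e : (fun ω => f ω * g ω - f' ω * g' ω)
      = f • (fun ω => g ω - g' ω) + (fun ω => f ω - f' ω) • g' := by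
    ext ω; simp only [Pi.add_apply, smul_eq_mul, Pi.mul_apply]; ring
  rw [e]
  refine (eLpNorm_add_le (hf.smul (hg.sub hg')) ((hf.sub hf').smul hg') ?_).trans (add_le_add ?_ ?_)
  · rw [← ENNReal.ofReal_one]; exact ENNReal.ofReal_le_ofReal hr
  · exact eLpNorm_smul_le_mul_eLpNorm (hg.sub hg') hf
  · exact eLpNorm_smul_le_mul_eLpNorm hg' (hf.sub hf')

/-! ### From projection arrays to functionals of the past and to products of coordinates -/

namespace CausalModel

section Functional

variable {Ω : Type*} [mΩ : MeasurableSpace Ω] {P : Measure Ω} [IsProbabilityMeasure P] {p : ℕ}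
  (M : CausalModel Ω P p)

/-- The functional may vary with the row, which accommodates the rescaled time `i / n`; stationarity
of the innovations reduces every hypothesis to time `0`. -/
lemma isProjectionArray_window {q : ℝ} (hq : 2 ≤ q) {F : ℕ → (ℕ → Fin p → ℝ) → ℝ}
    (hF : ∀ i, Measurable (F i))
    (hLp : ∀ i, MemLp (fun ω => F i (M.past 0 ω)) (ENNReal.ofReal q) P) {α β : ℕ → ℝ}
    (hα0 : ∀ j, 0 ≤ α j) (hβ0 : ∀ j, 0 ≤ β j)
    (hα : ∀ i j, eLpNorm (fun ω => F i (M.past 0 ω) - F i (M.pastCoupled 0 j ω))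
      (ENNReal.ofReal q) P ≤ ENNReal.ofReal (α j))
    (hβ : ∀ i j, eLpNorm (fun ω => F i (M.past 0 ω) - F i (M.pastCoupled 0 j ω))
      (ENNReal.ofReal 2) P ≤ ENNReal.ofReal (β j)) :
    IsProjectionArray P M.innovationSigma q
      (fun i j => M.window (F i) i (j + 1) - M.window (F i) i j) α β := by
  have h1q : (1 : ENNReal) ≤ ENNReal.ofReal q := by
    rw [← ENNReal.ofReal_one]; exact ENNReal.ofReal_le_ofReal (by linarith)
  have hLp' : ∀ i : ℕ, MemLp (fun ω => F i (M.past (i + 1) ω)) (ENNReal.ofReal q) P := fun i =>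
    ((M.identDistrib_past (i + 1) 0).comp (hF i)).memLp_iff.2 (hLp i)
  have hint : ∀ i : ℕ, Integrable (fun ω => F i (M.past (i + 1) ω)) P := fun i =>
    (hLp' i).integrable h1q
  refine ⟨M.innovationSigma_le, M.iIndep_innovationSigma, fun i j => ?_, fun i j => ?_,
    fun i j => M.condExp_window_sub (hF i) (hint i) j,
    fun i j => (M.eLpNorm_window_sub_le (hF i) (hint i) j h1q).trans (hα i j),
    fun i j => (M.eLpNorm_window_sub_le (hF i) (hint i) j (by simp)).trans (hβ i j),
    hα0, hβ0⟩
  · have hc : ∀ j, MemLp (M.window (F i) i j) (ENNReal.ofReal q) P := fun j =>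
      ⟨integrable_condExp.aestronglyMeasurable,
        (eLpNorm_condExp_le_eLpNorm _ h1q).trans_lt (hLp' i).2⟩
    exact (hc _).sub (hc _)
  · have h1 : StronglyMeasurable[sigmaOn M.innovationSigma (Set.Icc ((i : ℤ) - j) i)]
        (M.window (F i) i (j + 1)) := by
      rw [← Ioc_succ_eq]
      exact stronglyMeasurable_condExp
    have h2 : StronglyMeasurable[sigmaOn M.innovationSigma (Set.Icc ((i : ℤ) - j) i)]
        (M.window (F i) i j) :=
      StronglyMeasurable.mono stronglyMeasurable_condExp (sigmaOn_mono _ Set.Ioc_subset_Icc_self)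
    exact h1.sub h2

lemma tendsto_measureReal_window_sub {F : (ℕ → Fin p → ℝ) → ℝ} (hF : Measurable F) {i : ℤ}
    (hFi : Integrable (fun ω => F (M.past (i + 1) ω)) P) {y : ℝ} (hy : 0 < y) :
    Tendsto (fun j => P.real {ω | y ≤ |M.window F i j ω - F (M.past (i + 1) ω)|}) atTop (𝓝 0) := by
  have h := M.tendsto_eLpNorm_window hF hFi
  have hi : ∀ j, Integrable (M.window F i j - fun ω => F (M.past (i + 1) ω)) P := fun j =>
    integrable_condExp.sub hFi
  have h1 : Tendsto (fun j => y⁻¹ * (eLpNorm (M.window F i j - fun ω => F (M.past (i + 1) ω)) 1 P).toReal)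
      atTop (𝓝 0) := by
    have := ((ENNReal.tendsto_toReal ENNReal.zero_ne_top).comp h).const_mul y⁻¹
    simpa using this
  refine squeeze_zero (fun j => measureReal_nonneg) (fun j => ?_) h1
  have h2 := mul_meas_ge_le_integral_of_nonneg (ae_of_all P fun ω => abs_nonneg _) (hi j).abs y
  rw [inv_mul_eq_div, le_div_iff₀ hy, mul_comm]
  refine h2.trans (le_of_eq ?_)
  rw [eLpNorm_one_eq_lintegral_enorm, ← integral_norm_eq_lintegral_enorm (hi j).1]
  rfl

/-- A maximal inequality of Nagaev type for functionals of the past with summable dependence. -/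
theorem _root_.ChangePoint.exists_measure_partialSum_functional_le {q A : ℝ} (hq : 2 < q)
    (hA : 0 < A) : ∃ C : ℝ, 1 ≤ C ∧
    ∀ {Ω : Type*} [MeasurableSpace Ω] (P : Measure Ω) [IsProbabilityMeasure P] {p : ℕ}
      (M : CausalModel Ω P p) (F : ℕ → (ℕ → Fin p → ℝ) → ℝ) (_ : ∀ i, Measurable (F i))
      (_ : ∀ i, MemLp (fun ω => F i (M.past 0 ω)) (ENNReal.ofReal q) P) (α β : ℕ → ℝ)
      (_ : ∀ j, 0 ≤ α j) (_ : ∀ j, 0 ≤ β j)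
      (_ : ∀ i j, eLpNorm (fun ω => F i (M.past 0 ω) - F i (M.pastCoupled 0 j ω))
        (ENNReal.ofReal q) P ≤ ENNReal.ofReal (α j))
      (_ : ∀ i j, eLpNorm (fun ω => F i (M.past 0 ω) - F i (M.pastCoupled 0 j ω))
        (ENNReal.ofReal 2) P ≤ ENNReal.ofReal (β j)) (a b : ℝ) (_ : 0 ≤ a) (_ : 0 ≤ b)
      (_ : ∀ u N, ∑ j ∈ Finset.Ico u N, α j ≤ a * ((u : ℝ) + 1) ^ (-A))
      (_ : ∀ u N, ∑ j ∈ Finset.Ico u N, β j ≤ b * ((u : ℝ) + 1) ^ (-A))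
      (n : ℕ) (_ : 3 ≤ n) (x : ℝ) (_ : 0 < x),
      P.real {ω | ∃ k ≤ n, 2 * x ≤ |∑ i ∈ Finset.range k, (F i (M.past ((i : ℤ) + 1) ω)
          - ∫ ω', F i (M.past 0 ω') ∂P)|}
        ≤ C * (varpi q A n * a ^ q / x ^ q + Real.exp (-(x ^ 2 / (C * (n * b ^ 2))))) := by
  obtain ⟨C, hC, hmain⟩ := exists_measure_partialSum_le hq hA
  refine ⟨C, hC, ?_⟩
  intro Ω mΩ P _ p M F hF hLp α β hα0 hβ0 hα hβ a b ha hb hαt hβt n hn x hx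
  have h1q : (1 : ENNReal) ≤ ENNReal.ofReal q := by
    rw [← ENNReal.ofReal_one]; exact ENNReal.ofReal_le_ofReal (by linarith)
  have hid : ∀ i : ℕ, IdentDistrib (fun ω => F i (M.past (i + 1) ω)) (fun ω => F i (M.past 0 ω)) P P :=
    fun i => (M.identDistrib_past (i + 1) 0).comp (hF i)
  have hint : ∀ i : ℕ, Integrable (fun ω => F i (M.past (i + 1) ω)) P := fun i =>
    ((hid i).memLp_iff.2 (hLp i)).integrable h1q
  have hD := M.isProjectionArray_window hq.le hF hLp hα0 hβ0 hα hβ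
  have hn0 : (0 : ℝ) < n := by positivity
  -- Cutting the telescoping sum at lag `N` costs at most `n * y = x` in total, outside an event of
  -- probability at most `R N`. The main bound does not depend on `N` and `R N` tends to `0`; this
  -- accounts for `2 * x` in the event.
  set y := x / n with hy
  have hy0 : 0 < y := by positivity
  set R : ℕ → ℝ := fun N => ∑ i ∈ Finset.range n,
    P.real {ω | y ≤ |M.window (F i) i N ω - F i (M.past (i + 1) ω)|}
  have hR : Tendsto R atTop (𝓝 0) := by
    have := tendsto_finsetSum (Finset.range n) fun i _ =>
      M.tendsto_measureReal_window_sub (hF i) (hint i) hy0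
    simpa using this
  set B := C * (varpi q A n * a ^ q / x ^ q + Real.exp (-(x ^ 2 / (C * (n * b ^ 2)))))
  have hBR : Tendsto (fun N => B + R N) atTop (𝓝 B) := by simpa using hR.const_add B
  refine ge_of_tendsto hBR (Eventually.of_forall fun N => ?_)
  have h1 := hmain P M.innovationSigma _ α β hD a b ha hb N (fun u => hαt u N) (fun u => hβt u N)
    n hn x hx
  have hsub : {ω | ∃ k ≤ n, 2 * x ≤ |∑ i ∈ Finset.range k, (F i (M.past ((i : ℤ) + 1) ω)
          - ∫ ω', F i (M.past 0 ω') ∂P)|}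
      ⊆ {ω | ∃ k ≤ n, x ≤ |∑ i ∈ Finset.range k, ∑ j ∈ Finset.range N,
          (M.window (F i) i (j + 1) - M.window (F i) i j) ω|}
        ∪ ⋃ i ∈ Finset.range n, {ω | y ≤ |M.window (F i) i N ω - F i (M.past (i + 1) ω)|} := by
    rintro ω ⟨k, hk, hxk⟩
    by_contra hcon
    simp only [Set.mem_union, not_or, Set.mem_iUnion, Finset.mem_range, not_exists,
      Set.mem_ofPred_eq, not_and, not_le] at hcon
    obtain ⟨h2, h3⟩ := hcon
    have h4 := h2 k hk
    have e : ∀ i, ∑ j ∈ Finset.range N, (M.window (F i) i (j + 1) - M.window (F i) i j) ω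
        = M.window (F i) i N ω - ∫ ω', F i (M.past 0 ω') ∂P := by
      intro i
      simp only [Pi.sub_apply]
      rw [Finset.sum_range_sub (fun j => M.window (F i) i j ω), window_zero, (hid i).integral_eq]
    simp_rw [e] at h4
    have h5 : |∑ i ∈ Finset.range k, (M.window (F i) i N ω - F i (M.past (i + 1) ω))| ≤ x := by
      refine (Finset.abs_sum_le_sum_abs _ _).trans ?_
      calc _ ≤ ∑ i ∈ Finset.range k, y := Finset.sum_le_sum fun i hi =>
            (h3 i ((Finset.mem_range.1 hi).trans_le hk)).le
        _ = k * y := by rw [Finset.sum_const, Finset.card_range, nsmul_eq_mul]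
        _ ≤ n * y := by gcongr
        _ = x := by rw [hy]; field_simp
    have e2 : ∑ i ∈ Finset.range k, (F i (M.past ((i : ℤ) + 1) ω) - ∫ ω', F i (M.past 0 ω') ∂P)
        = ∑ i ∈ Finset.range k, (M.window (F i) i N ω - ∫ ω', F i (M.past 0 ω') ∂P)
          - ∑ i ∈ Finset.range k, (M.window (F i) i N ω - F i (M.past (i + 1) ω)) := by
      rw [← Finset.sum_sub_distrib]
      exact Finset.sum_congr rfl fun i _ => by ring
    rw [e2] at hxk
    have := hxk.trans (abs_sub _ _)
    linarith
  calc _ ≤ _ := measureReal_mono hsub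
    _ ≤ _ := measureReal_union_le _ _
    _ ≤ _ := add_le_add h1 (measureReal_biUnion_finset_le _ _)

end Functional

section Dependence

variable {Ω : Type*} [mΩ : MeasurableSpace Ω] {P : Measure Ω} [IsProbabilityMeasure P] {p : ℕ}
  (M : CausalModel Ω P p)

lemma measurable_H_apply (t : ℝ) (j : Fin p) : Measurable fun v => M.H v t j :=
  (measurable_pi_apply j).comp (M.measurable_H.comp (measurable_id.prodMk measurable_const))

lemma measurable_X_apply (i : ℤ) (t : ℝ) (j : Fin p) : Measurable fun ω => M.X i t ω j :=
  (M.measurable_H_apply t j).comp (M.measurable_past i)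

lemma measurable_XCoupled_apply (i : ℤ) (m : ℕ) (t : ℝ) (j : Fin p) :
    Measurable fun ω => M.XCoupled i m t ω j :=
  (M.measurable_H_apply t j).comp (M.measurable_pastCoupled i m)

lemma eLpNorm_XCoupled (m : ℕ) (t : ℝ) (j : Fin p) (r : ENNReal) :
    eLpNorm (fun ω => M.XCoupled 0 m t ω j) r P = eLpNorm (fun ω => M.X 0 t ω j) r P :=
  ((M.identDistrib_past_pastCoupled_same 0 m).comp (M.measurable_H_apply t j)).eLpNorm_eq r

lemma eLpNorm_le_depMeasure (a : ℝ) (j : Fin p) (m : ℕ) {t : ℝ} (ht : t ∈ Set.Icc (0 : ℝ) 1) :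
    eLpNorm (fun ω => M.X 0 t ω j - M.XCoupled 0 m t ω j) (ENNReal.ofReal a) P
      ≤ M.depMeasure a j m :=
  le_iSup₂_of_le (f := fun t (_ : t ∈ Set.Icc (0 : ℝ) 1) =>
    eLpNorm (fun ω => M.X 0 t ω j - M.XCoupled 0 m t ω j) (ENNReal.ofReal a) P) t ht le_rfl

lemma tsum_depMeasure_le_dan (a A : ℝ) (j : Fin p) : ∑' i, M.depMeasure a j i ≤ M.dan a A j := by
  refine le_iSup_of_le 0 ?_
  simp

lemma depMeasure_mono {a a' : ℝ} (h : a ≤ a') (j : Fin p) (m : ℕ) :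
    M.depMeasure a j m ≤ M.depMeasure a' j m := by
  refine iSup₂_mono fun t _ => ?_
  exact eLpNorm_le_eLpNorm_of_exponent_le (ENNReal.ofReal_le_ofReal h)
    ((M.measurable_X_apply 0 t j).sub (M.measurable_XCoupled_apply 0 m t j)).aestronglyMeasurable

lemma maxDan_mono {a a' : ℝ} (h : a ≤ a') (A : ℝ) : M.maxDan a A ≤ M.maxDan a' A := by
  refine iSup_mono fun j => iSup_mono fun m => ?_
  gcongr
  exact M.depMeasure_mono h j _

lemma dan_le_maxDan (a A : ℝ) (j : Fin p) : M.dan a A j ≤ M.maxDan a A :=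
  le_iSup (fun j => M.dan a A j) j

lemma depMeasure_ne_top {a A : ℝ} (h : M.maxDan a A ≠ ⊤) (j : Fin p) (m : ℕ) :
    M.depMeasure a j m ≠ ⊤ :=
  ne_top_of_le_ne_top h ((ENNReal.le_tsum m).trans
    ((M.tsum_depMeasure_le_dan a A j).trans (M.dan_le_maxDan a A j)))

lemma sum_Ico_depMeasure_le {a A : ℝ} (h : M.maxDan a A ≠ ⊤) (j : Fin p) (u N : ℕ) :
    ∑ m ∈ Finset.Ico u N, (M.depMeasure a j m).toReal
      ≤ (M.dan a A j).toReal * ((u : ℝ) + 1) ^ (-A) := by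
  have hdan : M.dan a A j ≠ ⊤ := ne_top_of_le_ne_top h (M.dan_le_maxDan a A j)
  have hu : (0 : ℝ) < (u : ℝ) + 1 := by positivity
  have hpos : 0 < ((u : ℝ) + 1) ^ A := by positivity
  have h1 : ENNReal.ofReal (((u : ℝ) + 1) ^ A) * ∑ m ∈ Finset.Ico u N, M.depMeasure a j m
      ≤ M.dan a A j := by
    refine le_trans ?_ (le_iSup (fun m : ℕ =>
      ENNReal.ofReal (((m : ℝ) + 1) ^ A) * ∑' i : ℕ, M.depMeasure a j (m + i)) u)
    gcongr
    rw [Finset.sum_Ico_eq_sum_range]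
    exact ENNReal.sum_le_tsum _
  have h2 := ENNReal.toReal_mono hdan h1
  rw [ENNReal.toReal_mul, ENNReal.toReal_ofReal hpos.le,
    ENNReal.toReal_sum fun m _ => M.depMeasure_ne_top h j m] at h2
  rw [Real.rpow_neg hu.le, ← div_eq_mul_inv, le_div_iff₀ hpos, mul_comm]
  exact h2

/-- A centred coordinate has `L²` norm at most the sum of its dependence measures. This gives an a
priori bound on the covariances in terms of `N_X`, the quantity that the bandwidth controls. -/
lemma abs_cov_le_NX_sq {A : ℝ} (h4 : M.maxDan 4 A ≠ ⊤) {t : ℝ} (ht : t ∈ Set.Icc (0 : ℝ) 1)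
    (hmean : ∀ j : Fin p, Integrable (fun ω => M.X 0 t ω j) P ∧ ∫ ω, M.X 0 t ω j ∂P = 0)
    (j k : Fin p) : |M.cov j k t| ≤ M.NX A ^ 2 := by
  have hN : 0 ≤ M.NX A := ENNReal.toReal_nonneg
  have hnorm : ∀ j, eLpNorm (fun ω => M.X 0 t ω j) (ENNReal.ofReal 2) P
      ≤ ENNReal.ofReal (M.NX A) := by
    intro j
    have hid := (M.identDistrib_past ((-1 : ℤ) + 1) 0).comp (M.measurable_H_apply t j)
    have hint : Integrable (fun ω => M.H (M.past ((-1 : ℤ) + 1) ω) t j) P :=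
      hid.integrable_iff.2 (hmean j).1
    have h1 := M.eLpNorm_sub_integral_le (M.measurable_H_apply t j) hint
      (r := ENNReal.ofReal 2) (by simp)
    have h0 : ∫ ω', M.H (M.past ((-1 : ℤ) + 1) ω') t j ∂P = 0 :=
      hid.integral_eq.trans (hmean j).2
    simp_rw [h0, sub_zero] at h1
    have h2 : eLpNorm (fun ω => M.X 0 t ω j) (ENNReal.ofReal 2) P
        = eLpNorm (fun ω => M.H (M.past ((-1 : ℤ) + 1) ω) t j) (ENNReal.ofReal 2) P :=
      (hid.eLpNorm_eq _).symm
    rw [h2, NX, ENNReal.ofReal_toReal h4]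
    refine h1.trans (le_trans ?_ ((M.tsum_depMeasure_le_dan 4 A j).trans (M.dan_le_maxDan 4 A j)))
    refine ENNReal.tsum_le_tsum fun m => ?_
    exact (M.eLpNorm_le_depMeasure 2 j m ht).trans (M.depMeasure_mono (by norm_num) j m)
  have hmem : ∀ j, MemLp (fun ω => M.X 0 t ω j) (ENNReal.ofReal 2) P := fun j =>
    ⟨(M.measurable_X_apply 0 t j).aestronglyMeasurable, (hnorm j).trans_lt ENNReal.ofReal_lt_top⟩
  have hsq : ∀ j, ∫ ω, M.X 0 t ω j ^ 2 ∂P ≤ M.NX A ^ 2 := fun j => by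
    have := (eLpNorm_le_ofReal_iff (by norm_num) (hmem j) hN).1 (hnorm j)
    simpa using this
  have hisq : ∀ j, Integrable (fun ω => M.X 0 t ω j ^ 2) P := fun j => by
    have := hmem j
    rw [ENNReal.ofReal_ofNat] at this
    exact this.integrable_sq
  calc |M.cov j k t| ≤ ∫ ω, |M.X 0 t ω j * M.X 0 t ω k| ∂P := abs_integral_le_integral_abs
    _ ≤ ∫ ω, (M.X 0 t ω j ^ 2 / 2 + M.X 0 t ω k ^ 2 / 2) ∂P := by
        refine integral_mono_of_nonneg (ae_of_all _ fun ω => abs_nonneg _)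
          (((hisq j).div_const 2).add ((hisq k).div_const 2)) (ae_of_all _ fun ω => ?_)
        simp only
        rw [abs_le]
        constructor <;> nlinarith [sq_nonneg (M.X 0 t ω j + M.X 0 t ω k),
          sq_nonneg (M.X 0 t ω j - M.X 0 t ω k)]
    _ ≤ M.NX A ^ 2 := by
        rw [integral_add ((hisq j).div_const 2) ((hisq k).div_const 2), integral_div, integral_div]
        linarith [hsq j, hsq k]

/-- The maximal deviation of the partial sums of the products of two coordinates. -/
theorem _root_.ChangePoint.exists_measure_products_le {q A : ℝ} (hq : 2 < q) (hA : 0 < A) :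
    ∃ C : ℝ, 1 ≤ C ∧
    ∀ {Ω : Type*} [MeasurableSpace Ω] (P : Measure Ω) [IsProbabilityMeasure P] {p : ℕ}
      (M : CausalModel Ω P p) (κ : ℝ) (_ : 0 ≤ κ)
      (_ : ∀ t ∈ Set.Icc (0 : ℝ) 1, ∀ j : Fin p,
        eLpNorm (fun ω => M.X 0 t ω j) (ENNReal.ofReal (2 * q)) P ≤ ENNReal.ofReal κ)
      (_ : M.maxDan (2 * q) A ≠ ⊤) (j k : Fin p) (n : ℕ) (_ : 3 ≤ n) (x : ℝ) (_ : 0 < x),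
      P.real {ω | ∃ l ≤ n, 2 * x ≤ |∑ i ∈ Finset.range l, (M.obs n ω (i + 1) j * M.obs n ω (i + 1) k
          - M.cov j k (((i + 1 : ℕ) : ℝ) / n))|}
        ≤ C * (varpi q A n * (κ * ((M.dan (2 * q) A j).toReal + (M.dan (2 * q) A k).toReal)) ^ q
              / x ^ q
            + Real.exp (-(x ^ 2 / (C * (n * (2 * κ * M.NX A) ^ 2))))) := by
  obtain ⟨C, hC, hmain⟩ := exists_measure_partialSum_functional_le hq hA
  refine ⟨C, hC, ?_⟩
  intro Ω mΩ P _ p M κ hκ hmom hdep j k n hn x hx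
  have hdep4 : M.maxDan 4 A ≠ ⊤ := ne_top_of_le_ne_top hdep (M.maxDan_mono (by linarith) A)
  have hn0 : (0 : ℝ) < n := by positivity
  -- The hypotheses on `F i` must hold for every `i`, although only `i < n` matters; clipping keeps
  -- the time in `[0, 1]`.
  set t : ℕ → ℝ := fun i => min (((i + 1 : ℕ) : ℝ) / n) 1 with ht
  have htm : ∀ i, t i ∈ Set.Icc (0 : ℝ) 1 := fun i =>
    ⟨le_min (by positivity) zero_le_one, min_le_right _ _⟩
  have hti : ∀ i < n, t i = ((i + 1 : ℕ) : ℝ) / n := fun i hi => by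
    apply min_eq_left
    rw [div_le_one hn0]
    exact_mod_cast hi
  set F : ℕ → (ℕ → Fin p → ℝ) → ℝ := fun i v => M.H v (t i) j * M.H v (t i) k with hFdef
  have hF : ∀ i, Measurable (F i) := fun i =>
    (M.measurable_H_apply (t i) j).mul (M.measurable_H_apply (t i) k)
  have hXm : ∀ i l, AEStronglyMeasurable (fun ω => M.X 0 (t i) ω l) P := fun i l =>
    (M.measurable_X_apply 0 (t i) l).aestronglyMeasurable
  have hXm' : ∀ i m l, AEStronglyMeasurable (fun ω => M.XCoupled 0 m (t i) ω l) P := fun i m l =>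
    (M.measurable_XCoupled_apply 0 m (t i) l).aestronglyMeasurable
  -- Used with `r = q` for the polynomial term and with `r = 2` for the Gaussian one, where the
  -- dependence measure of order `4` brings in `NX`.
  have hdiff : ∀ r : ℝ, 1 ≤ r → r ≤ q → M.maxDan (2 * r) A ≠ ⊤ → ∀ i m,
      eLpNorm (fun ω => F i (M.past 0 ω) - F i (M.pastCoupled 0 m ω)) (ENNReal.ofReal r) P
      ≤ ENNReal.ofReal (κ * ((M.depMeasure (2 * r) j m).toReal
        + (M.depMeasure (2 * r) k m).toReal)) := by
    intro r hr hrq hd i m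
    have hmom' : ∀ l, eLpNorm (fun ω => M.X 0 (t i) ω l) (ENNReal.ofReal (2 * r)) P
        ≤ ENNReal.ofReal κ := fun l =>
      (eLpNorm_le_eLpNorm_of_exponent_le (ENNReal.ofReal_le_ofReal (by linarith)) (hXm i l)).trans
        (hmom _ (htm i) l)
    refine (eLpNorm_mul_sub_mul_le hr (hXm i j) (hXm i k) (hXm' i m j) (hXm' i m k)).trans ?_
    rw [eLpNorm_XCoupled, mul_add, ENNReal.ofReal_add (by positivity) (by positivity),
      ENNReal.ofReal_mul hκ, ENNReal.ofReal_mul hκ, ENNReal.ofReal_toReal (M.depMeasure_ne_top hd j m),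
      ENNReal.ofReal_toReal (M.depMeasure_ne_top hd k m), add_comm,
      mul_comm (ENNReal.ofReal κ) (M.depMeasure (2 * r) j m)]
    gcongr
    · exact M.eLpNorm_le_depMeasure (2 * r) j m (htm i)
    · exact hmom' k
    · exact hmom' j
    · exact M.eLpNorm_le_depMeasure (2 * r) k m (htm i)
  have hLp : ∀ i, MemLp (fun ω => F i (M.past 0 ω)) (ENNReal.ofReal q) P := fun i => by
    refine ⟨((hF i).comp (M.measurable_past 0)).aestronglyMeasurable, ?_⟩
    have h0 := eLpNorm_mul_sub_mul_le (P := P) (r := q) (by linarith) (hXm i j) (hXm i k)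
      (f' := fun _ => 0) (g' := fun _ => 0) aestronglyMeasurable_const aestronglyMeasurable_const
    simp only [mul_zero, sub_zero] at h0
    refine h0.trans_lt (ENNReal.add_lt_top.2 ⟨?_, ?_⟩)
    · exact ENNReal.mul_lt_top ((hmom _ (htm i) j).trans_lt ENNReal.ofReal_lt_top)
        ((hmom _ (htm i) k).trans_lt ENNReal.ofReal_lt_top)
    · simp
  have h4 : (2 : ℝ) * 2 = 4 := by norm_num
  have hNX : ∀ l, (M.dan 4 A l).toReal ≤ M.NX A := fun l =>
    ENNReal.toReal_mono hdep4 (M.dan_le_maxDan 4 A l)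
  have htail : ∀ r : ℝ, M.maxDan (2 * r) A ≠ ⊤ → ∀ u N,
      ∑ m ∈ Finset.Ico u N, κ * ((M.depMeasure (2 * r) j m).toReal
        + (M.depMeasure (2 * r) k m).toReal)
      ≤ κ * ((M.dan (2 * r) A j).toReal + (M.dan (2 * r) A k).toReal) * ((u : ℝ) + 1) ^ (-A) := by
    intro r hd u N
    rw [← Finset.mul_sum, Finset.sum_add_distrib, mul_assoc, add_mul]
    gcongr
    · exact M.sum_Ico_depMeasure_le hd j u N
    · exact M.sum_Ico_depMeasure_le hd k u N
  have hfin := hmain P M F hF hLp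
    (fun m => κ * ((M.depMeasure (2 * q) j m).toReal + (M.depMeasure (2 * q) k m).toReal))
    (fun m => κ * ((M.depMeasure (2 * 2) j m).toReal + (M.depMeasure (2 * 2) k m).toReal))
    (fun m => by positivity) (fun m => by positivity)
    (hdiff q (by linarith) le_rfl hdep) (hdiff 2 (by norm_num) hq.le (by rwa [h4]))
    (κ * ((M.dan (2 * q) A j).toReal + (M.dan (2 * q) A k).toReal)) (2 * κ * M.NX A)
    (by positivity) (mul_nonneg (by positivity) ENNReal.toReal_nonneg) (htail q hdep)
    (fun u N => by
      refine (htail 2 (by rwa [h4]) u N).trans ?_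
      rw [h4]
      have h5 : κ * ((M.dan 4 A j).toReal + (M.dan 4 A k).toReal) ≤ 2 * κ * M.NX A := by
        nlinarith [hNX j, hNX k]
      exact mul_le_mul_of_nonneg_right h5 (by positivity)) n hn x hx
  refine (le_of_eq ?_).trans hfin
  congr 1
  ext ω
  refine exists_congr fun l => and_congr_right fun hl => ?_
  rw [Finset.sum_congr rfl fun i hi => ?_]
  have hi' : i < n := (Finset.mem_range.1 hi).trans_le hl
  simp only [hFdef, hti i hi', obs, X, cov]
  push_cast
  rfl

end Dependence

end CausalModel

/-! ### Combinatorics of the recursive search -/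

lemma mem_searchGrid {n b : ℕ} {mhat : ℕ → ℕ} {l m : ℕ} :
    m ∈ searchGrid n b mhat l ↔
      (b ≤ m ∧ m ≤ n - b) ∧ ∀ i < l, 2 * (b : ℤ) < |(m : ℤ) - (mhat i : ℤ)| := by
  induction l with
  | zero => simp [searchGrid]
  | succ l ih =>
    rw [searchGrid, Finset.mem_filter, ih, and_assoc]
    refine and_congr_right fun _ => ⟨fun h i hi => ?_, fun h => ⟨fun i hi => h i (by omega),
      h l (by omega)⟩⟩
    rcases Nat.lt_succ_iff_lt_or_eq.1 hi with hi | rfl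
    · exact h.1 i hi
    · exact h.2

/-- If large values of the statistic occur only near `ι` well separated positions, and do occur
at these positions, then the recursive search finds each of them exactly once. -/
lemma exists_perm_of_search {n b ι ihat : ℕ} {mhat : ℕ → ℕ} {v : ℕ → ℝ} {thr : ℝ}
    {pos : Fin ι → ℕ} (hmem : ∀ l < ihat, mhat l ∈ searchGrid n b mhat l)
    (hargmax : ∀ l < ihat, ∀ m ∈ searchGrid n b mhat l, v m ≤ v (mhat l))
    (hcont : ∀ l < ihat, thr ≤ v (mhat l))
    (hterm : ∀ m ∈ searchGrid n b mhat ihat, v m < thr)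
    (hnear : ∀ m, b ≤ m → m ≤ n - b → thr ≤ v m → ∃ l, |(m : ℤ) - (pos l : ℤ)| < b)
    (hpos : ∀ l, b ≤ pos l ∧ pos l ≤ n - b ∧ thr ≤ v (pos l))
    (hsep : ∀ l l', l ≠ l' → 4 * (b : ℤ) ≤ |(pos l : ℤ) - (pos l' : ℤ)|) :
    ihat = ι ∧ ∃ σ : Equiv.Perm (Fin ι), ∀ l, |(mhat (σ l) : ℤ) - (pos l : ℤ)| < b ∧
      v (pos l) ≤ v (mhat (σ l)) := by
  have h1 : ∀ s : Fin ihat, ∃ l, |(mhat s : ℤ) - (pos l : ℤ)| < b := fun s =>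
    hnear _ (mem_searchGrid.1 (hmem s s.2)).1.1 (mem_searchGrid.1 (hmem s s.2)).1.2 (hcont s s.2)
  -- `π` sends an estimate to a change point within `b` of it. Two estimates with the same image
  -- would be closer than `2b`, against the deletion rule, so `π` is injective. A change point not
  -- in the image is never deleted, as the positions are `4b` apart, and would prevent the search
  -- from stopping, so `π` is surjective.
  choose π hπ using h1
  have hlt : ∀ s s' : Fin ihat, s < s' → π s ≠ π s' := fun s s' hs he => by
    have h2 := (mem_searchGrid.1 (hmem s' s'.2)).2 s hs
    have h3 := hπ s
    have h4 := hπ s'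
    rw [he] at h3
    rw [abs_lt] at h3 h4
    rw [lt_abs] at h2
    omega
  have hinj : Function.Injective π := fun s s' he => by
    rcases lt_trichotomy s s' with h | h | h
    · exact absurd he (hlt _ _ h)
    · exact h
    · exact absurd he.symm (hlt _ _ h)
  have hgrid : ∀ (N : ℕ) (hN : N ≤ ihat) (l : Fin ι),
      (∀ i : Fin ihat, (i : ℕ) < N → π i ≠ l) → pos l ∈ searchGrid n b mhat N := by
    intro N hN l hl
    refine mem_searchGrid.2 ⟨⟨(hpos l).1, (hpos l).2.1⟩, fun i hi => ?_⟩
    have h2 := hsep _ _ (hl ⟨i, hi.trans_le hN⟩ hi)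
    have h3 := hπ ⟨i, hi.trans_le hN⟩
    simp only at h3
    rw [abs_lt] at h3
    rw [le_abs] at h2
    rw [lt_abs]
    omega
  have hsurj : Function.Surjective π := fun l => by
    by_contra! hl
    exact absurd (hterm _ (hgrid ihat le_rfl l fun i _ => hl i)) (not_lt.2 (hpos l).2.2)
  have hι : ihat = ι := by simpa using Fintype.card_of_bijective ⟨hinj, hsurj⟩
  subst hι
  refine ⟨rfl, (Equiv.ofBijective π ⟨hinj, hsurj⟩).symm, fun l => ?_⟩
  set s := (Equiv.ofBijective π ⟨hinj, hsurj⟩).symm l with hs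
  have hsl : π s = l := (Equiv.ofBijective π ⟨hinj, hsurj⟩).apply_symm_apply l
  -- No estimate before step `s` belongs to `l`, so `pos l` is still in the grid and competes with
  -- the maximizer.
  refine ⟨hsl ▸ hπ s, hargmax s s.2 _ (hgrid s s.2.le l fun i hi => ?_)⟩
  rw [← hsl]
  exact hlt i s hi

lemma gap_le_sub {ι : ℕ} {t : Fin (ι + 2) → ℝ} (ht : StrictMono t) {c : ℝ}
    (hsep : ∀ l : Fin (ι + 1), c ≤ t l.succ - t l.castSucc) {i j : Fin (ι + 2)} (hij : i < j) :
    c ≤ t j - t i := by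
  obtain ⟨j', rfl⟩ := Fin.exists_succ_eq.2 (Fin.ne_zero_of_lt hij)
  have h1 : t i ≤ t j'.castSucc := ht.monotone (by
    rw [Fin.le_def]; rw [Fin.lt_def] at hij; simp at hij ⊢; omega)
  linarith [hsep j']

/-- Change points are more than `2 * e` apart, so the arrangement `σ` already lists the estimates in
increasing order; a monotone rearrangement is unique, hence it is the sorted one. -/
lemma locationError_le {ι n : ℕ} {t : Fin (ι + 2) → ℝ} (ht : StrictMono t) {c e : ℝ}
    (hsep : ∀ l : Fin (ι + 1), c ≤ t l.succ - t l.castSucc) (he0 : 0 ≤ e) (he : 2 * e < c)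
    {mhat : ℕ → ℕ} (σ : Equiv.Perm (Fin ι))
    (h : ∀ l : Fin ι, |(mhat (σ l) : ℝ) / n - t l.succ.castSucc| ≤ e) :
    locationError n mhat t ≤ e := by
  refine Real.iSup_le (fun j => ?_) he0
  set s : Fin ι → ℝ := fun i => (mhat i : ℝ) / (n : ℝ) with hs
  have hmono : Monotone (s ∘ σ) := by
    refine monotone_iff_forall_lt.2 fun i j hij => ?_
    have h1 := gap_le_sub ht hsep (i := i.succ.castSucc) (j := j.succ.castSucc) (by simpa)
    have h2 := abs_le.1 (h i)
    have h3 := abs_le.1 (h j)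
    simp only [hs, Function.comp]
    linarith
  have h4 := Tuple.unique_monotone hmono (Tuple.monotone_sort s)
  have h5 := congr_fun h4 j
  simp only [Function.comp, hs] at h5
  unfold orderedEstimate
  simp only
  rw [← h5]
  exact h j

/-! ### Window differences of data and of piecewise Lipschitz functions -/

lemma abs_le_maxNorm {p : ℕ} (B : Matrix (Fin p) (Fin p) ℝ) (j k : Fin p) :
    |B j k| ≤ maxNorm B :=
  le_ciSup (f := fun x : Fin p × Fin p => |B x.1 x.2|) (Set.finite_range _).bddAbove (j, k)

lemma maxNorm_le {p : ℕ} {B : Matrix (Fin p) (Fin p) ℝ} {c : ℝ} (hc : 0 ≤ c)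
    (h : ∀ j k, |B j k| ≤ c) : maxNorm B ≤ c :=
  Real.iSup_le (fun x => h x.1 x.2) hc

/-- The difference of the sums of `f` over the windows of length `b` to the left and to the right
of `m`. -/
def windowDiff (f : ℕ → ℝ) (b m : ℕ) : ℝ :=
  ∑ i ∈ Finset.range b, (f (m - b + i + 1) - f (m + i + 1))

lemma localDiff_apply {p : ℕ} (x : ℕ → Fin p → ℝ) {n b m : ℕ} (hbm : b ≤ m) (j k : Fin p) :
    localDiff x n b m j k = (n : ℝ)⁻¹ * windowDiff (fun i => x i j * x i k) b m := by
  have h1 : ∑ i ∈ Finset.range b, x (m - i) j * x (m - i) k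
      = ∑ i ∈ Finset.range b, x (m - b + i + 1) j * x (m - b + i + 1) k := by
    rw [← Finset.sum_range_reflect]
    refine Finset.sum_congr rfl fun i hi => ?_
    have := Finset.mem_range.1 hi
    have e : m - (b - 1 - i) = m - b + i + 1 := by omega
    rw [e]
  have h2 : ∑ i ∈ Finset.Icc 1 b, x (m + i) j * x (m + i) k
      = ∑ i ∈ Finset.range b, x (m + i + 1) j * x (m + i + 1) k := by
    rw [Finset.range_eq_Ico, ← Finset.Ico_add_one_right_eq_Icc,
      ← Finset.sum_Ico_add' (fun i => x (m + i) j * x (m + i) k) 0 b 1]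
    rfl
  simp only [localDiff, Matrix.smul_apply, Matrix.sub_apply, Matrix.sum_apply,
    Matrix.vecMulVec_apply, smul_eq_mul, windowDiff, Finset.sum_sub_distrib, h1, h2]

lemma windowDiff_sub (f g : ℕ → ℝ) (b m : ℕ) :
    windowDiff f b m - windowDiff g b m = windowDiff (fun i => f i - g i) b m := by
  simp only [windowDiff, ← Finset.sum_sub_distrib]
  exact Finset.sum_congr rfl fun i _ => by ring

/-- A window difference combines the partial sums at `m`, `m - b` and `m + b` with coefficients `2`,
`-1`, `-1`. A maximal inequality for partial sums therefore covers all `m` at once. -/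
lemma abs_windowDiff_le {f : ℕ → ℝ} {n b m : ℕ} {y : ℝ} (hbm : b ≤ m) (hmn : m + b ≤ n)
    (h : ∀ l ≤ n, |∑ i ∈ Finset.range l, f (i + 1)| ≤ y) : |windowDiff f b m| ≤ 4 * y := by
  have e : windowDiff f b m = 2 * (∑ i ∈ Finset.range m, f (i + 1))
      - (∑ i ∈ Finset.range (m - b), f (i + 1)) - ∑ i ∈ Finset.range (m + b), f (i + 1) := by
    rw [Finset.sum_range_add]
    nth_rw 1 [show m = (m - b) + b by omega]
    rw [windowDiff, Finset.sum_sub_distrib, two_mul]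
    nth_rw 3 [show m = (m - b) + b by omega]
    rw [Finset.sum_range_add]
    simp only [Nat.sub_add_cancel hbm]
    ring
  have h1 := abs_le.1 (h m (by omega))
  have h2 := abs_le.1 (h (m - b) (by omega))
  have h3 := abs_le.1 (h (m + b) hmn)
  rw [e, abs_le]
  constructor <;> linarith

/-- A Lipschitz function on the half-open piece extends continuously to its right end, so the left
limit exists and equals the extension. -/
lemma abs_sub_leftLim_le {g : ℝ → ℝ} {a τ L : ℝ} (haτ : a < τ) (hL : 0 ≤ L)
    (hg : ∀ s ∈ Set.Ico a τ, ∀ s' ∈ Set.Ico a τ, |g s - g s'| ≤ L * |s - s'|) {s : ℝ}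
    (hs : s ∈ Set.Ico a τ) : |g s - Function.leftLim g τ| ≤ L * (τ - s) := by
  have hlip : LipschitzOnWith (Real.toNNReal L) g (Set.Ico a τ) :=
    LipschitzOnWith.of_dist_le_mul fun x hx y hy => by
      rw [Real.dist_eq, Real.dist_eq, Real.coe_toNNReal L hL]
      exact hg x hx y hy
  obtain ⟨G, hG, hEq⟩ := hlip.extend_real
  have hlim : Tendsto g (𝓝[<] τ) (𝓝 (G τ)) := by
    refine ((hG.continuous.tendsto τ).mono_left nhdsWithin_le_nhds).congr' ?_
    filter_upwards [Ioo_mem_nhdsLT haτ] with x hx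
    exact (hEq ⟨hx.1.le, hx.2⟩).symm
  rw [leftLim_eq_of_tendsto hlim, hEq hs]
  have h := hG.dist_le_mul s τ
  rw [Real.dist_eq, Real.dist_eq, Real.coe_toNNReal L hL, abs_sub_comm s τ,
    abs_of_nonneg (sub_nonneg.2 hs.2.le)] at h
  exact h

namespace CausalModel

lemma IsPartition.exists_mem_piece {ι : ℕ} {t : Fin (ι + 2) → ℝ} (ht : IsPartition t) {s : ℝ}
    (hs : s ∈ Set.Ico (0 : ℝ) 1) : ∃ l, s ∈ piece t l := by
  by_contra! h
  have h1 : ∀ i, t i ≤ s := fun i => by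
    induction i using Fin.induction with
    | zero => rw [ht.first]; exact hs.1
    | succ l ih =>
      by_contra! h2
      exact h l ⟨ih, h2⟩
  have := h1 (Fin.last (ι + 1))
  rw [ht.last] at this
  exact absurd hs.2 (not_lt.2 this)

lemma IsPartition.pos {ι : ℕ} {t : Fin (ι + 2) → ℝ} (ht : IsPartition t) (l : Fin ι) :
    0 < t l.succ.castSucc := by
  rw [← ht.first]
  exact ht.strictMono (by simp [Fin.lt_def])

lemma IsPartition.mem_Ico {ι : ℕ} {t : Fin (ι + 2) → ℝ} (ht : IsPartition t) (l : Fin ι) :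
    t l.succ.castSucc ∈ Set.Ico (0 : ℝ) 1 := by
  refine ⟨(ht.pos l).le, ?_⟩
  rw [← ht.last]
  exact ht.strictMono (by simp [Fin.lt_def])

end CausalModel

/-- The last index `i` with `i / n < τ`. -/
def changeIndex (n : ℕ) (τ : ℝ) : ℕ := ⌈(n : ℝ) * τ⌉₊ - 1

lemma le_changeIndex {n : ℕ} {τ : ℝ} (hn : 0 < n) (hτ : 0 < τ) {i : ℕ} :
    i ≤ changeIndex n τ ↔ (i : ℝ) / n < τ := by
  have hn' : (0 : ℝ) < n := by exact_mod_cast hn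
  have h1 : 0 < ⌈(n : ℝ) * τ⌉₊ := Nat.ceil_pos.2 (by positivity)
  have h2 : i ≤ changeIndex n τ ↔ i < ⌈(n : ℝ) * τ⌉₊ := by unfold changeIndex; omega
  rw [h2, Nat.lt_ceil, div_lt_iff₀ hn', mul_comm]

lemma changeIndex_lt {n : ℕ} {τ : ℝ} (hn : 0 < n) (hτ : 0 < τ) : (changeIndex n τ : ℝ) < n * τ := by
  have hn' : (0 : ℝ) < n := by exact_mod_cast hn
  have := (le_changeIndex hn hτ).1 le_rfl
  rwa [div_lt_iff₀ hn', mul_comm] at this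

lemma le_changeIndex_add_one {n : ℕ} {τ : ℝ} (hn : 0 < n) (hτ : 0 < τ) :
    n * τ ≤ (changeIndex n τ : ℝ) + 1 := by
  have hn' : (0 : ℝ) < n := by exact_mod_cast hn
  have h := mt (le_changeIndex hn hτ (i := changeIndex n τ + 1)).2 (by omega)
  rw [not_lt, le_div_iff₀ hn'] at h
  push_cast at h
  linarith

/-! ### The deterministic part away from change points and near one -/

section PiecewiseLipschitz

open CausalModel

variable {ι : ℕ} {t : Fin (ι + 2) → ℝ} {g : ℝ → ℝ} {L : ℝ} {n b m : ℕ}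

lemma abs_sub_le_of_no_change (ht : IsPartition t)
    (hg : ∀ l, ∀ s ∈ piece t l, ∀ s' ∈ piece t l, |g s - g s'| ≤ L * |s - s'|) {i i' : ℕ}
    (hii' : i ≤ i') (hi'n : i' < n)
    (hno : ∀ l : Fin ι, ¬(i ≤ changeIndex n (t l.succ.castSucc)
      ∧ changeIndex n (t l.succ.castSucc) < i')) :
    |g ((i : ℝ) / n) - g ((i' : ℝ) / n)| ≤ L * (((i' : ℝ) - i) / n) := by
  have hn : 0 < n := by omega
  have hn' : (0 : ℝ) < n := by exact_mod_cast hn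
  have hii : (i : ℝ) ≤ i' := by exact_mod_cast hii'
  have h1 : ∀ i < n, (i : ℝ) / n ∈ Set.Ico (0 : ℝ) 1 := fun i hi => by
    refine ⟨by positivity, ?_⟩
    rw [div_lt_one hn']
    exact_mod_cast hi
  obtain ⟨l, hl⟩ := ht.exists_mem_piece (h1 i (by omega))
  have hle : (i : ℝ) / n ≤ (i' : ℝ) / n := by gcongr
  have hl' : (i' : ℝ) / n ∈ piece t l := by
    refine ⟨hl.1.trans hle, ?_⟩
    induction l using Fin.lastCases with
    | last => rw [Fin.succ_last, ht.last]; exact (h1 i' hi'n).2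
    | cast l =>
      have h2 := hl.2
      rw [Fin.succ_castSucc] at h2 ⊢
      rw [← le_changeIndex hn (ht.pos l)] at h2 ⊢
      by_contra! h3
      exact hno l ⟨h2, h3⟩
  refine (hg l _ hl _ hl').trans (le_of_eq ?_)
  rw [abs_sub_comm, abs_of_nonneg (by linarith), sub_div]

lemma abs_windowDiff_le_of_no_change (ht : IsPartition t) (hL : 0 ≤ L)
    (hg : ∀ l, ∀ s ∈ piece t l, ∀ s' ∈ piece t l, |g s - g s'| ≤ L * |s - s'|) {B : ℝ}
    (hB : ∀ s ∈ Set.Icc (0 : ℝ) 1, |g s| ≤ B) (hn : 0 < n) (hbm : b ≤ m) (hmn : m + b ≤ n)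
    (hno : ∀ l : Fin ι, (b : ℤ) ≤ |(m : ℤ) - (changeIndex n (t l.succ.castSucc) : ℤ)|) :
    |windowDiff (fun i => g ((i : ℝ) / n)) b m| ≤ L * b ^ 2 / n + 2 * B := by
  have hn' : (0 : ℝ) < n := by exact_mod_cast hn
  have hB0 : 0 ≤ B := (abs_nonneg _).trans (hB 0 ⟨le_rfl, zero_le_one⟩)
  -- The two windows are paired at distance `b`. Only the last pair can reach the time `1`, which
  -- lies in no half-open piece; it is bounded crudely by `2 * B`.
  have hterm : ∀ i ∈ Finset.range b,
      |g (((m - b + i + 1 : ℕ) : ℝ) / n) - g (((m + i + 1 : ℕ) : ℝ) / n)|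
        ≤ L * (b / n) + if i + 1 = b then 2 * B else 0 := fun i hi => by
    have hib := Finset.mem_range.1 hi
    have hpos : 0 ≤ L * ((b : ℝ) / n) := by positivity
    by_cases h : m + i + 1 < n
    · refine (abs_sub_le_of_no_change ht hg (by omega) h fun l hl => ?_).trans ?_
      · have := hno l
        rw [le_abs] at this
        omega
      · have e : (((m + i + 1 : ℕ) : ℝ) - ((m - b + i + 1 : ℕ) : ℝ)) = b := by
          push_cast [Nat.cast_sub hbm]; ring
        rw [e]
        refine le_add_of_nonneg_right ?_
        split_ifs <;> linarith
    · rw [if_pos (by omega)]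
      have hm : ∀ i ≤ n, (i : ℝ) / n ∈ Set.Icc (0 : ℝ) 1 := fun i hi => by
        refine ⟨by positivity, ?_⟩
        rw [div_le_one hn']
        exact_mod_cast hi
      have h1 := abs_le.1 (hB _ (hm (m - b + i + 1) (by omega)))
      have h2 := abs_le.1 (hB _ (hm (m + i + 1) (by omega)))
      rw [abs_le]
      constructor <;> linarith
  refine (Finset.abs_sum_le_sum_abs _ _).trans ((Finset.sum_le_sum hterm).trans ?_)
  rw [Finset.sum_add_distrib]
  refine add_le_add (le_of_eq ?_) ?_
  · rw [Finset.sum_const, Finset.card_range, nsmul_eq_mul]; ring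
  · rcases Nat.eq_zero_or_pos b with rfl | hb
    · simpa using hB0
    · rw [Finset.sum_congr rfl fun i _ => if_congr (show i + 1 = b ↔ i = b - 1 by omega) rfl rfl,
        Finset.sum_ite_eq' (Finset.range b) (b - 1) fun _ => 2 * B]
      split_ifs <;> linarith

/-- The tent: for a step at `μ` the window difference is minus the jump times `b - |m - μ|`, the
minus sign because the right window is subtracted. -/
lemma sum_step_eq {μ b m : ℕ} (hbm : b ≤ m) (hd : |(m : ℤ) - (μ : ℤ)| ≤ b) (x y : ℝ) :
    windowDiff (fun i => if i ≤ μ then x else y) b m = -((b - |(m : ℝ) - μ|) * (y - x)) := by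
  have hterm : ∀ i ∈ Finset.range b,
      ((if m - b + i + 1 ≤ μ then x else y) - (if m + i + 1 ≤ μ then x else y))
      = if i ∈ Finset.Ico (μ - m) (b - (m - μ)) then x - y else 0 := fun i hi => by
    have hib := Finset.mem_range.1 hi
    rw [abs_le] at hd
    simp only [Finset.mem_Ico]
    split_ifs <;> first | omega | ring
  have hsub : Finset.Ico (μ - m) (b - (m - μ)) ⊆ Finset.range b := fun i hi => by
    simp only [Finset.mem_Ico, Finset.mem_range] at hi ⊢
    omega
  rw [windowDiff, Finset.sum_congr rfl hterm, Finset.sum_ite_mem,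
    Finset.inter_eq_right.2 hsub, Finset.sum_const, Nat.card_Ico, nsmul_eq_mul]
  have e : ((b - (m - μ) - (μ - m) : ℕ) : ℝ) = b - |(m : ℝ) - μ| := by
    rcases le_total μ m with h | h
    · have h2 : (μ : ℝ) ≤ m := by exact_mod_cast h
      rw [abs_le] at hd
      rw [abs_of_nonneg (by linarith), Nat.sub_eq_zero_of_le h, Nat.sub_zero,
        Nat.cast_sub (by omega), Nat.cast_sub h]
    · have h2 : (m : ℝ) ≤ μ := by exact_mod_cast h
      rw [abs_le] at hd
      rw [abs_of_nonpos (by linarith), Nat.sub_eq_zero_of_le h, Nat.sub_zero,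
        Nat.cast_sub (by omega), Nat.cast_sub h]
      ring
  rw [e]
  ring

/-- Subtracting the step from the left limit to `g τ` leaves a function of size at most `2 * L * b /
n` on both windows, all of whose points are within `2 * b / n` of `τ`. The assumption `2 * b ≤ c *
n` keeps them in the two adjacent pieces. -/
lemma abs_windowDiff_add_jump_le (ht : IsPartition t) (hL : 0 ≤ L)
    (hg : ∀ l, ∀ s ∈ piece t l, ∀ s' ∈ piece t l, |g s - g s'| ≤ L * |s - s'|) {c : ℝ}
    (hsep : ∀ l : Fin (ι + 1), c ≤ t l.succ - t l.castSucc) (hn : 0 < n) (hbm : b ≤ m)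
    (hbc : 2 * (b : ℝ) ≤ c * n) (l : Fin ι)
    (hd : |(m : ℤ) - (changeIndex n (t l.succ.castSucc) : ℤ)| ≤ b) :
    |windowDiff (fun i => g ((i : ℝ) / n)) b m
      + (b - |(m : ℝ) - changeIndex n (t l.succ.castSucc)|)
        * (g (t l.succ.castSucc) - Function.leftLim g (t l.succ.castSucc))| ≤ 4 * L * b ^ 2 / n := by
  have hn' : (0 : ℝ) < n := by exact_mod_cast hn
  set τ := t l.succ.castSucc with hτ
  set μ := changeIndex n τ with hμ
  have hτ0 : 0 < τ := ht.pos l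
  have hμ1 : (μ : ℝ) < n * τ := changeIndex_lt hn hτ0
  have hμ2 : n * τ ≤ (μ : ℝ) + 1 := le_changeIndex_add_one hn hτ0
  have hleft : t l.castSucc.castSucc ≤ τ - c := by
    have := hsep l.castSucc
    rw [Fin.succ_castSucc] at this
    linarith
  have hright : τ + c ≤ t l.succ.succ := by linarith [hsep l.succ]
  have hlt : t l.castSucc.castSucc < τ := by
    rw [hτ, ← Fin.succ_castSucc]
    exact ht.strictMono (Fin.castSucc_lt_succ)
  have hlt' : τ < t l.succ.succ := ht.strictMono (Fin.castSucc_lt_succ)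
  rw [abs_le] at hd
  have hstep : ∀ i : ℕ, m + 1 ≤ i + b → i ≤ m + b →
      |g ((i : ℝ) / n) - (if i ≤ μ then Function.leftLim g τ else g τ)| ≤ L * (2 * b / n) := by
    intro i hi1 hi2
    have h1 : (μ : ℝ) + 1 ≤ i + 2 * b := by
      have : μ + 1 ≤ i + 2 * b := by omega
      exact_mod_cast this
    have h2 : (i : ℝ) ≤ μ + 2 * b := by
      have : i ≤ μ + 2 * b := by omega
      exact_mod_cast this
    split_ifs with h
    · rw [le_changeIndex hn hτ0] at h
      have h3 : τ - i / n ≤ 2 * b / n := by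
        rw [sub_le_iff_le_add, ← add_div, le_div_iff₀ hn']
        linarith
      have h4 : 2 * (b : ℝ) / n ≤ c := by rwa [div_le_iff₀ hn']
      refine (abs_sub_leftLim_le hlt hL (fun s hs s' hs' => hg l.castSucc s ?_ s' ?_)
        ⟨by linarith, h⟩).trans (mul_le_mul_of_nonneg_left h3 hL)
      · rw [piece, Fin.succ_castSucc]; exact hs
      · rw [piece, Fin.succ_castSucc]; exact hs'
    · rw [le_changeIndex hn hτ0, not_lt] at h
      have h3 : i / n - τ < 2 * b / n := by
        rw [sub_lt_iff_lt_add, div_lt_iff₀ hn', add_mul, div_mul_cancel₀ _ hn'.ne']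
        linarith
      have h4 : 2 * (b : ℝ) / n ≤ c := by rwa [div_le_iff₀ hn']
      refine (hg l.succ _ ⟨h, by linarith⟩ τ ⟨le_rfl, hlt'⟩).trans ?_
      rw [abs_of_nonneg (by linarith)]
      exact mul_le_mul_of_nonneg_left h3.le hL
  have hw : windowDiff (fun i => g ((i : ℝ) / n)) b m
      + (b - |(m : ℝ) - μ|) * (g τ - Function.leftLim g τ)
      = windowDiff (fun i => g ((i : ℝ) / n) - if i ≤ μ then Function.leftLim g τ else g τ) b m := by
    rw [← windowDiff_sub, sum_step_eq hbm (abs_le.2 hd)]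
    ring
  rw [hw, windowDiff]
  refine (Finset.abs_sum_le_sum_abs _ _).trans
    ((Finset.sum_le_sum (g := fun _ => L * (2 * b / n) + L * (2 * b / n)) fun i hi => ?_).trans
      (le_of_eq ?_))
  · have hib := Finset.mem_range.1 hi
    exact (abs_sub _ _).trans (add_le_add (hstep _ (by omega) (by omega))
      (hstep _ (by omega) (by omega)))
  · rw [Finset.sum_const, Finset.card_range, nsmul_eq_mul]; ring

end PiecewiseLipschitz

/-! ### Consistency of the detector for given small noise -/

open CausalModel in
/-- On the event that the noise is small, the detector finds the correct number of change points,
and locates them with an error of order `h ^ 2`. -/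
theorem IsDetectorOutput.consistent {p n ι : ℕ} {x : ℕ → Fin p → ℝ} {g : Fin p → Fin p → ℝ → ℝ}
    {t : Fin (ι + 2) → ℝ} {L c₁ c₂ B h : ℝ} {ihat : ℕ} {mhat : ℕ → ℕ} (ht : IsPartition t)
    (hL : 0 ≤ L) (hc₂ : 0 < c₂)
    (hlip : ∀ l, ∀ s ∈ piece t l, ∀ s' ∈ piece t l, ∀ j k, |g j k s - g j k s'| ≤ L * |s - s'|)
    (hsep : ∀ l : Fin (ι + 1), c₁ ≤ t l.succ - t l.castSucc)
    (hsize : ∀ l : Fin ι, c₂ ≤ maxNorm (Matrix.of fun j k =>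
      g j k (t l.succ.castSucc) - Function.leftLim (g j k) (t l.succ.castSucc)))
    (hB : ∀ j k, ∀ s ∈ Set.Icc (0 : ℝ) 1, |g j k s| ≤ B) (hB0 : 0 ≤ B) (hn : 0 < n)
    (hnoise : ∀ j k, ∀ l ≤ n, |∑ i ∈ Finset.range l, (x (i + 1) j * x (i + 1) k
      - g j k (((i + 1 : ℕ) : ℝ) / n))| < n * h ^ 2 / 8)
    (hh : 0 < h) (hBh : 8 * B ≤ n * h ^ 2) (hc₁h : 5 * h ≤ c₁) (h1 : h ≤ 1)
    (hc₂h : (10 * L + 3) * h ≤ c₂) (hι : 0 < ι → 1 ≤ n * h ^ 2)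
    (hch : 2 * (((8 * L + 1) / c₂ + 1) * h ^ 2) < c₁)
    (hdet : IsDetectorOutput x n h ((1 + L) * h ^ 2) ihat mhat) :
    ihat = ι ∧ locationError n mhat t ≤ ((8 * L + 1) / c₂ + 1) * h ^ 2 := by
  have hn' : (0 : ℝ) < n := by exact_mod_cast hn
  set b := ⌊h * n⌋₊ with hb
  have hbh : (b : ℝ) ≤ h * n := Nat.floor_le (by positivity)
  have hbn : (b : ℝ) / n ≤ h := by rwa [div_le_iff₀ hn']
  have hbn0 : 0 ≤ (b : ℝ) / n := by positivity
  have hbn2 : ((b : ℝ) / n) ^ 2 ≤ h ^ 2 := by gcongr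
  set pos : Fin ι → ℕ := fun l => changeIndex n (t l.succ.castSucc) with hposdef
  set v : ℕ → ℝ := fun m => maxNorm (localDiff x n b m) with hv
  -- the statistic is close to its expectation
  have hclose : ∀ m, b ≤ m → m + b ≤ n → ∀ j k, |localDiff x n b m j k
      - (n : ℝ)⁻¹ * windowDiff (fun i => g j k ((i : ℝ) / n)) b m| ≤ h ^ 2 / 2 := by
    intro m hbm hmn j k
    rw [localDiff_apply x hbm, ← mul_sub, windowDiff_sub, abs_mul, abs_of_pos (inv_pos.2 hn'),
      inv_mul_le_iff₀ hn']
    refine (abs_windowDiff_le hbm hmn fun l hl => (hnoise j k l hl).le).trans (le_of_eq ?_)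
    ring
  have hfar : ∀ m, b ≤ m → m + b ≤ n → (∀ l, (b : ℤ) ≤ |(m : ℤ) - (pos l : ℤ)|) →
      v m < (1 + L) * h ^ 2 := by
    intro m hbm hmn hno
    -- Smooth variation contributes `L * h ^ 2`, the pair that may reach time `1` contributes `h ^ 2
    -- / 4` and the noise `h ^ 2 / 2`; this stays strictly below the threshold.
    have h2 : v m ≤ L * h ^ 2 + 3 / 4 * h ^ 2 := by
      refine maxNorm_le (by positivity) fun j k => ?_
      have h3 := hclose m hbm hmn j k
      have h4 := abs_windowDiff_le_of_no_change ht hL (fun l s hs s' hs' => hlip l s hs s' hs' j k)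
        (hB j k) hn hbm hmn hno
      have h5 : |(n : ℝ)⁻¹ * windowDiff (fun i => g j k ((i : ℝ) / n)) b m|
          ≤ L * h ^ 2 + h ^ 2 / 4 := by
        rw [abs_mul, abs_of_pos (inv_pos.2 hn'), inv_mul_le_iff₀ hn']
        refine h4.trans ?_
        have e : L * (b : ℝ) ^ 2 / n = n * (L * ((b : ℝ) / n) ^ 2) := by field_simp
        rw [e, mul_add]
        exact add_le_add (by gcongr) (by linarith)
      have h6 := abs_sub_abs_le_abs_sub (localDiff x n b m j k)
        ((n : ℝ)⁻¹ * windowDiff (fun i => g j k ((i : ℝ) / n)) b m)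
      linarith
    nlinarith [sq_pos_of_pos hh]
  -- the statistic near a change point
  have hjump : ∀ (l : Fin ι) (m : ℕ), b ≤ m → m + b ≤ n → |(m : ℤ) - (pos l : ℤ)| ≤ b → ∀ j k,
      |localDiff x n b m j k + (b - |(m : ℝ) - pos l|) / n
        * (g j k (t l.succ.castSucc) - Function.leftLim (g j k) (t l.succ.castSucc))|
        ≤ 4 * L * h ^ 2 + h ^ 2 / 2 := by
    intro l m hbm hmn hd j k
    have h3 := hclose m hbm hmn j k
    have h4 := abs_windowDiff_add_jump_le ht hL (fun l s hs s' hs' => hlip l s hs s' hs' j k)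
        hsep hn hbm (c := c₁) (by nlinarith) l hd
    set w := windowDiff (fun i => g j k ((i : ℝ) / n)) b m
    set Δ := g j k (t l.succ.castSucc) - Function.leftLim (g j k) (t l.succ.castSucc)
    have h5 : |(n : ℝ)⁻¹ * (w + (b - |(m : ℝ) - pos l|) * Δ)| ≤ 4 * L * h ^ 2 := by
      rw [abs_mul, abs_of_pos (inv_pos.2 hn'), inv_mul_le_iff₀ hn']
      refine h4.trans ?_
      have e : 4 * L * (b : ℝ) ^ 2 / n = n * (4 * L * ((b : ℝ) / n) ^ 2) := by field_simp
      rw [e]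
      gcongr
    have e : localDiff x n b m j k + (b - |(m : ℝ) - pos l|) / n * Δ
        = (n : ℝ)⁻¹ * (w + (b - |(m : ℝ) - pos l|) * Δ)
          + (localDiff x n b m j k - (n : ℝ)⁻¹ * w) := by
      field_simp; ring
    rw [e]
    exact (abs_add_le _ _).trans (add_le_add h5 h3)
  -- positions of the change points
  have hτ : ∀ l : Fin ι, (pos l : ℝ) < n * t l.succ.castSucc ∧ n * t l.succ.castSucc ≤ pos l + 1 :=
    fun l => ⟨changeIndex_lt hn (ht.pos l), le_changeIndex_add_one hn (ht.pos l)⟩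
  have hnh : 0 < ι → 1 ≤ n * h := fun h0 => by nlinarith [hι h0, mul_pos hn' hh]
  have hpos_lower : ∀ l : Fin ι, b ≤ pos l := fun l => by
    have h2 := gap_le_sub ht.strictMono hsep (i := 0) (j := l.succ.castSucc)
      (by simp [Fin.lt_def])
    rw [ht.first] at h2
    have h3 : (b : ℝ) ≤ pos l := by nlinarith [hτ l, hnh (Fin.pos l)]
    exact_mod_cast h3
  have hpos_upper : ∀ l : Fin ι, pos l + 2 * b ≤ n := fun l => by
    have h2 := gap_le_sub ht.strictMono hsep (i := l.succ.castSucc) (j := Fin.last (ι + 1))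
      (by simp [Fin.lt_def])
    rw [ht.last] at h2
    have h3 : (pos l : ℝ) + 2 * b ≤ n := by nlinarith [hτ l, hnh (Fin.pos l)]
    exact_mod_cast h3
  have hb1 : 0 < ι → h / 2 ≤ (b : ℝ) / n := fun h0 => by
    have h2 : 1 ≤ b := Nat.le_floor (by simpa [mul_comm] using hnh h0)
    have h3 : (1 : ℝ) ≤ b := by exact_mod_cast h2
    have h4 : h * n < b + 1 := Nat.lt_floor_add_one _
    rw [le_div_iff₀ hn']
    linarith
  have hlarge : ∀ l : Fin ι, (1 + L) * h ^ 2 ≤ v (pos l) := fun l => by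
    have h2 : maxNorm (Matrix.of fun j k =>
        g j k (t l.succ.castSucc) - Function.leftLim (g j k) (t l.succ.castSucc))
        ≤ (h / 2)⁻¹ * (v (pos l) + (4 * L * h ^ 2 + h ^ 2 / 2)) := by
      have hv0 : 0 ≤ v (pos l) := Real.iSup_nonneg fun _ => abs_nonneg _
      refine maxNorm_le (by positivity) fun j k => ?_
      rw [Matrix.of_apply, ← div_eq_inv_mul, le_div_iff₀ (by positivity)]
      have h3 := hjump l (pos l) (hpos_lower l) (by have := hpos_upper l; omega) (by simp) j k
      set Δ := g j k (t l.succ.castSucc) - Function.leftLim (g j k) (t l.succ.castSucc)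
      rw [sub_self, abs_zero, sub_zero] at h3
      have h4 := abs_le_maxNorm (localDiff x n b (pos l)) j k
      have h5 : |(b : ℝ) / n * Δ| ≤ v (pos l) + (4 * L * h ^ 2 + h ^ 2 / 2) := by
        have h6 := abs_sub_abs_le_abs_sub ((b : ℝ) / n * Δ) (-localDiff x n b (pos l) j k)
        rw [abs_neg, sub_neg_eq_add, add_comm (_ * _)] at h6
        linarith
      rw [abs_mul, abs_of_nonneg hbn0] at h5
      refine le_trans ?_ h5
      rw [mul_comm]
      exact mul_le_mul_of_nonneg_right (hb1 (Fin.pos l)) (abs_nonneg _)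
    -- Hence `v (pos l) ≥ c₂ * h / 2 - (4 * L + 1 / 2) * h ^ 2`, and `(10 * L + 3) * h ≤ c₂` makes
    -- this at least `(1 + L) * h ^ 2`.
    have h3 := (hsize l).trans h2
    rw [← div_eq_inv_mul, le_div_iff₀ (by positivity)] at h3
    nlinarith
  have hsep' : ∀ l l', l ≠ l' → 4 * (b : ℤ) ≤ |(pos l : ℤ) - (pos l' : ℤ)| := by
    have key : ∀ l l' : Fin ι, l < l' → pos l + 4 * b ≤ pos l' := fun l l' hll => by
      have h2 := gap_le_sub ht.strictMono hsep (i := l.succ.castSucc) (j := l'.succ.castSucc)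
        (by simpa)
      -- Rounding to the grid costs at most `1 ≤ n * h`, which is why the gap assumed is `5 * h`
      -- rather than `4 * h`.
      have h3 : (pos l : ℝ) + 4 * b ≤ pos l' := by nlinarith [hτ l, hτ l', hnh (Fin.pos l)]
      exact_mod_cast h3
    intro l l' hne
    rw [le_abs]
    rcases lt_or_gt_of_ne hne with h | h
    · have := key _ _ h; omega
    · have := key _ _ h; omega
  obtain ⟨hιhat, σ, hσ⟩ := exists_perm_of_search (v := v) hdet.mem hdet.argmax hdet.continues
    hdet.stops
    (fun m hbm hmn hm => by
      by_contra! hno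
      rcases Nat.le_total (m + b) n with h | h
      · exact absurd (hfar m hbm h hno) (not_lt.2 hm)
      -- The grid bound `n - b` is a truncated subtraction; `h ≤ 1` excludes `b > n`.
      · have hm0 : b ≤ n := by
          have : (b : ℝ) ≤ n := by nlinarith
          exact_mod_cast this
        exact absurd (hfar m hbm (by omega) hno) (not_lt.2 hm))
    (fun l => ⟨hpos_lower l, by have := hpos_upper l; omega, hlarge l⟩) hsep'
  refine ⟨hιhat, locationError_le ht.strictMono hsep (by positivity) hch σ fun l => ?_⟩
  obtain ⟨h2, h3⟩ := hσ l
  have hup := hpos_upper l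
  set m := mhat (σ l) with hm
  have hmem : m ∈ searchGrid n b mhat (σ l) := hdet.mem _ (by omega)
  have hbm : b ≤ m := (mem_searchGrid.1 hmem).1.1
  have hmn : m + b ≤ n := by rw [abs_lt] at h2; omega
  have hdb : |(m : ℝ) - pos l| ≤ b := by exact_mod_cast h2.le
  have hdn : 0 ≤ (b - |(m : ℝ) - pos l|) / n := div_nonneg (by linarith) hn'.le
  set J := maxNorm (Matrix.of fun j k =>
    g j k (t l.succ.castSucc) - Function.leftLim (g j k) (t l.succ.castSucc)) with hJ
  have hJ0 : 0 ≤ J := hc₂.le.trans (hsize l)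
  have hvm : v m ≤ (b - |(m : ℝ) - pos l|) / n * J + (4 * L * h ^ 2 + h ^ 2 / 2) := by
    refine maxNorm_le (by positivity) fun j k => ?_
    have h4 := hjump l m hbm hmn h2.le j k
    have h5 := abs_le_maxNorm (Matrix.of fun j k =>
      g j k (t l.succ.castSucc) - Function.leftLim (g j k) (t l.succ.castSucc)) j k
    rw [Matrix.of_apply] at h5
    set Δ := g j k (t l.succ.castSucc) - Function.leftLim (g j k) (t l.succ.castSucc)
    have h6 := abs_sub_abs_le_abs_sub (localDiff x n b m j k)
      (-((b - |(m : ℝ) - pos l|) / n * Δ))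
    rw [abs_neg, sub_neg_eq_add, abs_mul, abs_of_nonneg hdn] at h6
    have h7 := mul_le_mul_of_nonneg_left h5 hdn
    linarith
  have hJm : (b : ℝ) / n * J ≤ v (pos l) + (4 * L * h ^ 2 + h ^ 2 / 2) := by
    have hbpos : 0 < (b : ℝ) / n := lt_of_lt_of_le (by positivity) (hb1 (Fin.pos l))
    rw [mul_comm, ← le_div_iff₀ hbpos]
    have hv0 : 0 ≤ v (pos l) := Real.iSup_nonneg fun _ => abs_nonneg _
    refine maxNorm_le (by positivity) fun j k => ?_
    rw [Matrix.of_apply, le_div_iff₀ hbpos]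
    have h4 := hjump l (pos l) (hpos_lower l) (by omega) (by simp) j k
    set Δ := g j k (t l.succ.castSucc) - Function.leftLim (g j k) (t l.succ.castSucc)
    rw [sub_self, abs_zero, sub_zero] at h4
    have h5 := abs_le_maxNorm (localDiff x n b (pos l)) j k
    have h6 := abs_sub_abs_le_abs_sub ((b : ℝ) / n * Δ) (-localDiff x n b (pos l) j k)
    rw [abs_neg, sub_neg_eq_add, add_comm (_ * _), abs_mul, abs_of_nonneg hbn0] at h6
    linarith
  -- The estimate beats the change point, `v (pos l) ≤ v m`. In the upper bound for `v m` and the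
  -- lower bound for `v (pos l)` the terms `b / n * J` cancel, leaving twice the error `(4 * L + 1 /
  -- 2) * h ^ 2`.
  have hd1 : |(m : ℝ) - pos l| / n * c₂ ≤ (8 * L + 1) * h ^ 2 := by
    have h4 : |(m : ℝ) - pos l| / n * c₂ ≤ |(m : ℝ) - pos l| / n * J :=
      mul_le_mul_of_nonneg_left (hsize l) (by positivity)
    rw [sub_div, sub_mul] at hvm
    linarith
  have hd2 : |(m : ℝ) - pos l| / n ≤ (8 * L + 1) / c₂ * h ^ 2 := by
    rw [div_mul_eq_mul_div, le_div_iff₀ hc₂]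
    exact hd1
  have e : (m : ℝ) / n - t l.succ.castSucc
      = ((m : ℝ) - pos l) / n + ((pos l : ℝ) - n * t l.succ.castSucc) / n := by
    field_simp; ring
  rw [e, add_mul, one_mul]
  refine (abs_add_le _ _).trans (add_le_add ?_ ?_)
  · rwa [abs_div, abs_of_pos hn']
  -- Rounding a change point to the grid costs at most `1 / n ≤ h ^ 2`; this is the `+ 1` in the
  -- constant.
  · rw [abs_div, abs_of_pos hn', div_le_iff₀ hn', mul_comm, abs_le]
    have := hι (Fin.pos l)
    constructor <;> linarith [hτ l]

/-! ### Calibration of the bandwidth and the probability of large noise -/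

lemma varpi_nonneg (q A : ℝ) (n : ℕ) : 0 ≤ varpi q A n := by
  have := Real.log_natCast_nonneg n
  unfold varpi
  split_ifs <;> positivity

/-- The two terms of the bandwidth are calibrated so that both terms of the tail bound simplify. -/
lemma exists_calibration {N n l : ℝ} (hN : 0 < N) (hn : 0 < n) (hl : 0 ≤ l) :
    ∃ v w : ℝ, v = N ^ (1 / 3 : ℝ) * n ^ (-(1 / 6) : ℝ) * l ^ (1 / 6 : ℝ) ∧
      w = (n * l ^ 2 / N ^ 2) ^ (1 / 3 : ℝ) ∧ 0 ≤ v ∧ 0 ≤ w ∧ v ^ 6 = N ^ 2 / n * l ∧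
      n * v ^ 4 = N ^ 2 * w ∧ w * v ^ 2 = l := by
  set v := N ^ (1 / 3 : ℝ) * n ^ (-(1 / 6) : ℝ) * l ^ (1 / 6 : ℝ) with hv
  set w := (n * l ^ 2 / N ^ 2) ^ (1 / 3 : ℝ) with hw
  have hv0 : 0 ≤ v := by positivity
  have hw0 : 0 ≤ w := by positivity
  have hv6 : v ^ 6 = N ^ 2 / n * l := by
    have e1 : (N ^ (1 / 3 : ℝ)) ^ 6 = N ^ 2 := by
      rw [← Real.rpow_natCast, ← Real.rpow_mul hN.le, ← Real.rpow_natCast]; norm_num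
    have e2 : (n ^ (-(1 / 6) : ℝ)) ^ 6 = n⁻¹ := by
      rw [← Real.rpow_natCast, ← Real.rpow_mul hn.le, ← Real.rpow_neg_one]; norm_num
    have e3 : (l ^ (1 / 6 : ℝ)) ^ 6 = l := by
      rw [← Real.rpow_natCast, ← Real.rpow_mul hl]; norm_num
    rw [hv, mul_pow, mul_pow, e1, e2, e3, div_eq_mul_inv]
  have hw3 : w ^ 3 = n * l ^ 2 / N ^ 2 := by
    rw [hw, ← Real.rpow_natCast, ← Real.rpow_mul (by positivity)]; norm_num
  refine ⟨v, w, rfl, rfl, hv0, hw0, hv6, ?_, ?_⟩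
  · rw [← pow_left_inj₀ (by positivity) (by positivity) (three_ne_zero)]
    have e : (n * v ^ 4) ^ 3 = n ^ 3 * (v ^ 6) ^ 2 := by ring
    rw [e, hv6, mul_pow (N ^ 2) w, hw3]
    field_simp
  · rw [← pow_left_inj₀ (by positivity) (by positivity) (three_ne_zero)]
    have e : (w * v ^ 2) ^ 3 = w ^ 3 * v ^ 6 := by ring
    rw [e, hv6, hw3]
    field_simp

namespace CausalModel

variable {Ω : Type*} [mΩ : MeasurableSpace Ω] {P : Measure Ω} {p : ℕ} (M : CausalModel Ω P p)

/-- The event that some partial sum of the centred products is not small. -/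
def noiseEvent (n : ℕ) (h : ℝ) : Set Ω :=
  {ω | ∃ j k, ∃ l ≤ n, n * h ^ 2 / 8 ≤ |∑ i ∈ Finset.range l,
    (M.obs n ω (i + 1) j * M.obs n ω (i + 1) k - M.cov j k (((i + 1 : ℕ) : ℝ) / n))|}

lemma MX_nonneg (q A : ℝ) : 0 ≤ M.MX q A :=
  Real.rpow_nonneg (Finset.sum_nonneg fun _ _ => Real.rpow_nonneg ENNReal.toReal_nonneg _) _

lemma MX_rpow {q : ℝ} (hq : q ≠ 0) (A : ℝ) :
    M.MX q A ^ q = ∑ j, (M.dan (2 * q) A j).toReal ^ q := by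
  rw [MX, ← Real.rpow_mul (Finset.sum_nonneg fun _ _ => Real.rpow_nonneg ENNReal.toReal_nonneg _),
    one_div_mul_cancel hq, Real.rpow_one]

lemma J_nonneg (q A : ℝ) (n : ℕ) : 0 ≤ M.J q A n :=
  mul_nonneg (M.MX_nonneg q A) (Real.rpow_nonneg (mul_nonneg (by positivity) (varpi_nonneg _ _ _)) _)

lemma J_div_rpow {q : ℝ} (hq : q ≠ 0) (A : ℝ) (n : ℕ) :
    ((n : ℝ)⁻¹ * M.J q A n) ^ q = (p * varpi q A n * M.MX q A ^ q) / (n : ℝ) ^ q := by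
  have hv := varpi_nonneg q A n
  rw [Real.mul_rpow (by positivity) (M.J_nonneg q A n), J, Real.mul_rpow (M.MX_nonneg q A)
    (by positivity), ← Real.rpow_mul (by positivity), one_div_mul_cancel hq, Real.rpow_one,
    Real.inv_rpow (by positivity)]
  ring

/-- Summing over pairs repeats each coordinate `p` times per slot, whence the factor `p` in `J`. -/
lemma sum_dan_rpow_le {q : ℝ} (hq : 0 < q) (A : ℝ) :
    ∑ x : Fin p × Fin p, ((M.dan (2 * q) A x.1).toReal + (M.dan (2 * q) A x.2).toReal) ^ q
      ≤ 2 * 2 ^ q * (p * M.MX q A ^ q) := by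
  set d : Fin p → ℝ := fun j => (M.dan (2 * q) A j).toReal with hd
  have hd0 : ∀ j, 0 ≤ d j := fun j => ENNReal.toReal_nonneg
  have h1 : ∀ j k, (d j + d k) ^ q ≤ 2 ^ q * (d j ^ q + d k ^ q) := fun j k => by
    rcases le_total (d j) (d k) with h | h
    · calc (d j + d k) ^ q ≤ (2 * d k) ^ q :=
            Real.rpow_le_rpow (add_nonneg (hd0 j) (hd0 k)) (by linarith) hq.le
        _ = 2 ^ q * d k ^ q := Real.mul_rpow (by norm_num) (hd0 k)
        _ ≤ _ := by
          gcongr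
          exact le_add_of_nonneg_left (Real.rpow_nonneg (hd0 j) q)
    · calc (d j + d k) ^ q ≤ (2 * d j) ^ q :=
            Real.rpow_le_rpow (add_nonneg (hd0 j) (hd0 k)) (by linarith) hq.le
        _ = 2 ^ q * d j ^ q := Real.mul_rpow (by norm_num) (hd0 j)
        _ ≤ _ := by
          gcongr
          exact le_add_of_nonneg_right (Real.rpow_nonneg (hd0 k) q)
  refine (Finset.sum_le_sum fun x _ => h1 x.1 x.2).trans (le_of_eq ?_)
  rw [← Finset.mul_sum, Finset.sum_add_distrib, Fintype.sum_prod_type, Fintype.sum_prod_type,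
    M.MX_rpow hq.ne']
  simp only [Finset.sum_const, Finset.card_univ, Fintype.card_fin, nsmul_eq_mul, ← Finset.mul_sum]
  ring

lemma bandwidth_terms_le {q A a₁ a₂ : ℝ} (ha₁ : 0 ≤ a₁) (ha₂ : 0 ≤ a₂) (n : ℕ) :
    a₁ * ((n : ℝ)⁻¹ * M.J q A n) ^ (1 / 3 : ℝ) ≤ M.bandwidth q A a₁ a₂ n ∧
    a₂ * (M.NX A ^ (1 / 3 : ℝ) * (n : ℝ) ^ (-(1 / 6) : ℝ) * Real.log p ^ (1 / 6 : ℝ))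
      ≤ M.bandwidth q A a₁ a₂ n := by
  have hN : 0 ≤ M.NX A := ENNReal.toReal_nonneg
  have hJ := M.J_nonneg q A n
  have hl := Real.log_natCast_nonneg p
  unfold bandwidth
  constructor
  · exact le_add_of_nonneg_right (by positivity)
  · rw [← mul_assoc, ← mul_assoc]
    exact le_add_of_nonneg_left (by positivity)

/-- The maximal inequality at level `n * h ^ 2` and a union bound over the pairs. With `u = J / n`,
the polynomial terms total a multiple of `u ^ q / h ^ (2 * q)`, and `h ≥ a₁ * u ^ (1 / 3)` reduces
this to a multiple of `u ^ (q / 3)`. With `v` the factor of `a₂` in the bandwidth, `h ≥ a₂ * v` and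
`n * v ^ 4 = N ^ 2 * w` turn the Gaussian exponent into a multiple of `w`. -/
theorem _root_.ChangePoint.exists_measure_noiseEvent_le {q A a₁ a₂ : ℝ} (hq : 2 < q) (hA : 0 < A)
    (ha₁ : 0 < a₁) (ha₂ : 0 < a₂) : ∃ K : ℝ, 1 ≤ K ∧
    ∀ {Ω : Type*} [MeasurableSpace Ω] (P : Measure Ω) [IsProbabilityMeasure P] {p : ℕ}
      (M : CausalModel Ω P p) (κ : ℝ) (_ : 0 < κ)
      (_ : ∀ t ∈ Set.Icc (0 : ℝ) 1, ∀ j : Fin p,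
        eLpNorm (fun ω => M.X 0 t ω j) (ENNReal.ofReal (2 * q)) P ≤ ENNReal.ofReal κ)
      (_ : M.maxDan (2 * q) A ≠ ⊤) (n : ℕ) (_ : 3 ≤ n) (_ : 0 < M.bandwidth q A a₁ a₂ n)
      (_ : 0 < M.NX A),
      P.real (M.noiseEvent n (M.bandwidth q A a₁ a₂ n))
        ≤ K * (κ ^ q * ((p * varpi q A n * M.MX q A ^ q) / (n : ℝ) ^ q) ^ (1 / 3 : ℝ)
          + p ^ 2 * Real.exp (-(((n : ℝ) * Real.log p ^ 2 / M.NX A ^ 2) ^ (1 / 3 : ℝ)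
            / (K * κ ^ 2)))) := by
  obtain ⟨C, hC, hmain⟩ := exists_measure_products_le hq hA
  have hC0 : 0 < C := by linarith
  set K₁ := C * (2 * 32 ^ q) * (a₁ ^ (2 * q))⁻¹ with hK₁
  set K₂ := 1024 * C / a₂ ^ 4 with hK₂
  have hK₁0 : 0 ≤ K₁ := by positivity
  have hK₂0 : 0 < K₂ := by positivity
  refine ⟨1 + K₁ + C + K₂, by linarith, ?_⟩
  intro Ω mΩ P _ p M κ hκ hmom hdep n hn hh hN
  have hn' : (0 : ℝ) < n := by positivity
  set h := M.bandwidth q A a₁ a₂ n with hh_def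
  set N := M.NX A with hN_def
  -- The maximal inequality bounds deviations of size `2 * y`, which is the level `n * h ^ 2 / 8` of
  -- `noiseEvent`.
  set y := n * h ^ 2 / 16 with hy
  have hy0 : 0 < y := by positivity
  have hϖ := varpi_nonneg q A n
  have hMX := M.MX_nonneg q A
  obtain ⟨hu, hv⟩ := M.bandwidth_terms_le (q := q) (A := A) ha₁.le ha₂.le n
  set u := (n : ℝ)⁻¹ * M.J q A n with hu_def
  have hu0 : 0 ≤ u := mul_nonneg (by positivity) (M.J_nonneg q A n)
  have huq : u ^ q = (p * varpi q A n * M.MX q A ^ q) / (n : ℝ) ^ q := M.J_div_rpow (by linarith) A n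
  obtain ⟨v, w, hvdef, hwdef, hv0, hw0, -, hnv, -⟩ := exists_calibration hN hn'
    (Real.log_natCast_nonneg p)
  rw [← hvdef] at hv
  rw [← hwdef, ← huq]
  -- the polynomial term
  have hpoly : u ^ q / h ^ (2 * q) ≤ (a₁ ^ (2 * q))⁻¹ * (u ^ q) ^ (1 / 3 : ℝ) := by
    rcases hu0.eq_or_lt with h0 | h0
    · rw [← h0, Real.zero_rpow (by linarith), zero_div]
      positivity
    · have h1 : a₁ ^ (2 * q) * u ^ (2 * q / 3) ≤ h ^ (2 * q) := by
        have := Real.rpow_le_rpow (by positivity) hu (by linarith : 0 ≤ 2 * q)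
        rw [Real.mul_rpow ha₁.le (by positivity), ← Real.rpow_mul hu0] at this
        rwa [show 1 / 3 * (2 * q) = 2 * q / 3 by ring] at this
      rw [div_le_iff₀ (by positivity), ← Real.rpow_mul hu0]
      have h2 : u ^ q = (a₁ ^ (2 * q))⁻¹ * u ^ (q * (1 / 3)) * (a₁ ^ (2 * q) * u ^ (2 * q / 3)) := by
        have h3 : u ^ q = u ^ (q * (1 / 3)) * u ^ (2 * q / 3) := by
          rw [← Real.rpow_add h0]; congr 1; ring
        rw [h3]
        field_simp
      rw [h2]
      gcongr
  -- the exponential term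
  have hexp : w / (K₂ * κ ^ 2) ≤ y ^ 2 / (C * (n * (2 * κ * N) ^ 2)) := by
    have h1 : a₂ ^ 4 * (N ^ 2 * w) ≤ n * h ^ 4 := by
      rw [← hnv]
      have : (a₂ * v) ^ 4 ≤ h ^ 4 := by gcongr
      rw [mul_pow] at this
      nlinarith
    rw [hK₂, hy, div_le_div_iff₀ (by positivity) (by positivity)]
    have e1 : w * (C * (n * (2 * κ * N) ^ 2)) = a₂ ^ 4 * (N ^ 2 * w) * (4 * C * n * κ ^ 2 / a₂ ^ 4) := by
      field_simp; ring
    have e2 : (n * h ^ 2 / 16) ^ 2 * (1024 * C / a₂ ^ 4 * κ ^ 2)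
        = n * h ^ 4 * (4 * C * n * κ ^ 2 / a₂ ^ 4) := by
      field_simp; ring
    rw [e1, e2]
    gcongr
  have hsub : M.noiseEvent n h ⊆ ⋃ x : Fin p × Fin p, {ω | ∃ l ≤ n, 2 * y ≤ |∑ i ∈ Finset.range l,
      (M.obs n ω (i + 1) x.1 * M.obs n ω (i + 1) x.2 - M.cov x.1 x.2 (((i + 1 : ℕ) : ℝ) / n))|} := by
    rintro ω ⟨j, k, l, hl, hle⟩
    refine Set.mem_iUnion.2 ⟨(j, k), l, hl, le_trans (le_of_eq ?_) hle⟩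
    rw [hy]; ring
  calc P.real (M.noiseEvent n h) ≤ _ := measureReal_mono hsub
    _ ≤ _ := measureReal_iUnion_fintype_le _
    _ ≤ ∑ x : Fin p × Fin p, (C * varpi q A n * κ ^ q / y ^ q
          * ((M.dan (2 * q) A x.1).toReal + (M.dan (2 * q) A x.2).toReal) ^ q
          + C * Real.exp (-(w / (K₂ * κ ^ 2)))) := by
        refine Finset.sum_le_sum fun x _ => ?_
        refine (hmain P M κ hκ.le hmom hdep x.1 x.2 n hn y hy0).trans ?_
        rw [mul_add, Real.mul_rpow hκ.le (add_nonneg ENNReal.toReal_nonneg ENNReal.toReal_nonneg)]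
        refine add_le_add (le_of_eq (by ring)) ?_
        gcongr
    _ = C * varpi q A n * κ ^ q / y ^ q
          * ∑ x : Fin p × Fin p, ((M.dan (2 * q) A x.1).toReal + (M.dan (2 * q) A x.2).toReal) ^ q
          + C * (p ^ 2 * Real.exp (-(w / (K₂ * κ ^ 2)))) := by
        rw [Finset.sum_add_distrib, ← Finset.mul_sum, Finset.sum_const, Finset.card_univ,
          Fintype.card_prod, Fintype.card_fin, nsmul_eq_mul]
        push_cast
        ring
    _ ≤ C * varpi q A n * κ ^ q / y ^ q * (2 * 2 ^ q * (p * M.MX q A ^ q))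
          + C * (p ^ 2 * Real.exp (-(w / (K₂ * κ ^ 2)))) := by
        gcongr
        exact M.sum_dan_rpow_le (by linarith) A
    _ = C * (2 * 32 ^ q) * κ ^ q * (u ^ q / h ^ (2 * q))
          + C * (p ^ 2 * Real.exp (-(w / (K₂ * κ ^ 2)))) := by
        have e1 : y ^ q = n ^ q * h ^ (2 * q) / 16 ^ q := by
          rw [hy, Real.div_rpow (by positivity) (by norm_num), Real.mul_rpow hn'.le (by positivity),
            Real.rpow_mul hh.le, Real.rpow_two]
        have e2 : (32 : ℝ) ^ q = 2 ^ q * 16 ^ q := by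
          rw [← Real.mul_rpow (by norm_num) (by norm_num)]; norm_num
        rw [e1, e2, huq]
        field_simp
    _ ≤ C * (2 * 32 ^ q) * κ ^ q * ((a₁ ^ (2 * q))⁻¹ * (u ^ q) ^ (1 / 3 : ℝ))
          + C * (p ^ 2 * Real.exp (-(w / (K₂ * κ ^ 2)))) := by
        gcongr
    _ = K₁ * (κ ^ q * (u ^ q) ^ (1 / 3 : ℝ)) + C * (p ^ 2 * Real.exp (-(w / (K₂ * κ ^ 2)))) := by
        rw [hK₁]; ring
    _ ≤ (1 + K₁ + C + K₂) * (κ ^ q * (u ^ q) ^ (1 / 3 : ℝ))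
          + (1 + K₁ + C + K₂) * (p ^ 2 * Real.exp (-(w / ((1 + K₁ + C + K₂) * κ ^ 2)))) := by
        gcongr <;> linarith
    _ = _ := by ring

lemma eLpNorm_X_le {q : ℝ} (hq : 0 < q) {ν : ENNReal} (hν : ν ≠ ⊤) (h : M.momentSup q ≤ ν)
    {t : ℝ} (ht : t ∈ Set.Icc (0 : ℝ) 1) (j : Fin p) :
    eLpNorm (fun ω => M.X 0 t ω j) (ENNReal.ofReal (2 * q)) P
      ≤ ENNReal.ofReal (ν.toReal ^ (1 / (2 * q))) := by
  have h2q : 0 < 2 * q := by linarith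
  rw [eLpNorm_eq_lintegral_rpow_enorm_toReal (by simpa using hq) ENNReal.ofReal_ne_top,
    ENNReal.toReal_ofReal h2q.le, ← ENNReal.ofReal_rpow_of_nonneg ENNReal.toReal_nonneg
      (by positivity), ENNReal.ofReal_toReal hν]
  refine ENNReal.rpow_le_rpow ?_ (by positivity)
  refine le_trans (le_trans (le_of_eq ?_) (le_iSup₂_of_le t ht (le_iSup_of_le j le_rfl))) h
  refine lintegral_congr fun ω => ?_
  rw [Real.enorm_eq_ofReal_abs, ENNReal.ofReal_rpow_of_nonneg (abs_nonneg _) h2q.le]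

lemma MX_eq_zero {q A : ℝ} (hq : 0 < q) (h : M.maxDan (2 * q) A = 0) : M.MX q A = 0 := by
  have h1 : ∀ j, M.dan (2 * q) A j = 0 := fun j =>
    le_antisymm ((le_iSup (fun j => M.dan (2 * q) A j) j).trans h.le) bot_le
  rw [MX, Finset.sum_eq_zero fun j _ => by rw [h1 j, ENNReal.toReal_zero, Real.zero_rpow hq.ne'],
    Real.zero_rpow (by positivity)]

/-- If `N_X` vanishes, all coupling differences are zero almost surely, hence in every `L^a`, and
`M_X` vanishes too. A positive bandwidth therefore forces `N_X > 0`. -/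
lemma bandwidth_eq_zero [IsProbabilityMeasure P] {q A : ℝ} (hq : 2 < q) (h : M.maxDan 4 A ≠ ⊤) (hN : M.NX A = 0)
    (a₁ a₂ : ℝ) (n : ℕ) : M.bandwidth q A a₁ a₂ n = 0 := by
  have h4 : M.maxDan 4 A = 0 := ((ENNReal.toReal_eq_zero_iff _).1 hN).resolve_right h
  have h1 : ∀ j m, M.depMeasure 4 j m = 0 := fun j m => by
    have h2 : ENNReal.ofReal ((((0 : ℕ) : ℝ) + 1) ^ A) * ∑' i : ℕ, M.depMeasure 4 j (0 + i)
        ≤ M.maxDan 4 A :=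
      (le_iSup (fun m : ℕ => ENNReal.ofReal (((m : ℝ) + 1) ^ A)
        * ∑' i : ℕ, M.depMeasure 4 j (m + i)) 0).trans (le_iSup (fun j => M.dan 4 A j) j)
    rw [h4] at h2
    simp at h2
    exact h2 m
  have h2 : ∀ j m, M.depMeasure (2 * q) j m = 0 := fun j m => by
    have h3 := h1 j m
    simp only [depMeasure, ENNReal.iSup_eq_zero] at h3 ⊢
    intro t ht
    have hm : AEStronglyMeasurable (fun ω => M.X 0 t ω j - M.XCoupled 0 m t ω j) P :=
      ((M.measurable_X_apply 0 t j).sub (M.measurable_XCoupled_apply 0 m t j)).aestronglyMeasurable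
    rw [eLpNorm_eq_zero_iff hm (by simp; linarith)]
    exact (eLpNorm_eq_zero_iff hm (by simp)).1 (h3 t ht)
  have h5 : M.maxDan (2 * q) A = 0 := by simp [maxDan, dan, h2]
  rw [bandwidth, J, M.MX_eq_zero (by linarith) h5, hN]
  simp

/-- Together with `N_X > 0` it shows that `ν_{2q}` is positive, so that one may divide by it. -/
lemma NX_eq_zero_of_momentSup_eq_zero [IsProbabilityMeasure P] {q A : ℝ} (hq : 2 < q)
    (h : M.momentSup q = 0) : M.NX A = 0 := by
  have h1 : ∀ t ∈ Set.Icc (0 : ℝ) 1, ∀ j,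
      eLpNorm (fun ω => M.X 0 t ω j) (ENNReal.ofReal (2 * q)) P = 0 := fun t ht j => by
    have := M.eLpNorm_X_le (by linarith) (ENNReal.zero_ne_top) h.le ht j
    rw [ENNReal.toReal_zero, Real.zero_rpow (by positivity), ENNReal.ofReal_zero] at this
    exact le_antisymm this bot_le
  have h2 : ∀ j m, M.depMeasure (2 * q) j m = 0 := fun j m => by
    simp only [depMeasure, ENNReal.iSup_eq_zero]
    intro t ht
    have h3 := eLpNorm_sub_le (μ := P) (p := ENNReal.ofReal (2 * q))
      (M.measurable_X_apply 0 t j).aestronglyMeasurable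
      (M.measurable_XCoupled_apply 0 m t j).aestronglyMeasurable
      (by rw [← ENNReal.ofReal_one]; exact ENNReal.ofReal_le_ofReal (by linarith))
    rw [eLpNorm_XCoupled, h1 t ht j, add_zero] at h3
    exact le_antisymm h3 bot_le
  have h5 : M.maxDan (2 * q) A = 0 := by simp [maxDan, dan, h2]
  have h6 : M.maxDan 4 A = 0 := le_antisymm ((M.maxDan_mono (by linarith) A).trans h5.le) bot_le
  rw [NX, h6, ENNReal.toReal_zero]

end CausalModel

/-! ### From the noise event to the conclusion -/

lemma abs_leftLim_le {g : ℝ → ℝ} {a τ L B : ℝ} (haτ : a < τ) (hL : 0 ≤ L)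
    (hg : ∀ s ∈ Set.Ico a τ, ∀ s' ∈ Set.Ico a τ, |g s - g s'| ≤ L * |s - s'|)
    (hB : ∀ s ∈ Set.Ico a τ, |g s| ≤ B) : |Function.leftLim g τ| ≤ B := by
  refine le_of_forall_pos_le_add fun ε hε => ?_
  set s := max a (τ - ε / (L + 1)) with hs
  have hεL : 0 < ε / (L + 1) := by positivity
  have hmem : s ∈ Set.Ico a τ := ⟨le_max_left _ _, max_lt haτ (by linarith)⟩
  have h1 := abs_sub_leftLim_le haτ hL hg hmem
  have h2 : L * (τ - s) ≤ ε := by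
    have h3 : τ - s ≤ ε / (L + 1) := by linarith [le_max_right a (τ - ε / (L + 1))]
    rw [le_div_iff₀ (by positivity)] at h3
    nlinarith [hmem.2]
  have h4 := abs_sub_abs_le_abs_sub (Function.leftLim g τ) (g s)
  rw [abs_sub_comm] at h4
  linarith [hB s hmem]

lemma locationError_nonneg {ι : ℕ} (n : ℕ) (mhat : ℕ → ℕ) (t : Fin (ι + 2) → ℝ) :
    0 ≤ locationError n mhat t :=
  Real.iSup_nonneg fun _ => abs_nonneg _

/-- A crude bound for the finitely many indices that the asymptotic argument does not reach. -/
lemma IsDetectorOutput.locationError_le_one {p n ι : ℕ} {x : ℕ → Fin p → ℝ} {h thr : ℝ}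
    {mhat : ℕ → ℕ} (hdet : IsDetectorOutput x n h thr ι mhat) {t : Fin (ι + 2) → ℝ}
    (ht : CausalModel.IsPartition t) : locationError n mhat t ≤ 1 := by
  refine Real.iSup_le (fun j => ?_) zero_le_one
  have h1 := ht.mem_Ico j
  set s : Fin ι → ℝ := fun i => (mhat i : ℝ) / (n : ℝ) with hs
  have h2 : 0 ≤ s (Tuple.sort s j) ∧ s (Tuple.sort s j) ≤ 1 := by
    refine ⟨by positivity, div_le_one_of_le₀ ?_ (by positivity)⟩
    have := (mem_searchGrid.1 (hdet.mem _ (Tuple.sort s j).2)).1.2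
    exact_mod_cast this.trans (Nat.sub_le _ _)
  have h3 : orderedEstimate n ι mhat j = s (Tuple.sort s j) := rfl
  rw [h3, abs_le]
  constructor <;> linarith [h1.1, h1.2]

namespace CausalModel

variable {Ω : Type*} [mΩ : MeasurableSpace Ω] {P : Measure Ω} [IsProbabilityMeasure P] {p : ℕ}
  (M : CausalModel Ω P p)

/-- The link between probability and the deterministic result is that `N_X² log p` is at most a
constant times `n h²`: the second summand of the bandwidth has sixth power of order `N_X² log p /
n`, and `h ^ 6 ≤ h ^ 2`. With `log p` large, `n h²` exceeds the `N_X²` that bounds the covariances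
by the required factor. -/
lemma consistent_of_notMem_noiseEvent {ι n : ℕ} {t : Fin (ι + 2) → ℝ}
    {q A L₀ L c₁ c₂ a₁ a₂ h : ℝ} (hL : 0 ≤ L) (hc₂ : 0 < c₂) (ha₁ : 0 ≤ a₁) (ha₂ : 0 < a₂)
    (hdep : M.maxDan 4 A ≠ ⊤) (hpls : M.IsPLS t L₀) (hlip : M.CovLipschitz t L)
    (hjump : M.SeparatedSizeable t c₁ c₂) (hh : h = M.bandwidth q A a₁ a₂ n) (hh0 : 0 < h)
    (hn : 0 < n) (hN : 0 < M.NX A) (h1 : h ≤ 1) (hc₁h : 5 * h ≤ c₁)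
    (hc₂h : (10 * L + 3) * h ≤ c₂) (hch : 2 * (((8 * L + 1) / c₂ + 1) * h ^ 2) < c₁)
    (hp1 : 8 ≤ a₂ ^ 6 * Real.log p) (hp2 : 2 ≤ a₂ ^ 6 * c₂ * Real.log p) {ω : Ω}
    (hω : ω ∉ M.noiseEvent n h) {ihat : ℕ} {mhat : ℕ → ℕ}
    (hdet : IsDetectorOutput (M.obs n ω) n h ((1 + L) * h ^ 2) ihat mhat) :
    ihat = ι ∧ locationError n mhat t ≤ ((8 * L + 1) / c₂ + 1) * h ^ 2 := by
  have hn' : (0 : ℝ) < n := by exact_mod_cast hn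
  have hB : ∀ j k, ∀ s ∈ Set.Icc (0 : ℝ) 1, |M.cov j k s| ≤ M.NX A ^ 2 := fun j k s hs =>
    M.abs_cov_le_NX_sq hdep hs (hpls.mean_zero s hs) j k
  obtain ⟨v, w, hvdef, -, hv0, -, hv6, -, -⟩ := exists_calibration hN hn'
    (Real.log_natCast_nonneg p)
  have hv : a₂ * v ≤ h := by
    rw [hh, hvdef]; exact (M.bandwidth_terms_le ha₁ ha₂.le n).2
  have h6 : a₂ ^ 6 * (M.NX A ^ 2 / n * Real.log p) ≤ h ^ 2 := by
    rw [← hv6, ← mul_pow]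
    calc (a₂ * v) ^ 6 ≤ h ^ 6 := by gcongr
      _ ≤ h ^ 2 := pow_le_pow_of_le_one hh0.le h1 (by norm_num)
  have h7 : M.NX A ^ 2 * (a₂ ^ 6 * Real.log p) ≤ n * h ^ 2 := by
    have e : a₂ ^ 6 * (M.NX A ^ 2 / n * Real.log p) = M.NX A ^ 2 * (a₂ ^ 6 * Real.log p) / n := by
      ring
    rw [e, div_le_iff₀ hn'] at h6
    linarith
  have hN2 : 0 ≤ M.NX A ^ 2 := by positivity
  refine IsDetectorOutput.consistent (g := M.cov) (B := M.NX A ^ 2) hpls.partition hL hc₂ hlip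
    hjump.separated hjump.sizeable hB hN2 hn (fun j k l hl => ?_) hh0 (by nlinarith) hc₁h h1 hc₂h
    (fun hι => ?_) hch hdet
  · by_contra! hle
    exact hω ⟨j, k, l, hl, hle⟩
  -- A jump is at most twice the bound on the covariances. If there is a change point, `N_X²` is
  -- thus bounded below, and `n * h ^ 2 ≥ 1` follows.
  · have hc : c₂ ≤ 2 * M.NX A ^ 2 := by
      refine (hjump.sizeable ⟨0, hι⟩).trans (maxNorm_le (by positivity) fun j k => ?_)
      set l : Fin ι := ⟨0, hι⟩
      have hmem := hpls.partition.mem_Ico l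
      have hmem' := hpls.partition.mem_Ico
      have hlt : t l.castSucc.castSucc < t l.succ.castSucc := by
        rw [← Fin.succ_castSucc]
        exact hpls.partition.strictMono (Fin.castSucc_lt_succ)
      have h0 : 0 ≤ t l.castSucc.castSucc := by
        rw [← hpls.partition.first]
        exact hpls.partition.strictMono.monotone (Fin.zero_le _)
      have h8 := abs_leftLim_le (g := M.cov j k) (B := M.NX A ^ 2) hlt hL
        (fun s hs s' hs' => hlip l.castSucc s (by rw [piece, Fin.succ_castSucc]; exact hs) s'
          (by rw [piece, Fin.succ_castSucc]; exact hs') j k)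
        (fun s hs => hB j k s ⟨h0.trans hs.1, (hs.2.trans hmem.2).le⟩)
      have h9 := hB j k _ ⟨hmem.1, hmem.2.le⟩
      rw [jump, Matrix.of_apply]
      refine (abs_sub _ _).trans ?_
      linarith
    have hlog : 0 < a₂ ^ 6 * Real.log p := by linarith
    nlinarith

end CausalModel

/-- The tail bound tends to zero as the bandwidth does. -/
lemma tendsto_rate {q a₁ a₂ c K κ : ℝ} (hq : 2 < q) (ha₁ : 0 < a₁) (ha₂ : 0 < a₂) (hc : 0 < c)
    {p : ℕ → ℕ} (hp : Tendsto p atTop atTop) {h u v w : ℕ → ℝ} (hh : Tendsto h atTop (𝓝 0))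
    (hu0 : ∀ k, 0 ≤ u k) (hu : ∀ k, a₁ * u k ^ (1 / 3 : ℝ) ≤ h k) (hh0 : ∀ k, 0 < h k)
    (hv : ∀ᶠ k in atTop, a₂ * v k ≤ h k ∧ 0 ≤ v k ∧ 0 ≤ w k ∧ w k * v k ^ 2 = Real.log (p k)) :
    Tendsto (fun k => K * (κ * (u k ^ q) ^ (1 / 3 : ℝ) + (p k : ℝ) ^ 2 * Real.exp (-(w k / c))))
      atTop (𝓝 0) := by
  have h1 : Tendsto (fun k => (u k ^ q) ^ (1 / 3 : ℝ)) atTop (𝓝 0) := by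
    have h2 : Tendsto (fun k => (h k / a₁) ^ q) atTop (𝓝 0) := by
      have := (hh.div_const a₁).rpow_const (p := q) (Or.inr (by linarith))
      simpa [Real.zero_rpow (by linarith : q ≠ 0)] using this
    refine squeeze_zero (fun k => by have := hu0 k; positivity) (fun k => ?_) h2
    rw [← Real.rpow_mul (hu0 k), mul_comm, Real.rpow_mul (hu0 k)]
    refine Real.rpow_le_rpow (Real.rpow_nonneg (hu0 k) _) ?_ (by linarith)
    rw [le_div_iff₀ ha₁, mul_comm]
    exact hu k
  have h3 : Tendsto (fun k => (p k : ℝ) ^ 2 * Real.exp (-(w k / c))) atTop (𝓝 0) := by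
    have h4 : Tendsto (fun k => ((p k : ℝ))⁻¹) atTop (𝓝 0) :=
      tendsto_inv_atTop_zero.comp (tendsto_natCast_atTop_atTop.comp hp)
    have h5 : ∀ᶠ k in atTop, h k ^ 2 < a₂ ^ 2 / (3 * c) := by
      have := hh.pow 2
      rw [zero_pow two_ne_zero] at this
      exact this.eventually_lt_const (by positivity)
    refine squeeze_zero' (Eventually.of_forall fun k => by positivity) ?_ h4
    filter_upwards [h5, hv, hp.eventually_ge_atTop 1] with k hk ⟨hv1, hv2, hw, hwv⟩ hp1
    have hp0 : (0 : ℝ) < p k := by exact_mod_cast hp1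
    have h6 : (a₂ * v k) ^ 2 ≤ h k ^ 2 := by gcongr
    have h7 : 3 * c * v k ^ 2 ≤ 1 := by
      rw [lt_div_iff₀ (by positivity)] at hk
      have h8 : a₂ ^ 2 * (3 * c * v k ^ 2) ≤ a₂ ^ 2 * 1 := by nlinarith
      exact le_of_mul_le_mul_left h8 (by positivity)
    -- As `w = log p / v ^ 2` and `v → 0`, the exponent eventually exceeds `3 * log p`, one power of
    -- `p` more than the union bound costs.
    have h9 : 3 * Real.log (p k) ≤ w k / c := by
      rw [le_div_iff₀ hc, ← hwv]
      nlinarith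
    have h10 : Real.exp (-(w k / c)) ≤ Real.exp (-(3 * Real.log (p k))) := by gcongr
    have h11 : Real.exp (-(3 * Real.log (p k))) = ((p k : ℝ) ^ 3)⁻¹ := by
      rw [Real.exp_neg, ← Nat.cast_ofNat, Real.exp_nat_mul, Real.exp_log hp0]
    calc (p k : ℝ) ^ 2 * Real.exp (-(w k / c)) ≤ (p k : ℝ) ^ 2 * ((p k : ℝ) ^ 3)⁻¹ := by
          gcongr; exact h10.trans h11.le
      _ = (p k : ℝ)⁻¹ := by field_simp
  simpa using ((h1.const_mul κ).add h3).const_mul K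

end ChangePoint

end

/-! ### Assembly -/

theorem theorem1
    -- the sample sizes and the dimensions
    (n p : ℕ → ℕ) (hn : Tendsto n atTop atTop) (hp : Tendsto p atTop atTop)
    -- the triangular array of models
    {Ω : ℕ → Type*} [∀ k, MeasurableSpace (Ω k)] (P : ∀ k, Measure (Ω k))
    [∀ k, IsProbabilityMeasure (P k)] (X : ∀ k, ChangePoint.CausalModel (Ω k) (P k) (p k))
    -- constants that depend neither on the sample size nor on the dimension
    (q A L₀ L c₁ c₂ a₁ a₂ : ℝ) (ι : ℕ) (hq : 2 < q) (hA : 0 < A) (hL₀ : 0 < L₀) (hL : 0 < L)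
    (hc₁ : c₁ ∈ Set.Ioo (0 : ℝ) 1) (hc₂ : 0 < c₂) (ha₁ : 0 < a₁) (ha₂ : 0 < a₂)
    -- moments and dependence
    (hmoment : ChangePoint.nu2q X q ≠ ⊤)
    (hdep : ∀ k, (X k).maxDan (2 * q) A ≠ ⊤)
    -- piecewise smoothness
    (t : ℕ → Fin (ι + 2) → ℝ)
    (hpls : ∀ k, (X k).IsPLS (t k) L₀)
    (hcov : ∀ k, (X k).CovC2 (t k))
    (hcovLip : ∀ k, (X k).CovLipschitz (t k) L)
    -- separated and sizeable change points
    (hjump : ∀ k, (X k).SeparatedSizeable (t k) c₁ c₂)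
    -- the bandwidth
    (hpos : ∀ k, 0 < (X k).bandwidth q A a₁ a₂ (n k))
    (hsmall : Tendsto (fun k => (X k).bandwidth q A a₁ a₂ (n k)) atTop (𝓝 0))
    -- the estimated number of change points and the estimated change points
    (ihat : ∀ k, Ω k → ℕ) (mhat : ∀ k, Ω k → ℕ → ℕ)
    (hdetect : ∀ k ω, ChangePoint.IsDetectorOutput ((X k).obs (n k) ω) (n k)
      ((X k).bandwidth q A a₁ a₂ (n k))
      ((1 + L) * (X k).bandwidth q A a₁ a₂ (n k) ^ 2) (ihat k ω) (mhat k ω)) :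
    (∃ C₁ C₂ C₃ : ℝ, 0 < C₁ ∧ 0 < C₂ ∧ 0 < C₃ ∧ ∀ k,
      P k {ω | ihat k ω ≠ ι} ≤ ENNReal.ofReal
        (C₁ * ((p k : ℝ) * ChangePoint.varpi q A (n k) * (X k).MX q A ^ q
              * (ChangePoint.nu2q X q).toReal ^ q / ((n k : ℝ) ^ q * c₂ ^ q)) ^ (1 / 3 : ℝ)
          + C₂ * (p k : ℝ) ^ 2 * Real.exp (-(C₃
              * ((n k : ℝ) * Real.log (p k) ^ 2 / (X k).NX A ^ 2) ^ (1 / 3 : ℝ))))) ∧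
    ChangePoint.IsBigOP P
      (fun k => Set.indicator {ω | ihat k ω = ι}
        (fun ω => ChangePoint.locationError (n k) (mhat k ω) (t k)))
      (fun k => (X k).bandwidth q A a₁ a₂ (n k) ^ 2) := by
  set h : ℕ → ℝ := fun k => (X k).bandwidth q A a₁ a₂ (n k) with hh
  set ν := ChangePoint.nu2q X q with hν
  set l : ℕ → ℝ := fun k => Real.log (p k) with hl
  set w : ℕ → ℝ := fun k => ((n k : ℝ) * l k ^ 2 / (X k).NX A ^ 2) ^ (1 / 3 : ℝ) with hw
  set u : ℕ → ℝ := fun k => (n k : ℝ)⁻¹ * (X k).J q A (n k) with hu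
  have hq0 : 0 < q := by linarith
  have hdep4 : ∀ k, (X k).maxDan 4 A ≠ ⊤ := fun k =>
    ne_top_of_le_ne_top (hdep k) ((X k).maxDan_mono (by linarith) A)
  have hN : ∀ k, 0 < (X k).NX A := fun k => by
    refine lt_of_le_of_ne ENNReal.toReal_nonneg fun h0 => ?_
    exact absurd ((X k).bandwidth_eq_zero hq (hdep4 k) h0.symm a₁ a₂ (n k)) (hpos k).ne'
  have hν0 : 0 < ν.toReal := by
    refine ENNReal.toReal_pos (fun h0 => ?_) hmoment
    have h1 : (X 0).momentSup q = 0 :=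
      le_antisymm ((le_iSup (fun k => (X k).momentSup q) 0).trans h0.le) bot_le
    exact absurd ((X 0).NX_eq_zero_of_momentSup_eq_zero hq h1) (hN 0).ne'
  have hp1 : ∀ k, 1 ≤ p k := fun k => by
    by_contra! h0
    have h1 : IsEmpty (Fin (p k)) := by
      rw [Nat.lt_one_iff.1 h0]; infer_instance
    have h2 : (X k).NX A = 0 := by simp [ChangePoint.CausalModel.NX, ChangePoint.CausalModel.maxDan]
    exact absurd h2 (hN k).ne'
  obtain ⟨K, hK, hnoise⟩ := ChangePoint.exists_measure_noiseEvent_le (A := A) hq hA ha₁ ha₂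
  set κ := ν.toReal ^ (1 / (2 * q)) with hκ
  have hκ0 : 0 < κ := by positivity
  have hK0 : 0 < K := by linarith
  have huq : ∀ k, u k ^ q
      = (p k : ℝ) * ChangePoint.varpi q A (n k) * (X k).MX q A ^ q / (n k : ℝ) ^ q := fun k =>
    (X k).J_div_rpow hq0.ne' A (n k)
  have hu0 : ∀ k, 0 ≤ u k := fun k => mul_nonneg (by positivity) ((X k).J_nonneg q A (n k))
  set rate : ℕ → ℝ := fun k => K * (κ ^ q * (u k ^ q) ^ (1 / 3 : ℝ)
    + (p k : ℝ) ^ 2 * Real.exp (-(w k / (K * κ ^ 2)))) with hrate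
  have hlog : Tendsto l atTop atTop :=
    Real.tendsto_log_atTop.comp (tendsto_natCast_atTop_atTop.comp hp)
  set c₀ := (8 * L + 1) / c₂ + 1 with hc₀
  have hc₀0 : 0 < c₀ := by positivity
  -- Both conclusions follow from this: for large `k`, off an event of probability at most `rate k`,
  -- the count is right and the location error is at most `c₀ * h k ^ 2`.
  have hevent : ∀ᶠ k in atTop, P k ((X k).noiseEvent (n k) (h k)) ≤ ENNReal.ofReal (rate k) ∧
      ∀ ω, ω ∉ (X k).noiseEvent (n k) (h k) → ihat k ω = ι ∧
        ChangePoint.locationError (n k) (mhat k ω) (t k) ≤ c₀ * h k ^ 2 := by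
    have e1 : ∀ᶠ k in atTop, h k < 1 := hsmall.eventually_lt_const one_pos
    have e2 : ∀ᶠ k in atTop, 5 * h k < c₁ := by
      have := hsmall.const_mul 5
      rw [mul_zero] at this
      exact this.eventually_lt_const hc₁.1
    have e3 : ∀ᶠ k in atTop, (10 * L + 3) * h k < c₂ := by
      have := hsmall.const_mul (10 * L + 3)
      rw [mul_zero] at this
      exact this.eventually_lt_const hc₂
    have e4 : ∀ᶠ k in atTop, 2 * (c₀ * h k ^ 2) < c₁ := by
      have := ((hsmall.pow 2).const_mul c₀).const_mul 2
      rw [zero_pow two_ne_zero, mul_zero, mul_zero] at this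
      exact this.eventually_lt_const hc₁.1
    have e5 : ∀ᶠ k in atTop, 8 ≤ a₂ ^ 6 * l k :=
      (hlog.const_mul_atTop (by positivity)).eventually_ge_atTop _
    have e6 : ∀ᶠ k in atTop, 2 ≤ a₂ ^ 6 * c₂ * l k :=
      (hlog.const_mul_atTop (by positivity)).eventually_ge_atTop _
    filter_upwards [e1, e2, e3, e4, e5, e6, hn.eventually_ge_atTop 3] with k f1 f2 f3 f4 f5 f6 f7
    constructor
    · rw [← ofReal_measureReal]
      refine ENNReal.ofReal_le_ofReal ?_
      rw [hrate]
      simp only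
      rw [huq k]
      exact hnoise (P k) (X k) κ hκ0 (fun s hs j => (X k).eLpNorm_X_le hq0 hmoment
        (le_iSup (fun k => (X k).momentSup q) k) hs j) (hdep k) (n k) f7 (hpos k) (hN k)
    · intro ω hω
      exact (X k).consistent_of_notMem_noiseEvent hL.le hc₂ ha₁.le ha₂ (hdep4 k) (hpls k)
        (hcovLip k) (hjump k) rfl (hpos k) (by omega) (hN k) f1.le f2.le f3.le f4 f5 f6 hω
        (hdetect k ω)
  clear_value κ c₀
  constructor
  · obtain ⟨k₀, hk₀⟩ := eventually_atTop.1 hevent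
    obtain ⟨C₃, hC₃⟩ : ∃ C₃, C₃ = 1 / (K * κ ^ 2) := ⟨_, rfl⟩
    -- The noise bound carries `κ ^ q` where the claim has `(ν ^ q / c₂ ^ q) ^ (1 / 3)`. Both are
    -- positive constants, and `C₁` exchanges one for the other.
    obtain ⟨C₁, hC₁⟩ : ∃ C₁, C₁ = K * κ ^ q / (ν.toReal ^ q / c₂ ^ q) ^ (1 / 3 : ℝ) := ⟨_, rfl⟩
    -- The added sum makes the claimed bound at least `1` for each of the finitely many `k < k₀`, as
    -- `p k ≥ 1`.
    obtain ⟨C₂, hC₂⟩ : ∃ C₂, C₂ = K + ∑ k ∈ Finset.range k₀, Real.exp (C₃ * w k) := ⟨_, rfl⟩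
    have hsum : 0 ≤ ∑ k ∈ Finset.range k₀, Real.exp (C₃ * w k) :=
      Finset.sum_nonneg fun k _ => (Real.exp_pos _).le
    have hC₁0 : 0 < C₁ := by rw [hC₁]; positivity
    have hC₂0 : 0 < C₂ := by rw [hC₂]; linarith
    have hC₃0 : 0 < C₃ := by rw [hC₃]; positivity
    refine ⟨C₁, C₂, C₃, hC₁0, hC₂0, hC₃0, fun k => ?_⟩
    have hv := ChangePoint.varpi_nonneg q A (n k)
    have hM := (X k).MX_nonneg q A
    rcases lt_or_ge k k₀ with hk | hk
    · refine prob_le_one.trans ?_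
      rw [← ENNReal.ofReal_one]
      refine ENNReal.ofReal_le_ofReal (le_add_of_nonneg_of_le (by positivity) ?_)
      have h1 : Real.exp (C₃ * w k) ≤ C₂ :=
        (Finset.single_le_sum (f := fun k => Real.exp (C₃ * w k))
          (fun k _ => (Real.exp_pos _).le) (Finset.mem_range.2 hk)).trans (by linarith)
      have h2 : (1 : ℝ) ≤ (p k : ℝ) ^ 2 := one_le_pow₀ (by exact_mod_cast hp1 k)
      calc (1 : ℝ) = Real.exp (C₃ * w k) * 1 * Real.exp (-(C₃ * w k)) := by
            rw [mul_one, ← Real.exp_add, add_neg_cancel, Real.exp_zero]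
        _ ≤ C₂ * (p k : ℝ) ^ 2 * Real.exp (-(C₃ * w k)) := by gcongr
    · obtain ⟨h1, h2⟩ := hk₀ k hk
      have h3 : {ω | ihat k ω ≠ ι} ⊆ (X k).noiseEvent (n k) (h k) := fun ω hω => by
        by_contra h4
        exact hω (h2 ω h4).1
      refine (measure_mono h3).trans (h1.trans (ENNReal.ofReal_le_ofReal ?_))
      have e1 : (p k : ℝ) * ChangePoint.varpi q A (n k) * (X k).MX q A ^ q * ν.toReal ^ q
          / ((n k : ℝ) ^ q * c₂ ^ q) = u k ^ q * (ν.toReal ^ q / c₂ ^ q) := by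
        rw [huq k]; ring
      have e2 : C₁ * (u k ^ q * (ν.toReal ^ q / c₂ ^ q)) ^ (1 / 3 : ℝ)
          = K * (κ ^ q * (u k ^ q) ^ (1 / 3 : ℝ)) := by
        rw [Real.mul_rpow (Real.rpow_nonneg (hu0 k) q) (by positivity), hC₁]
        have : 0 < (ν.toReal ^ q / c₂ ^ q) ^ (1 / 3 : ℝ) := by positivity
        field_simp
      rw [e1, e2, hrate]
      simp only
      rw [mul_add, mul_assoc C₂]
      refine add_le_add le_rfl (mul_le_mul (by linarith) (le_of_eq ?_) (by positivity)
        (by positivity))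
      rw [hC₃, one_div_mul_eq_div]
  · intro δ hδ
    have hrate0 : Tendsto rate atTop (𝓝 0) := by
      refine ChangePoint.tendsto_rate (a₂ := a₂) hq ha₁ ha₂ (by positivity) hp hsmall hu0
        (fun k => ((X k).bandwidth_terms_le ha₁.le ha₂.le (n k)).1) hpos
        (v := fun k => (X k).NX A ^ (1 / 3 : ℝ) * (n k : ℝ) ^ (-(1 / 6) : ℝ) * l k ^ (1 / 6 : ℝ)) ?_
      filter_upwards [hn.eventually_ge_atTop 1] with k hk
      obtain ⟨v', w', hv, hw', h1, h2, -, -, h3⟩ := ChangePoint.exists_calibration (hN k)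
        (n := (n k : ℝ)) (by exact_mod_cast hk) (Real.log_natCast_nonneg (p k))
      refine ⟨((X k).bandwidth_terms_le (q := q) ha₁.le ha₂.le (n k)).2, hv ▸ h1, by rw [hw'] at h2; exact h2, ?_⟩
      rw [hw', hv] at h3
      exact h3
    obtain ⟨k₀, hk₀⟩ := eventually_atTop.1 (hevent.and (hrate0.eventually_lt_const hδ))
    have hsum : 0 ≤ ∑ k ∈ Finset.range k₀, 1 / h k ^ 2 :=
      Finset.sum_nonneg fun k _ => by have := hpos k; positivity
    -- For `k < k₀` the error is at most `1`, so its ratio to `h k ^ 2` never exceeds the added sum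
    -- and the event is empty.
    refine ⟨c₀ + ∑ k ∈ Finset.range k₀, 1 / h k ^ 2, by positivity, fun k => ?_⟩
    have hh0 : 0 < h k ^ 2 := pow_pos (hpos k) 2
    rcases lt_or_ge k k₀ with hk | hk
    · have hempty : {ω | c₀ + ∑ k ∈ Finset.range k₀, 1 / h k ^ 2
          < |Set.indicator {ω | ihat k ω = ι}
            (fun ω => ChangePoint.locationError (n k) (mhat k ω) (t k)) ω| / h k ^ 2} = ∅ := by
        refine Set.eq_empty_of_forall_notMem fun ω hω => ?_
        rw [Set.mem_ofPred_eq] at hω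
        refine absurd hω (not_lt.2 ?_)
        have h1 : 1 / h k ^ 2 ≤ ∑ k ∈ Finset.range k₀, 1 / h k ^ 2 :=
          Finset.single_le_sum (f := fun k => 1 / h k ^ 2)
            (fun k _ => by have := hpos k; positivity) (Finset.mem_range.2 hk)
        refine le_trans ?_ (h1.trans (le_add_of_nonneg_left hc₀0.le))
        gcongr
        by_cases hω' : ihat k ω = ι
        · rw [Set.indicator_of_mem (show ω ∈ {ω | ihat k ω = ι} from hω'), abs_of_nonneg (ChangePoint.locationError_nonneg _ _ _)]
          exact (hω' ▸ hdetect k ω).locationError_le_one (hpls k).partition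
        · rw [Set.indicator_of_notMem (show ω ∉ {ω | ihat k ω = ι} from hω'), abs_zero]
          exact zero_le_one
      rw [hempty, measure_empty]
      exact ENNReal.ofReal_pos.2 hδ
    · obtain ⟨⟨h1, h2⟩, h3⟩ := hk₀ k hk
      refine lt_of_le_of_lt ((measure_mono fun ω hω => ?_).trans h1)
        ((ENNReal.ofReal_lt_ofReal_iff hδ).2 h3)
      by_contra h4
      obtain ⟨h5, h6⟩ := h2 ω h4
      simp only [Set.mem_ofPred_eq] at hω
      refine absurd hω (not_lt.2 ?_)
      change _ / h k ^ 2 ≤ _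
      rw [Set.indicator_of_mem (show ω ∈ {ω | ihat k ω = ι} from h5), abs_of_nonneg (ChangePoint.locationError_nonneg _ _ _),
        div_le_iff₀ hh0]
      refine h6.trans ?_
      gcongr
      linarith
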